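/- Fix $l\in\mathbb N$ and a polynomial $p\in\mathbb N[X]$. An instance of \textsc{Weight-$k$ $l$-Local Hamiltonian} consists of a positive integer $k$ (the parameter), a number $n$ of qubits (both $k$ and $n$ written in unary), a Hamiltonian $H=\sum_i H_i$ on $n$ qubits with at most $p(n)$ terms, each $H_i$ being Hermitian, acting non-trivially on at most $l$ qubits, with operator norm at most $p(n)$, and given by its matrix on those qubits with entries in $\mathbb Q(i)$ (written in binary), and rational numbers $a,b\in(0,1)$ with $b-a>1/p(n)$. An $n$-qubit state has weight $k$ if it is a superposition of computational basis states of Hamming weight $k$. The task is to decide whether some weight-$k$ state satisfies $\langle\psi|H|\psi\rangle\le a$ (yes) or every weight-$k$ state satisfies $\langle\psi|H|\psi\rangle\ge b$ (no), given the promise that one of these holds. A parameterized (promise) problem is in $\mathsf{XP}$ if its parameter is a polynomial-time computable function of the input string and, for every $k\ge1$, its $k$-th slice (the yes-instances being those with parameter $k$, and all strings with a different parameter being no-instances) is in $\mathsf P$. **Proposition.** 1. For all $l$ and $p$, \textsc{Weight-$k$ $l$-Local Hamiltonian} is in $\mathsf{XP}$. 2. The span of the $n$-qubit computational basis states of Hamming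 weight $k$ has dimension at most $n^k$. 3. There are a deterministic Turing machine and a constant $c$ such that, for all $1\le k\le n$, all $t\in\mathbb N$ and every sum $H$ of Hermitian local terms on $n$ qubits (presented as above, with any number of terms of any locality and norm), the machine on input $(k,n,H,t)$, with $t$ in unary, outputs in at most $c\,N^{ck}$ steps an integer $z$ with $|\lambda_{\min}-z/2^t|\le 2^{-t}$. Here $N$ is the length of the input (so that $N^{ck}=n^{O(k)}$ when $N$ is polynomial in $n$), and $\lambda_{\min}$ is the smallest eigenvalue of the restriction $(\langle x|H|y\rangle)_{x,y}$ of $H$ to the basis states $x,y$ of Hamming weight $k$. 4. In contrast, \textsc{Weight-$k$ Quantum Circuit Satisfiability} is not in $\mathsf{XP}$ unless $\mathsf P=\mathsf{BQP}$ (as classes of promise problems over $\{0,1\}$). Its instances consist of $k\geq 1$ (the parameter), a quantum circuit over $\{H,T,\mathrm{CNOT}\}$ with $n$ witness qubits and at most $q(n)$ ancilla qubits initialized to $|0\rangle$, and rationals $a,b\in(0,1)$ with $b-a>1/q(n)$; the task is to decide whether some $n$-qubit weight-$k$ witness state is accepted with probability at least $b$ or every such state is accepted with probability at most $a$, given the promise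 that one of these holds. The assertion holds for every polynomial $q\in\mathbb N[X]$ with $q(n)\ge n$ for all $n$. -/

import Mathlib

noncomputable section

namespace ParamQC

open Turing Computability

/-! ### Deterministic polynomial time, promise problems, slice-wise polynomial time -/

/-- On input `x` the (multi-stack) Turing machine `M` halts with output `y` after at most `T`
steps. -/
def OutputsWithin {Γ Δ : Type} (M : TM2ComputableAux Γ Δ) (x : List Γ) (y : List Δ) (T : ℕ) :
    Prop :=
  Nonempty (TM2OutputsInTime M.tm (x.map M.inputAlphabet.invFun)
    (some (y.map M.outputAlphabet.invFun)) T)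

/-- A promise problem over the alphabet `Γ`: disjoint sets of yes- and no-instances. -/
structure PromiseProblem (Γ : Type) where
  yes : Set (List Γ)
  no : Set (List Γ)
  disj : Disjoint yes no

/-- The class `P` of promise problems over `Γ`: a deterministic Turing machine answers correctly in
polynomial time on every input that satisfies the promise. -/
def classP (Γ : Type) : Set (PromiseProblem Γ) :=
  {A | ∃ (M : TM2ComputableAux Γ Bool) (q : Polynomial ℕ),
    (∀ x ∈ A.yes, OutputsWithin M x [true] (q.eval x.length)) ∧
    (∀ x ∈ A.no, OutputsWithin M x [false] (q.eval x.length))}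

/-- A promise problem together with a map that assigns a positive parameter to every string. -/
structure ParamProblem (Γ : Type) where
  problem : PromiseProblem Γ
  κ : List Γ → ℕ+

/-- The `l`-th slice, that is the problem of recognizing the yes-instances with parameter `l`:
strings with a different parameter are no-instances. -/
def ParamProblem.slice {Γ : Type} (A : ParamProblem Γ) (l : ℕ+) : PromiseProblem Γ where
  yes := {x | x ∈ A.problem.yes ∧ A.κ x = l}
  no := {x | (x ∈ A.problem.no ∧ A.κ x = l) ∨ A.κ x ≠ l}
  disj := by
    rw [Set.disjoint_left]
    rintro x ⟨hx, hl⟩ (⟨hn, -⟩ | hn)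
    · exact Set.disjoint_left.mp A.problem.disj hx hn
    · exact hn hl

/-- The class `XP`: the parameterization is polynomial-time computable (the parameter being written
in binary) and every slice is in `P`. -/
def classXP (Γ : Type) : Set (ParamProblem Γ) :=
  {A | Nonempty (TM2ComputableInPolyTime (id : List Γ → List Γ)
      (fun m : ℕ+ => encodeNat (m : ℕ)) A.κ) ∧
    ∀ l : ℕ+, A.slice l ∈ classP Γ}

/-! ### Encodings of finite objects as strings -/

/-- The alphabet of encodings: the bits `some false`, `some true` and the separator `none`. -/
abbrev Symbol := Option Bool

def encUnary (m : ℕ) : List Symbol := List.replicate m (some true) ++ [none]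

def encNat (m : ℕ) : List Symbol := (encodeNat m).map some ++ [none]

def encInt (z : ℤ) : List Symbol := some (decide (z < 0)) :: encNat z.natAbs

/-- Numerator and denominator, in lowest terms. -/
def encRat (q : ℚ) : List Symbol := encInt q.num ++ encNat q.den

def encList {α : Type} (f : α → List Symbol) (L : List α) : List Symbol :=
  encUnary L.length ++ L.flatMap f

/-- The parameter is written in unary at the beginning of an instance (and is `1` on strings that
do not begin with a positive number in unary). -/
def leadingParam (x : List Symbol) : ℕ+ :=
  (x.takeWhile (· == some true)).length.toPNat'

/-! ### Quantum states of given Hamming weight -/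

/-- Number of ones of a bit string. -/
def hammingWeight {n : ℕ} (x : Fin n → Bool) : ℕ := (Finset.univ.filter (fun i => x i = true)).card

/-- Unit vectors of the `n`-qubit space, given by their amplitudes in the computational basis. -/
def IsState {n : ℕ} (ψ : (Fin n → Bool) → ℂ) : Prop := ∑ x, ‖ψ x‖ ^ 2 = 1

def HasWeight {n : ℕ} (k : ℕ) (ψ : (Fin n → Bool) → ℂ) : Prop :=
  ∀ x, hammingWeight x ≠ k → ψ x = 0

/-- The span of the computational basis states of Hamming weight `k`. -/
def weightSpace (n k : ℕ) : Submodule ℂ ((Fin n → Bool) → ℂ) :=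
  Submodule.span ℂ {ψ | ∃ x : Fin n → Bool, hammingWeight x = k ∧ ψ = Pi.single x 1}

/-! ### Local Hamiltonians -/

/-- A term acting on `arity` distinct qubits out of `n`, given by the real and imaginary parts of
the entries of its matrix on these qubits. -/
structure LocalTerm (n : ℕ) where
  arity : ℕ
  qubit : Fin arity ↪ Fin n
  re : (Fin arity → Bool) → (Fin arity → Bool) → ℚ
  im : (Fin arity → Bool) → (Fin arity → Bool) → ℚ

/-- The operator of a term on all `n` qubits: the given matrix on its qubits, tensored with the
identity on the other qubits. -/
def LocalTerm.op {n : ℕ} (h : LocalTerm n) : Matrix (Fin n → Bool) (Fin n → Bool) ℂ :=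
  open Classical in
  Matrix.of fun x y =>
    if ∀ i, i ∉ Set.range h.qubit → x i = y i then
      ⟨(h.re (x ∘ h.qubit) (y ∘ h.qubit) : ℝ), (h.im (x ∘ h.qubit) (y ∘ h.qubit) : ℝ)⟩
    else 0

/-- A sum of local terms. -/
abbrev Hamiltonian (n : ℕ) := List (LocalTerm n)

def Hamiltonian.op {n : ℕ} (H : Hamiltonian n) : Matrix (Fin n → Bool) (Fin n → Bool) ℂ :=
  (List.map LocalTerm.op H).sum

def Hamiltonian.TermsHermitian {n : ℕ} (H : Hamiltonian n) : Prop :=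
  ∀ h ∈ H, h.op.IsHermitian

/-- The energy `⟨ψ|H|ψ⟩` (which is real for Hermitian `H`). -/
def Hamiltonian.energy {n : ℕ} (H : Hamiltonian n) (ψ : (Fin n → Bool) → ℂ) : ℝ :=
  (star ψ ⬝ᵥ H.op.mulVec ψ).re

/-- The matrix of the Hamiltonian restricted to the span of the weight-`k` basis states. -/
def Hamiltonian.restrict {n : ℕ} (H : Hamiltonian n) (k : ℕ) :
    Matrix {x : Fin n → Bool // hammingWeight x = k} {x : Fin n → Bool // hammingWeight x = k} ℂ :=
  H.op.submatrix Subtype.val Subtype.val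

/-- The real number `lam` is the smallest eigenvalue of the square complex matrix `A`. -/
def IsSmallestEigenvalue {ι : Type} [Fintype ι] [DecidableEq ι] (A : Matrix ι ι ℂ) (lam : ℝ) :
    Prop :=
  IsLeast {μ : ℝ | Module.End.HasEigenvalue (Matrix.toLin' A) (μ : ℂ)} lam

/-- The bit string of length `r` that is the binary expansion of `j`. -/
def bitString (r j : ℕ) : Fin r → Bool := fun i => j.testBit i

/-- The arity, the qubits in unary, and the matrix entries row by row. -/
def LocalTerm.encode {n : ℕ} (h : LocalTerm n) : List Symbol :=
  encUnary h.arity ++ (List.finRange h.arity).flatMap (fun i => encUnary (h.qubit i)) ++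
    (List.range (2 ^ h.arity)).flatMap fun i =>
      (List.range (2 ^ h.arity)).flatMap fun j =>
        encRat (h.re (bitString _ i) (bitString _ j)) ++
          encRat (h.im (bitString _ i) (bitString _ j))

/-- The parameter, the number of qubits (both in unary), and the terms. -/
def encHamiltonian (k : ℕ) {n : ℕ} (H : Hamiltonian n) : List Symbol :=
  encUnary k ++ encUnary n ++ encList LocalTerm.encode H

structure LHInstance where
  k : ℕ
  n : ℕ
  H : Hamiltonian n
  a : ℚ
  b : ℚ

def LHInstance.encode (I : LHInstance) : List Symbol :=
  encHamiltonian I.k I.H ++ encRat I.a ++ encRat I.b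

/-- The conditions on instances of Weight-`k` `l`-Local Hamiltonian, with the polynomial bounds all
given by `p`. The last one says `b - a > 1 / p(n)`. -/
structure LHInstance.Valid (l : ℕ) (p : Polynomial ℕ) (I : LHInstance) : Prop where
  k_pos : 0 < I.k
  hermitian : I.H.TermsHermitian
  isLocal : ∀ h ∈ I.H, h.arity ≤ l
  terms_le : List.length I.H ≤ p.eval I.n
  norm_le : ∀ h ∈ I.H, ‖Matrix.toEuclideanCLM (𝕜 := ℂ) h.op‖ ≤ ((p.eval I.n : ℕ) : ℝ)
  a_mem : I.a ∈ Set.Ioo (0 : ℚ) 1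
  b_mem : I.b ∈ Set.Ioo (0 : ℚ) 1
  gap : 1 < (I.b - I.a) * ((p.eval I.n : ℕ) : ℚ)

def LHInstance.IsYes (I : LHInstance) : Prop :=
  ∃ ψ, IsState ψ ∧ HasWeight I.k ψ ∧ I.H.energy ψ ≤ (I.a : ℝ)

def LHInstance.IsNo (I : LHInstance) : Prop :=
  ∀ ψ, IsState ψ → HasWeight I.k ψ → (I.b : ℝ) ≤ I.H.energy ψ

/-! ### Quantum circuits -/

/-- Gates on `N` qubits, from the universal gate set `{H, T, CNOT}`. -/
inductive Gate (N : ℕ) where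
  | hadamard (i : Fin N)
  | phase (i : Fin N)
  | cnot (c t : Fin N) (h : c ≠ t)

def Gate.op {N : ℕ} : Gate N → Matrix (Fin N → Bool) (Fin N → Bool) ℂ
  | .hadamard i => Matrix.of fun x y =>
      if ∀ j, j ≠ i → x j = y j then
        (if x i = true ∧ y i = true then -1 else 1) / (Real.sqrt 2 : ℂ) else 0
  | .phase i => Matrix.diagonal fun x =>
      if x i = true then Complex.exp (Complex.I * (Real.pi / 4)) else 1
  | .cnot c t _ => Matrix.of fun x y =>
      if x = Function.update y t (xor (y t) (y c)) then 1 else 0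

/-- A circuit on `n` witness qubits and `m` ancilla qubits with a designated output qubit. The
qubits `0, …, m - 1` are the ancillas, the qubits `m, …, m + n - 1` hold the witness. The gates are
applied in the order of the list. -/
structure Circuit (n m : ℕ) where
  out : Fin (m + n)
  gates : List (Gate (m + n))

/-- The witness `ψ` together with ancillas in the state `|0⟩`. -/
def initialState {n : ℕ} (m : ℕ) (ψ : (Fin n → Bool) → ℂ) : (Fin (m + n) → Bool) → ℂ :=
  fun x => if ∀ i : Fin m, x (Fin.castAdd n i) = false then ψ (fun j => x (Fin.natAdd m j)) else 0

def Circuit.run {n m : ℕ} (C : Circuit n m) (ψ : (Fin n → Bool) → ℂ) :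
    (Fin (m + n) → Bool) → ℂ :=
  C.gates.foldl (fun φ g => g.op.mulVec φ) (initialState m ψ)

/-- The probability that measuring the output qubit yields `1`. -/
def Circuit.acceptProb {n m : ℕ} (C : Circuit n m) (ψ : (Fin n → Bool) → ℂ) : ℝ :=
  ∑ x, if x C.out = true then ‖C.run ψ x‖ ^ 2 else 0

def Gate.encode {N : ℕ} : Gate N → List Symbol
  | .hadamard i => some false :: encUnary i
  | .phase i => some true :: some false :: encUnary i
  | .cnot c t _ => some true :: some true :: (encUnary c ++ encUnary t)

def Circuit.encode {n m : ℕ} (C : Circuit n m) : List Symbol :=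
  encUnary n ++ encUnary m ++ encUnary C.out ++ encList Gate.encode C.gates

/-- The class `BQP` of promise problems over `Γ`: a deterministic polynomial-time Turing machine
maps an input `x` to the description of a quantum circuit which, run on the all-zero state, accepts
with probability at least `2/3` on yes-instances and at most `1/3` on no-instances. -/
def classBQP (Γ : Type) : Set (PromiseProblem Γ) :=
  {A | ∃ (M : TM2ComputableAux Γ Symbol) (q : Polynomial ℕ),
    (∀ x ∈ A.yes, ∃ (m : ℕ) (C : Circuit 0 m), OutputsWithin M x C.encode (q.eval x.length) ∧
      2 / 3 ≤ C.acceptProb (fun _ => 1)) ∧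
    (∀ x ∈ A.no, ∃ (m : ℕ) (C : Circuit 0 m), OutputsWithin M x C.encode (q.eval x.length) ∧
      C.acceptProb (fun _ => 1) ≤ 1 / 3)}

structure QCSatInstance where
  k : ℕ
  n : ℕ
  m : ℕ
  C : Circuit n m
  a : ℚ
  b : ℚ

def QCSatInstance.encode (I : QCSatInstance) : List Symbol :=
  encUnary I.k ++ I.C.encode ++ encRat I.a ++ encRat I.b

/-- The conditions on instances of Weight-`k` Quantum Circuit Satisfiability, with the polynomial
bounds both given by `p`. The last one says `b - a > 1 / p(n)`. -/
structure QCSatInstance.Valid (p : Polynomial ℕ) (I : QCSatInstance) : Prop where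
  k_pos : 0 < I.k
  ancillas_le : I.m ≤ p.eval I.n
  a_mem : I.a ∈ Set.Ioo (0 : ℚ) 1
  b_mem : I.b ∈ Set.Ioo (0 : ℚ) 1
  gap : 1 < (I.b - I.a) * ((p.eval I.n : ℕ) : ℚ)

def QCSatInstance.IsYes (I : QCSatInstance) : Prop :=
  ∃ ψ, IsState ψ ∧ HasWeight I.k ψ ∧ (I.b : ℝ) ≤ I.C.acceptProb ψ

def QCSatInstance.IsNo (I : QCSatInstance) : Prop :=
  ∀ ψ, IsState ψ → HasWeight I.k ψ → I.C.acceptProb ψ ≤ (I.a : ℝ)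

/-! ### The encodings are injective -/

/-- `f` is an injective prefix code. -/
def PrefixInj {α : Type} (f : α → List Symbol) : Prop :=
  ∀ a b s t, f a ++ s = f b ++ t → a = b ∧ s = t

theorem encUnary_prefixInj : PrefixInj encUnary := by
  intro a
  induction a with
  | zero =>
    intro b s t h
    cases b with
    | zero => simpa [encUnary] using h
    | succ b => simp [encUnary, List.replicate_succ] at h
  | succ a ih =>
    intro b s t h
    cases b with
    | zero => simp [encUnary, List.replicate_succ] at h
    | succ b =>
      have h' : encUnary a ++ s = encUnary b ++ t := by
        simpa [encUnary, List.replicate_succ] using h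
      obtain ⟨rfl, rfl⟩ := ih b s t h'
      exact ⟨rfl, rfl⟩

theorem map_some_prefix (u : List Bool) : ∀ (v : List Bool) (s t : List Symbol),
    u.map some ++ none :: s = v.map some ++ none :: t → u = v ∧ s = t := by
  induction u with
  | nil =>
    intro v s t h
    cases v <;> simp_all
  | cons x u ih =>
    intro v s t h
    cases v with
    | nil => simp at h
    | cons y v =>
      simp only [List.map_cons, List.cons_append, List.cons.injEq, Option.some.injEq] at h
      obtain ⟨rfl, rfl⟩ := ih v s t h.2
      exact ⟨by rw [h.1], rfl⟩

theorem encNat_prefixInj : PrefixInj encNat := by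
  intro a b s t h
  obtain ⟨h1, h2⟩ := map_some_prefix (encodeNat a) (encodeNat b) s t (by simpa [encNat] using h)
  exact ⟨by rw [← decode_encodeNat a, h1, decode_encodeNat], h2⟩

theorem encInt_prefixInj : PrefixInj encInt := by
  intro a b s t h
  simp only [encInt, List.cons_append, List.cons.injEq, Option.some.injEq,
    decide_eq_decide] at h
  obtain ⟨h1, h2⟩ := encNat_prefixInj _ _ _ _ h.2
  exact ⟨by omega, h2⟩

theorem encRat_prefixInj : PrefixInj encRat := by
  intro a b s t h
  simp only [encRat, List.append_assoc] at h
  obtain ⟨h1, h2⟩ := encInt_prefixInj _ _ _ _ h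
  obtain ⟨h3, h4⟩ := encNat_prefixInj _ _ _ _ h2
  exact ⟨Rat.ext h1 h3, h4⟩

theorem flatMap_prefix {ι : Type} (f g : ι → List Symbol) (P : ι → Prop)
    (hfg : ∀ i s t, f i ++ s = g i ++ t → P i ∧ s = t) (L : List ι) :
    ∀ s t, L.flatMap f ++ s = L.flatMap g ++ t → (∀ i ∈ L, P i) ∧ s = t := by
  induction L with
  | nil => intro s t h; simpa using h
  | cons i L ih =>
    intro s t h
    simp only [List.flatMap_cons, List.append_assoc] at h
    obtain ⟨h1, h2⟩ := hfg _ _ _ h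
    obtain ⟨h3, h4⟩ := ih _ _ h2
    exact ⟨by simpa using ⟨h1, h3⟩, h4⟩

theorem encList_prefixInj {α : Type} {f : α → List Symbol} (hf : PrefixInj f) :
    PrefixInj (encList f) := by
  have key : ∀ (L L' : List α) (s t : List Symbol), L.length = L'.length →
      L.flatMap f ++ s = L'.flatMap f ++ t → L = L' ∧ s = t := by
    intro L
    induction L with
    | nil =>
      intro L' s t hl h
      cases L' with
      | nil => simpa using h
      | cons => simp at hl
    | cons x L ih =>
      intro L' s t hl h
      cases L' with
      | nil => simp at hl
      | cons y L' =>
        simp only [List.flatMap_cons, List.append_assoc] at h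
        obtain ⟨rfl, h2⟩ := hf _ _ _ _ h
        obtain ⟨rfl, rfl⟩ := ih L' s t (by simpa using hl) h2
        exact ⟨rfl, rfl⟩
  intro L L' s t h
  simp only [encList, List.append_assoc] at h
  obtain ⟨h1, h2⟩ := encUnary_prefixInj _ _ _ _ h
  exact key L L' s t h1 h2

theorem exists_bitString {r : ℕ} (x : Fin r → Bool) : ∃ j ∈ List.range (2 ^ r),
    bitString r j = x := by
  refine ⟨(BitVec.ofFnLE x).toNat, by simpa using (BitVec.ofFnLE x).isLt, ?_⟩
  funext i
  simp [bitString]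

theorem LocalTerm.encode_prefixInj {n : ℕ} : PrefixInj (LocalTerm.encode (n := n)) := by
  rintro ⟨r, q, re, im⟩ ⟨r', q', re', im'⟩ s t h
  simp only [LocalTerm.encode, List.append_assoc] at h
  obtain ⟨rfl, w1⟩ := encUnary_prefixInj _ _ _ _ h
  obtain ⟨hq, w2⟩ := flatMap_prefix _ _ (fun i => q i = q' i) (fun i s t hi => by
    obtain ⟨h1, h2⟩ := encUnary_prefixInj _ _ _ _ hi
    exact ⟨Fin.ext h1, h2⟩) _ _ _ w1
  obtain ⟨he, w3⟩ := flatMap_prefix _ _ (fun i => ∀ j ∈ List.range (2 ^ r),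
      re (bitString _ i) (bitString _ j) = re' (bitString _ i) (bitString _ j) ∧
      im (bitString _ i) (bitString _ j) = im' (bitString _ i) (bitString _ j))
    (fun i s t hi => flatMap_prefix _ _ _ (fun j s t hj => by
      simp only [List.append_assoc] at hj
      obtain ⟨h1, hj⟩ := encRat_prefixInj _ _ _ _ hj
      obtain ⟨h2, h3⟩ := encRat_prefixInj _ _ _ _ hj
      exact ⟨⟨h1, h2⟩, h3⟩) _ _ _ hi) _ _ _ w2
  obtain rfl : q = q' := by ext i; rw [hq i (List.mem_finRange i)]
  have hre : ∀ x y, re x y = re' x y ∧ im x y = im' x y := by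
    intro x y
    obtain ⟨i, hi, rfl⟩ := exists_bitString x
    obtain ⟨j, hj, rfl⟩ := exists_bitString y
    exact he i hi j hj
  obtain rfl : re = re' := by funext x y; exact (hre x y).1
  obtain rfl : im = im' := by funext x y; exact (hre x y).2
  exact ⟨rfl, w3⟩

theorem LHInstance.encode_injective : Function.Injective LHInstance.encode := by
  rintro ⟨k, n, H, a, b⟩ ⟨k', n', H', a', b'⟩ h
  simp only [LHInstance.encode, encHamiltonian, List.append_assoc] at h
  obtain ⟨rfl, w1⟩ := encUnary_prefixInj _ _ _ _ h
  obtain ⟨rfl, w2⟩ := encUnary_prefixInj _ _ _ _ w1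
  obtain ⟨rfl, w3⟩ := encList_prefixInj LocalTerm.encode_prefixInj _ _ _ _ w2
  obtain ⟨rfl, w4⟩ := encRat_prefixInj _ _ _ _ w3
  obtain ⟨rfl, -⟩ := encRat_prefixInj b b' [] [] (by simpa using w4)
  rfl

theorem Gate.encode_prefixInj {N : ℕ} : PrefixInj (Gate.encode (N := N)) := by
  intro g g' s t h
  cases g <;> cases g' <;> simp [Gate.encode] at h
  · obtain ⟨h1, rfl⟩ := encUnary_prefixInj _ _ _ _ h
    exact ⟨by rw [Fin.ext h1], rfl⟩
  · obtain ⟨h1, rfl⟩ := encUnary_prefixInj _ _ _ _ h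
    exact ⟨by rw [Fin.ext h1], rfl⟩
  · obtain ⟨h1, h⟩ := encUnary_prefixInj _ _ _ _ h
    obtain ⟨h2, rfl⟩ := encUnary_prefixInj _ _ _ _ h
    obtain rfl := Fin.ext h1
    obtain rfl := Fin.ext h2
    exact ⟨rfl, rfl⟩

theorem QCSatInstance.encode_injective : Function.Injective QCSatInstance.encode := by
  rintro ⟨k, n, m, ⟨o, G⟩, a, b⟩ ⟨k', n', m', ⟨o', G'⟩, a', b'⟩ h
  simp only [QCSatInstance.encode, Circuit.encode, List.append_assoc] at h
  obtain ⟨rfl, w1⟩ := encUnary_prefixInj _ _ _ _ h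
  obtain ⟨rfl, w2⟩ := encUnary_prefixInj _ _ _ _ w1
  obtain ⟨rfl, w3⟩ := encUnary_prefixInj _ _ _ _ w2
  obtain ⟨h1, w4⟩ := encUnary_prefixInj _ _ _ _ w3
  obtain rfl := Fin.ext h1
  obtain ⟨rfl, w5⟩ := encList_prefixInj Gate.encode_prefixInj _ _ _ _ w4
  obtain ⟨rfl, w6⟩ := encRat_prefixInj _ _ _ _ w5
  obtain ⟨rfl, -⟩ := encRat_prefixInj b b' [] [] (by simpa using w6)
  rfl

theorem lt_of_gap {a b : ℚ} {m : ℕ} (h : 1 < (b - a) * (m : ℚ)) : (a : ℝ) < b := by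
  have h0 : (0 : ℚ) ≤ m := Nat.cast_nonneg m
  have : a < b := by
    by_contra hab
    nlinarith [mul_nonneg (sub_nonneg.mpr (not_lt.mp hab)) h0]
  exact_mod_cast this

/-! ### The two parameterized problems -/

/-- Weight-`k` `l`-Local Hamiltonian with parameter `k`. -/
def weightLocalHamiltonian (l : ℕ) (p : Polynomial ℕ) : ParamProblem Symbol where
  problem :=
    { yes := {x | ∃ I : LHInstance, I.Valid l p ∧ I.IsYes ∧ x = I.encode}
      no := {x | ∃ I : LHInstance, I.Valid l p ∧ I.IsNo ∧ x = I.encode}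
      disj := by
        rw [Set.disjoint_left]
        rintro x ⟨I, hI, ⟨ψ, h1, h2, h3⟩, rfl⟩ ⟨J, -, hJ, h⟩
        obtain rfl := LHInstance.encode_injective h
        exact absurd (lt_of_gap hI.gap) (not_lt.mpr ((hJ ψ h1 h2).trans h3)) }
  κ := leadingParam

/-- Weight-`k` Quantum Circuit Satisfiability with parameter `k`. -/
def weightQuantumCircuitSat (p : Polynomial ℕ) : ParamProblem Symbol where
  problem :=
    { yes := {x | ∃ I : QCSatInstance, I.Valid p ∧ I.IsYes ∧ x = I.encode}
      no := {x | ∃ I : QCSatInstance, I.Valid p ∧ I.IsNo ∧ x = I.encode}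
      disj := by
        rw [Set.disjoint_left]
        rintro x ⟨I, hI, ⟨ψ, h1, h2, h3⟩, rfl⟩ ⟨J, -, hJ, h⟩
        obtain rfl := QCSatInstance.encode_injective h
        exact absurd (lt_of_gap hI.gap) (not_lt.mpr (h3.trans (hJ ψ h1 h2))) }
  κ := leadingParam

end ParamQC

end

noncomputable section

namespace ParamQC

open Turing Computability

/-! ### Structured programs over finitely many stacks -/

/-! On the weight-k sector a Hamiltonian is a Hermitian matrix B whose size is the number of
k-subsets of the n qubits. This number is at most n^k, which is the dimension bound, so exact linear
algebra costs n^{O(k)} operations. Everything is reduced to one test: is B - c positive definite for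
a rational c? Some state of weight k has energy at most a only if B - a is not positive definite,
and if all such states have energy at least b > a then B - a is positive definite
(`not_posDef_of_energy_le`, `posDef_of_lt_energy`). The smallest eigenvalue is the threshold of the
same test (`exists_isSmallestEigenvalue`), so a binary search for z with z < 2^t λ ≤ z + 1 gives the
approximation.

The test is carried out over the integers. Multiplication by a common multiple of the denominators
clears fractions, and the block matrix [[Re, -Im], [Im, Re]] replaces a Hermitian matrix by a real
symmetric one (`realify_posDef_iff`). For a symmetric matrix a division-free Faddeev–LeVerrier
recursion yields positive multiples of the elementary symmetric functions of the eigenvalues, by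
Newton's identities (`leVerrier_eq_sum`). Real numbers are all positive exactly when these functions
are (`forall_pos_iff_forall_esymm_pos`). The bit length of the entries grows by a bounded amount in
each step of the recursion (`leVerrierStep_bound`), so the test takes polynomial time in the size of
the listed matrix.

To obtain actual Turing machines, structured programs on stacks are compiled to machines
(`Exec.steps`), data are stored as prefix codes of binary trees, and `PT` collects the functions
that such programs compute in polynomial time. It is closed under composition, pairing, case
distinction and folds whose intermediate values have polynomial size (`PTm.foldl`); lists, binary
arithmetic and matrices follow. `PTm` measures time against an arbitrary function of the input. This
is needed because listing the basis takes about n^k steps: polynomial for fixed k, which gives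
membership in `XP`, and N^{O(k)} when k is part of the input.

For circuits, a computation in `BQP` is a circuit without witness. Adding idle witness qubits
produces an instance with k = 1 whose acceptance probability does not depend on the witness
(`Circuit.lift_acceptProb`). A polynomial-time decision of the first slice, composed with the
machine that generates the circuits, therefore places `BQP` in `P`. Conversely, a deterministic
answer can be turned into one of two fixed circuits that accept with probability 1 or 0. -/

/-- Structured programs that operate on stacks of symbols. -/
inductive Prog (K : Type) : Type
  | skip : Prog K
  | push (k : K) (a : Symbol) : Prog K
  | case (k : K) (f : Option Symbol → Prog K) : Prog K
  | seq (p q : Prog K) : Prog K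
  | loop (k : K) (S : Option Symbol → Bool) (p : Prog K) : Prog K

/-- `Exec p s n s'`: started with stacks `s`, the program `p` ends after `n` steps with stacks
`s'`. -/
inductive Exec {K : Type} [DecidableEq K] :
    Prog K → (K → List Symbol) → ℕ → (K → List Symbol) → Prop
  | skip (s) : Exec .skip s 1 s
  | push (s) (k : K) (a : Symbol) : Exec (.push k a) s 1 (Function.update s k (a :: s k))
  | case (s : K → List Symbol) (k : K) (f : Option Symbol → Prog K) (n s') :
      Exec (f (s k).head?) (Function.update s k (s k).tail) n s' → Exec (.case k f) s (n + 1) s'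
  | seq (p q s n s' m s'') : Exec p s n s' → Exec q s' m s'' → Exec (.seq p q) s (n + m) s''
  | loop_done (s : K → List Symbol) (k : K) (S : Option Symbol → Bool) (p) :
      S (s k).head? = false → Exec (.loop k S p) s 1 s
  | loop_step (s : K → List Symbol) (k : K) (S : Option Symbol → Bool) (p) (n s' m s'') :
      S (s k).head? = true → Exec p s n s' → Exec (.loop k S p) s' m s'' →
      Exec (.loop k S p) s (n + m + 1) s''

/-! ### Compilation of programs to Turing machines -/

/-- The control points of a program. -/
def Prog.Lab {K : Type} : Prog K → Type
  | .skip => Unit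
  | .push _ _ => Unit
  | .case _ f => Option (Σ o, (f o).Lab)
  | .seq p q => p.Lab ⊕ q.Lab
  | .loop _ _ p => Option p.Lab

@[reducible]
def Prog.labFintype {K : Type} : (p : Prog K) → Fintype p.Lab
  | .skip => inferInstanceAs (Fintype Unit)
  | .push _ _ => inferInstanceAs (Fintype Unit)
  | .case _ f =>
      letI := fun o => (f o).labFintype
      inferInstanceAs (Fintype (Option (Σ o, (f o).Lab)))
  | .seq p q =>
      letI := p.labFintype
      letI := q.labFintype
      inferInstanceAs (Fintype (p.Lab ⊕ q.Lab))
  | .loop _ _ p =>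
      letI := p.labFintype
      inferInstanceAs (Fintype (Option p.Lab))

def Prog.entry {K : Type} : (p : Prog K) → p.Lab
  | .skip => ()
  | .push _ _ => ()
  | .case _ _ => none
  | .seq p _ => Sum.inl p.entry
  | .loop _ _ _ => none

/-- The code of a program, with control points embedded by `e`, that continues at `x`. -/
def Prog.code {K Λ : Type} : (p : Prog K) → (p.Lab → Λ) → Λ → p.Lab →
    TM2.Stmt (fun _ : K => Symbol) Λ (Option Symbol)
  | .skip, _, x, _ => .goto fun _ => x
  | .push k a, _, x, _ => .push k (fun _ => a) (.goto fun _ => x)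
  -- The popped symbol is kept in the internal state and selects the branch; an empty stack yields
  -- `none`.
  | .case k f, e, _, none => .pop k (fun _ o => o) (.goto fun v => e (some ⟨v, (f v).entry⟩))
  | .case _ f, e, x, some ⟨o, l⟩ => (f o).code (fun l => e (some ⟨o, l⟩)) x l
  | .seq p q, e, _, .inl l => p.code (fun l => e (.inl l)) (e (.inr q.entry)) l
  | .seq _ q, e, x, .inr l => q.code (fun l => e (.inr l)) x l
  | .loop k S p, e, x, none =>
      .peek k (fun _ o => o) (.goto fun v => if S v then e (some p.entry) else x)
  | .loop _ _ p, e, _, some l => p.code (fun l => e (some l)) (e none) l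

/-- The machine with the given code goes from `c` to `c'` in exactly `n` steps. -/
def Steps {K Λ σ : Type} [DecidableEq K] {Γ : K → Type} (m : Λ → TM2.Stmt Γ Λ σ) (n : ℕ)
    (c c' : TM2.Cfg Γ Λ σ) : Prop :=
  (flip bind (TM2.step m))^[n] (some c) = some c'

theorem Steps.one {K Λ σ : Type} [DecidableEq K] {Γ : K → Type} {m : Λ → TM2.Stmt Γ Λ σ}
    {c c' : TM2.Cfg Γ Λ σ} (h : TM2.step m c = some c') : Steps m 1 c c' := by
  simpa [Steps, flip] using h

theorem Steps.refl {K Λ σ : Type} [DecidableEq K] {Γ : K → Type} {m : Λ → TM2.Stmt Γ Λ σ}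
    (c : TM2.Cfg Γ Λ σ) : Steps m 0 c c := rfl

theorem Steps.trans {K Λ σ : Type} [DecidableEq K] {Γ : K → Type} {m : Λ → TM2.Stmt Γ Λ σ}
    {n n' : ℕ} {c c' c'' : TM2.Cfg Γ Λ σ} (h : Steps m n c c') (h' : Steps m n' c' c'') :
    Steps m (n + n') c c'' := by
  rw [Steps] at h h' ⊢
  rw [Nat.add_comm, Function.iterate_add_apply, h, h']

/-- The step counts of `Exec` are chosen so that each of them is one machine step. The internal
state `v` may be arbitrary at the start, because `case` and `loop` overwrite it before they use it.
-/
theorem Exec.steps {K : Type} [DecidableEq K] {p : Prog K} {s s' : K → List Symbol} {n : ℕ}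
    (h : Exec p s n s') : ∀ {Λ : Type} (m : Λ → TM2.Stmt (fun _ : K => Symbol) Λ (Option Symbol))
    (e : p.Lab → Λ) (x : Λ), (∀ l, m (e l) = p.code e x l) → ∀ v, ∃ v',
    Steps m n ⟨some (e p.entry), v, s⟩ ⟨some x, v', s'⟩ := by
  induction h with
  | skip s =>
    intro Λ m e x hm v
    exact ⟨v, Steps.one (congrArg (fun c => some (TM2.stepAux c v s)) (hm ()))⟩
  | push s k a =>
    intro Λ m e x hm v
    exact ⟨v, Steps.one (congrArg (fun c => some (TM2.stepAux c v s)) (hm ()))⟩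
  | case s k f n s' _ ih =>
    intro Λ m e x hm v
    obtain ⟨v', h⟩ := ih m (fun l => e (some ⟨_, l⟩)) x (fun l => hm _) (s k).head?
    refine ⟨v', ?_⟩
    rw [Nat.add_comm]
    refine (Steps.one ?_).trans h
    exact congrArg (fun c => some (TM2.stepAux c v s)) (hm none)
  | seq p q s n s' n' s'' _ _ ih ih' =>
    intro Λ m e x hm v
    obtain ⟨v', h⟩ := ih m (fun l => e (.inl l)) (e (.inr q.entry)) (fun l => hm _) v
    obtain ⟨v'', h'⟩ := ih' m (fun l => e (.inr l)) x (fun l => hm _) v'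
    exact ⟨v'', h.trans h'⟩
  | loop_done s k S p hS =>
    intro Λ m e x hm v
    exact ⟨(s k).head?, Steps.one
      ((congrArg (fun c => some (TM2.stepAux c v s)) (hm none)).trans (by
        simp [Prog.code, TM2.stepAux, hS]))⟩
  | loop_step s k S p n s' n' s'' hS _ _ ih ih' =>
    intro Λ m e x hm v
    obtain ⟨v', h⟩ := ih m (fun l => e (some l)) (e none) (fun l => hm _) (s k).head?
    obtain ⟨v'', h'⟩ := ih' m e x hm v'
    refine ⟨v'', ?_⟩
    rw [Nat.add_comm]
    refine (Steps.one ?_).trans (h.trans h')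
    exact (congrArg (fun c => some (TM2.stepAux c v s)) (hm none)).trans (by
      simp [Prog.code, TM2.stepAux, hS])

/-- The Turing machine of a program, with input and output on the stack `k`. -/
def Prog.machine {K : Type} [DecidableEq K] [Fintype K] (p : Prog K) (k : K) :
    TM2ComputableAux Symbol Symbol :=
  letI := p.labFintype
  { tm :=
      { K := K
        k₀ := k
        k₁ := k
        Γ := fun _ => Symbol
        Λ := Option p.Lab
        main := some p.entry
        σ := Option Symbol
        initialState := none
        m := fun l => match l with
          -- An accepted final configuration must carry the initial internal state, so the state is
          -- reset before halting. This is the additional step in `Exec.outputsWithin`.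
          | none => .load (fun _ => none) .halt
          | some l => p.code some none l }
    inputAlphabet := Equiv.refl _
    outputAlphabet := Equiv.refl _ }

theorem initList_eq (tm : FinTM2) (s : List (tm.Γ tm.k₀)) :
    initList tm s = ⟨some tm.main, tm.initialState, Function.update (fun _ => []) tm.k₀ s⟩ := by
  unfold initList
  congr 1
  funext k
  by_cases h : k = tm.k₀
  · subst h; simp
  · simp [h]

theorem haltList_eq (tm : FinTM2) (s : List (tm.Γ tm.k₁)) :
    haltList tm s = ⟨none, tm.initialState, Function.update (fun _ => []) tm.k₁ s⟩ := by
  unfold haltList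
  congr 1
  funext k
  by_cases h : k = tm.k₁
  · subst h; simp
  · simp [h]

theorem outputsWithin_iff {Γ Δ : Type} (M : TM2ComputableAux Γ Δ) (x : List Γ) (y : List Δ)
    (T : ℕ) : OutputsWithin M x y T ↔ ∃ n ≤ T, Steps M.tm.m n
      ⟨some M.tm.main, M.tm.initialState,
        Function.update (fun _ => []) M.tm.k₀ (x.map M.inputAlphabet.invFun)⟩
      ⟨none, M.tm.initialState,
        Function.update (fun _ => []) M.tm.k₁ (y.map M.outputAlphabet.invFun)⟩ := by
  constructor
  · rintro ⟨⟨⟨n, h⟩, hT⟩⟩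
    refine ⟨n, hT, ?_⟩
    rw [initList_eq, Option.map_some, haltList_eq] at h
    exact h
  · rintro ⟨n, hT, h⟩
    refine ⟨⟨⟨n, ?_⟩, hT⟩⟩
    rw [initList_eq, Option.map_some, haltList_eq]
    exact h

theorem Exec.outputsWithin {K : Type} [DecidableEq K] [Fintype K] {p : Prog K} {k : K}
    {x y : List Symbol} {n T : ℕ}
    (h : Exec p (Function.update (fun _ => []) k x) n (Function.update (fun _ => []) k y))
    (hT : n + 1 ≤ T) : OutputsWithin (p.machine k) x y T := by
  rw [outputsWithin_iff]
  let := p.labFintype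
  obtain ⟨v, hv⟩ := h.steps (p.machine k).tm.m some none (fun _ => rfl) none
  have h1 : Steps (p.machine k).tm.m 1 ⟨some none, v, Function.update (fun _ => []) k y⟩
      ⟨none, none, Function.update (fun _ => []) k y⟩ := Steps.one rfl
  refine ⟨n + 1, hT, ?_⟩
  have hx : x.map (p.machine k).inputAlphabet.invFun = x := List.map_id x
  have hy : y.map (p.machine k).outputAlphabet.invFun = y := List.map_id y
  rw [hx, hy]
  exact hv.trans h1

end ParamQC
end

noncomputable section

namespace ParamQC

open Turing Computability

/-! ### Programs on binary trees -/

inductive Data : Type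
  | nil : Data
  | cons (a b : Data) : Data

namespace Data

/-- The prefix code of a tree. -/
def str : Data → List Symbol
  | nil => [some false]
  | cons a b => some true :: (str a ++ str b)

def size (t : Data) : ℕ := t.str.length

@[simp] theorem size_nil : size nil = 1 := rfl

@[simp] theorem size_cons (a b : Data) : size (cons a b) = size a + size b + 1 := by
  simp [size, str]

theorem size_pos (t : Data) : 0 < t.size := by cases t <;> simp

@[simp] theorem length_str (t : Data) : t.str.length = t.size := rfl

end Data

/-- The data lie on the main stack `s`, one tree code after the other. A tree in transit lies
reversed on `t`, the stack `c` counts the subtrees still to be read, and `a`, `b`, `d` hold trees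
that are being copied or permuted. -/
inductive Reg : Type
  | s | a | b | d | t | c
  deriving DecidableEq

instance : Fintype Reg :=
  ⟨{.s, .a, .b, .d, .t, .c}, fun x => by cases x <;> simp⟩

/-- The stacks with the given contents. -/
def st (s a b d t c : List Symbol) : Reg → List Symbol
  | .s => s
  | .a => a
  | .b => b
  | .d => d
  | .t => t
  | .c => c

section
variable (s a b d t c v : List Symbol)
@[simp] theorem st_s : st s a b d t c .s = s := rfl
@[simp] theorem st_a : st s a b d t c .a = a := rfl
@[simp] theorem st_b : st s a b d t c .b = b := rfl
@[simp] theorem st_d : st s a b d t c .d = d := rfl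
@[simp] theorem st_t : st s a b d t c .t = t := rfl
@[simp] theorem st_c : st s a b d t c .c = c := rfl
@[simp] theorem update_st_s : Function.update (st s a b d t c) .s v = st v a b d t c := by
  funext k; cases k <;> rfl
@[simp] theorem update_st_a : Function.update (st s a b d t c) .a v = st s v b d t c := by
  funext k; cases k <;> rfl
@[simp] theorem update_st_b : Function.update (st s a b d t c) .b v = st s a v d t c := by
  funext k; cases k <;> rfl
@[simp] theorem update_st_d : Function.update (st s a b d t c) .d v = st s a b v t c := by
  funext k; cases k <;> rfl
@[simp] theorem update_st_t : Function.update (st s a b d t c) .t v = st s a b d v c := by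
  funext k; cases k <;> rfl
@[simp] theorem update_st_c : Function.update (st s a b d t c) .c v = st s a b d t v := by
  funext k; cases k <;> rfl
end

/-- The program ends within `n` steps in the given state. -/
def Within (p : Prog Reg) (s : Reg → List Symbol) (n : ℕ) (s' : Reg → List Symbol) : Prop :=
  ∃ m ≤ n, Exec p s m s'

namespace Within

variable {p q : Prog Reg} {s s' s'' : Reg → List Symbol} {n m : ℕ}

theorem mono (h : Within p s n s') (hn : n ≤ m) : Within p s m s' :=
  let ⟨k, hk, h⟩ := h
  ⟨k, hk.trans hn, h⟩

theorem seq (h : Within p s n s') (h' : Within q s' m s'') : Within (.seq p q) s (n + m) s'' :=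
  let ⟨k, hk, h⟩ := h
  let ⟨k', hk', h'⟩ := h'
  ⟨k + k', Nat.add_le_add hk hk', .seq _ _ _ _ _ _ _ h h'⟩

theorem push {k : Reg} {x : Symbol} (h : Function.update s k (x :: s k) = s') :
    Within (.push k x) s 1 s' :=
  h ▸ ⟨1, le_rfl, .push _ _ _⟩

theorem skip : Within .skip s 1 s := ⟨1, le_rfl, .skip _⟩

theorem case {k : Reg} {f : Option Symbol → Prog Reg} (x : Option Symbol) (hx : (s k).head? = x)
    (hs : Function.update s k (s k).tail = s') (h : Within (f x) s' n s'') :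
    Within (.case k f) s (n + 1) s'' := by
  subst hx hs
  obtain ⟨j, hj, h⟩ := h
  exact ⟨j + 1, Nat.add_le_add_right hj 1, .case _ _ _ _ _ h⟩

theorem loop_done {k : Reg} {S : Option Symbol → Bool} (h : S (s k).head? = false) :
    Within (.loop k S p) s 1 s := ⟨1, le_rfl, .loop_done _ _ _ _ h⟩

theorem loop_step {k : Reg} {S : Option Symbol → Bool} (hS : S (s k).head? = true)
    (h : Within p s n s') (h' : Within (.loop k S p) s' m s'') :
    Within (.loop k S p) s (n + m + 1) s'' :=
  let ⟨j, hj, h⟩ := h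
  let ⟨j', hj', h'⟩ := h'
  ⟨j + j' + 1, by omega, .loop_step _ _ _ _ _ _ _ _ hS h h'⟩

end Within

/-- Empty the stack `x` onto the stack `y`. -/
def pour (x y : Reg) : Prog Reg :=
  .loop x Option.isSome (.case x fun o => .push y (o.getD none))

theorem pour_within {x y : Reg} (hxy : x ≠ y) {s s' : Reg → List Symbol} (l : List Symbol)
    (hl : s x = l) (hs' : Function.update (Function.update s y (l.reverse ++ s y)) x [] = s') :
    Within (pour x y) s (3 * l.length + 1) s' := by
  subst hs'
  induction l generalizing s with
  | nil =>
    have : Function.update (Function.update s y ([].reverse ++ s y)) x [] = s := by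
      rw [← hl, hl, List.reverse_nil, List.nil_append, Function.update_eq_self, ← hl,
        Function.update_eq_self]
    rw [this]
    exact Within.loop_done (by simp [hl])
  | cons a l ih =>
    have h1 : Within (.case x fun o => .push y (o.getD none)) s 2
        (Function.update (Function.update s x l) y (a :: s y)) := by
      refine Within.case (some a) (by simp [hl]) rfl (Within.push ?_)
      simp [hl, hxy.symm]
    have h2 := @ih (Function.update (Function.update s x l) y (a :: s y)) (by simp [hxy])
    have h3 := (Within.loop_step (S := Option.isSome) (by simp [hl]) h1 h2).mono
      (m := 3 * (a :: l).length + 1) (by simp; omega)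
    convert (show Within (pour x y) s _ _ from h3) using 1
    funext k
    rcases eq_or_ne k x with rfl | hk
    · simp
    · rcases eq_or_ne k y with rfl | hk'
      · simp [hk]
      · simp [hk, hk']

/-- Empty the stack `t` onto the stacks `s` and `a`. -/
def pourBoth : Prog Reg :=
  .loop .t Option.isSome (.case .t fun o => .seq (.push .s (o.getD none)) (.push .a (o.getD none)))

theorem pourBoth_within (l r r' b d c : List Symbol) :
    Within pourBoth (st r r' b d l c) (4 * l.length + 1)
      (st (l.reverse ++ r) (l.reverse ++ r') b d [] c) := by
  induction l generalizing r r' with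
  | nil => exact Within.loop_done (by simp)
  | cons x l ih =>
    have h1 : Within (.case .t fun o => .seq (.push .s (o.getD none)) (.push .a (o.getD none)))
        (st r r' b d (x :: l) c) 3 (st (x :: r) (x :: r') b d l c) :=
      Within.case (some x) (by simp) (by simp; rfl)
        ((Within.push (by simp; rfl)).seq (Within.push (by simp)))
    have h2 := ih (x :: r) (x :: r')
    simp only [List.reverse_cons, List.append_assoc, List.singleton_append, List.length_cons]
    exact (Within.loop_step (by simp) h1 h2).mono (by omega)

def branch (p q : Prog Reg) : Option Symbol → Prog Reg
  | some (some true) => p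
  | _ => q

/-- The end of a prefix code is found by counting: `c` holds one mark for each subtree that is still
expected. An inner node replaces one expected tree by two and a leaf settles one, so the tree is
complete when `c` is empty. -/
def readStep : Prog Reg :=
  .case .s (branch (.seq (.push .t (some true)) (.push .c none))
    (.seq (.push .t (some false)) (.case .c fun _ => .skip)))

def readLoop : Prog Reg := .loop .c Option.isSome readStep

/-- Move the tree on top of the stack `s` to the stack `t`, reversed. -/
def readTree : Prog Reg := .seq (.push .c none) readLoop

/-- The statement is in continuation form: `n` and `s'` describe the rest of the loop after `x` has
been read. The case of an inner node is then the chaining of the statements for its two subtrees. -/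
theorem readLoop_within (x : Data) : ∀ (r a b d t c : List Symbol) (n : ℕ) (s' : Reg → List Symbol),
    Within readLoop (st r a b d (x.str.reverse ++ t) c) n s' →
    Within readLoop (st (x.str ++ r) a b d t (none :: c)) (n + 5 * x.size) s' := by
  induction x with
  | nil =>
    intro r a b d t c n s' h
    have h1 : Within readStep (st (some false :: r) a b d t (none :: c)) 4
        (st r a b d (some false :: t) c) :=
      Within.case (some (some false)) rfl (by simp; rfl) ((Within.push (by simp; rfl)).seq
        (m := 2) (Within.case (some none) rfl (by simp) Within.skip))
    exact (Within.loop_step (by simp) h1 h).mono (by simp; omega)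
  | cons x y ihx ihy =>
    intro r a b d t c n s' h
    have h1 : Within readStep (st ((Data.cons x y).str ++ r) a b d t (none :: c)) 3
        (st (x.str ++ (y.str ++ r)) a b d (some true :: t) (none :: none :: c)) :=
      Within.case (some (some true)) rfl (by simp [Data.str]; rfl)
        ((Within.push (by simp; rfl)).seq (Within.push (by simp)))
    have h2 := ihy r a b d (x.str.reverse ++ some true :: t) c n s' (by
      simpa [Data.str] using h)
    have h3 := ihx _ a b d _ _ _ _ h2
    exact (Within.loop_step (by simp) h1 h3).mono (by simp; omega)

theorem readTree_within (x : Data) (r a b d : List Symbol) :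
    Within readTree (st (x.str ++ r) a b d [] []) (5 * x.size + 2)
      (st r a b d x.str.reverse []) := by
  refine ((Within.push (by simp)).seq (readLoop_within x r a b d [] [] 1 _ ?_)).mono
    (by omega)
  rw [List.append_nil]
  exact Within.loop_done rfl

/-- Move the tree on top of the stack `s` to the empty stack `k`. -/
def takeTo (k : Reg) : Prog Reg := .seq readTree (pour .t k)

/-- Move the contents of the stack `k` to the stack `s`. -/
def giveBack (k : Reg) : Prog Reg := .seq (pour k .t) (pour .t .s)

def dropTree : Prog Reg := .seq readTree (.loop .t Option.isSome (.case .t fun _ => .skip))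

def dupTree : Prog Reg := .seq readTree (.seq pourBoth (giveBack .a))

def swapTree : Prog Reg :=
  .seq (takeTo .a) (.seq (takeTo .b) (.seq (giveBack .a) (giveBack .b)))

/-- Exchange the second and the third tree. -/
def swapBelow : Prog Reg :=
  .seq (takeTo .a) (.seq (takeTo .b) (.seq (takeTo .d)
    (.seq (giveBack .b) (.seq (giveBack .d) (giveBack .a)))))

theorem dropTree_within (x : Data) (r : List Symbol) :
    Within dropTree (st (x.str ++ r) [] [] [] [] []) (8 * x.size + 3) (st r [] [] [] [] []) := by
  have h : ∀ l : List Symbol, Within (.loop .t Option.isSome (.case .t fun _ => .skip))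
      (st r [] [] [] l []) (3 * l.length + 1) (st r [] [] [] [] []) := by
    intro l
    induction l with
    | nil => exact Within.loop_done (by simp)
    | cons x l ih =>
      refine (Within.loop_step (by simp) (n := 2) (s' := st r [] [] [] l [])
        (Within.case (some x) rfl (by simp) Within.skip) ih).mono (by simp; omega)
  exact ((readTree_within x r [] [] []).seq (h _)).mono (by simp; omega)

theorem dupTree_within (x : Data) (r : List Symbol) :
    Within dupTree (st (x.str ++ r) [] [] [] [] []) (15 * x.size + 5)
      (st (x.str ++ (x.str ++ r)) [] [] [] [] []) :=
  ((readTree_within x r [] [] []).seq ((pourBoth_within _ _ _ _ _ _).seq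
    ((pour_within (by decide) x.str (by simp) (by simp; rfl)).seq
      (pour_within (by decide) x.str.reverse (by simp) (by simp))))).mono (by simp; omega)

theorem swapTree_within (x y : Data) (r : List Symbol) :
    Within swapTree (st (x.str ++ (y.str ++ r)) [] [] [] [] []) (20 * (x.size + y.size) + 20)
      (st (y.str ++ (x.str ++ r)) [] [] [] [] []) :=
  (((readTree_within x _ [] [] []).seq (pour_within (by decide) x.str.reverse (by simp)
    (by simp; rfl))).seq (((readTree_within y _ _ [] []).seq (pour_within (by decide)
    y.str.reverse (by simp) (by simp; rfl))).seq (((pour_within (by decide) x.str (by simp)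
    (by simp; rfl)).seq (pour_within (by decide) x.str.reverse (by simp) (by simp; rfl))).seq
    ((pour_within (by decide) y.str (by simp) (by simp; rfl)).seq (pour_within (by decide)
    y.str.reverse (by simp) (by simp)))))).mono (by simp; omega)

theorem swapBelow_within (x y z : Data) (r : List Symbol) :
    Within swapBelow (st (x.str ++ (y.str ++ (z.str ++ r))) [] [] [] [] [])
      (20 * (x.size + y.size + z.size) + 20)
      (st (x.str ++ (z.str ++ (y.str ++ r))) [] [] [] [] []) :=
  (((readTree_within x _ [] [] []).seq (pour_within (by decide) x.str.reverse (by simp)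
    (by simp; rfl))).seq (((readTree_within y _ _ [] []).seq (pour_within (by decide)
    y.str.reverse (by simp) (by simp; rfl))).seq (((readTree_within z _ _ _ []).seq (pour_within
    (by decide) z.str.reverse (by simp) (by simp; rfl))).seq
    (((pour_within (by decide) y.str (by simp) (by simp; rfl)).seq (pour_within (by decide)
    y.str.reverse (by simp) (by simp; rfl))).seq
    (((pour_within (by decide) z.str (by simp) (by simp; rfl)).seq (pour_within (by decide)
    z.str.reverse (by simp) (by simp; rfl))).seq
    ((pour_within (by decide) x.str (by simp) (by simp; rfl)).seq (pour_within (by decide)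
    x.str.reverse (by simp) (by simp)))))))).mono (by simp; omega)

/-! ### Computations on the top of the main stack -/

/-- The program `p` replaces the tree `x` on top of the main stack by `y` within `n` steps. -/
def Runs (p : Prog Reg) (x y : Data) (n : ℕ) : Prop :=
  ∀ r, Within p (st (x.str ++ r) [] [] [] [] []) n (st (y.str ++ r) [] [] [] [] [])

namespace Runs

variable {p q : Prog Reg} {x y z w : Data} {n m : ℕ}

theorem mono (h : Runs p x y n) (hn : n ≤ m) : Runs p x y m := fun r => (h r).mono hn

theorem skip (x : Data) : Runs .skip x x 1 := fun _ => Within.skip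

theorem seq (h : Runs p x y n) (h' : Runs q y z m) : Runs (.seq p q) x z (n + m) :=
  fun r => (h r).seq (h' r)

end Runs

def pushAll (l : List Symbol) : Prog Reg :=
  l.foldr (fun x p => .seq p (.push .s x)) .skip

theorem pushAll_within (l r : List Symbol) :
    Within (pushAll l) (st r [] [] [] [] []) (l.length + 1) (st (l ++ r) [] [] [] [] []) := by
  induction l with
  | nil => exact Within.skip
  | cons x l ih => exact (ih.seq (Within.push (by simp))).mono (by simp)

def constProg (y : Data) : Prog Reg := .seq dropTree (pushAll y.str)

theorem constProg_runs (x y : Data) : Runs (constProg y) x y (8 * x.size + y.size + 4) :=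
  fun r => ((dropTree_within x r).seq (pushAll_within y.str r)).mono (by simp; omega)

def pairProg (p q : Prog Reg) : Prog Reg :=
  .seq dupTree (.seq p (.seq swapTree (.seq q (.seq swapTree (.push .s (some true))))))

theorem pairProg_runs {p q : Prog Reg} {x y z : Data} {n m : ℕ} (hp : Runs p x y n)
    (hq : Runs q x z m) : Runs (pairProg p q) x (.cons y z)
      (n + m + 35 * x.size + 40 * y.size + 20 * z.size + 46) := by
  intro r
  refine ((dupTree_within x r).seq ((hp _).seq ((swapTree_within y x r).seq ((hq _).seq
    ((swapTree_within z y r).seq (Within.push ?_)))))).mono (by omega)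
  simp [Data.str]

/-- The components of a tree (both `nil` for the tree `nil`). -/
def Data.left : Data → Data
  | .nil => .nil
  | .cons a _ => a

def Data.right : Data → Data
  | .nil => .nil
  | .cons _ b => b

def leftProg : Prog Reg := .case .s (branch (.seq swapTree dropTree) (.push .s (some false)))

theorem leftProg_runs (x : Data) : Runs leftProg x x.left (30 * x.size + 30) := by
  intro r
  cases x with
  | nil =>
    exact (Within.case (some (some false)) rfl (by simp; rfl) (Within.push (by simp; rfl))).mono
      (by simp)
  | cons a b =>
    exact (Within.case (some (some true)) rfl (by simp [Data.str])
      ((swapTree_within a b r).seq (dropTree_within b _))).mono (by simp; omega)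

def rightProg : Prog Reg := .case .s (branch dropTree (.push .s (some false)))

theorem rightProg_runs (x : Data) : Runs rightProg x x.right (8 * x.size + 4) := by
  intro r
  cases x with
  | nil =>
    exact (Within.case (some (some false)) rfl (by simp; rfl) (Within.push (by simp; rfl))).mono
      (by simp)
  | cons a b =>
    exact (Within.case (some (some true)) rfl (by simp [Data.str]; rfl)
      (dropTree_within a _)).mono (by simp; omega)

/-- On the tree `cons c x`: run `p` on `x` if `c = nil`, and run `q` on `x` otherwise. -/
def iteProg (p q : Prog Reg) : Prog Reg :=
  .case .s fun _ => .case .s (branch (.seq dropTree (.seq dropTree q)) p)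

theorem iteProg_runs_nil {p : Prog Reg} (q : Prog Reg) {x y : Data} {n : ℕ} (hp : Runs p x y n) :
    Runs (iteProg p q) (.cons .nil x) y (n + 2) := fun r =>
  Within.case (n := n + 1) (some (some true)) rfl (by simp [Data.str]; rfl)
    (Within.case (some (some false)) rfl (by simp) (hp r))

theorem iteProg_runs_cons (p : Prog Reg) {q : Prog Reg} {a b x y : Data} {n : ℕ}
    (hq : Runs q x y n) :
    Runs (iteProg p q) (.cons (.cons a b) x) y (n + 8 * (a.size + b.size) + 8) := fun r =>
  (Within.case (some (some true)) rfl (by simp [Data.str]; rfl)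
    (Within.case (some (some true)) rfl (by simp)
      ((dropTree_within a _).seq ((dropTree_within b _).seq (hq r))))).mono (by omega)

/-- A list of trees as a tree. -/
def Data.ofList : List Data → Data
  | [] => .nil
  | a :: l => .cons a (ofList l)

/-- On the tree `cons l x`: for each element `a` of the list `l`, replace `x` by the result of `p`
on `cons a x`. -/
def foldProg (p : Prog Reg) : Prog Reg :=
  .case .s fun _ => .seq (.loop .s (· = some (some true)) (.case .s fun _ =>
    -- Once the mark of the list cell is popped, the stack reads head, remaining list, state.
    -- Exchanging the last two and pushing a mark forms the pair of head and state for `p`. The last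
    -- pop removes the code of the empty list.
    .seq swapBelow (.seq (.push .s (some true)) (.seq p swapTree)))) (.case .s fun _ => .skip)

/-- Bounds on the step and on the state are required only for states reached after a prefix of `L`,
since a priori bounds are usually available for those alone. -/
theorem foldProg_runs {β σ : Type} (eβ : β → Data) (eσ : σ → Data) {p : Prog Reg} (F : σ → β → σ)
    (L : List β) (x : σ) (B T : ℕ)
    (hB : ∀ l₁ l₂, L = l₁ ++ l₂ → (eσ (l₁.foldl F x)).size ≤ B)
    (hp : ∀ l₁ a l₂, L = l₁ ++ a :: l₂ →
      Runs p (.cons (eβ a) (eσ (l₁.foldl F x))) (eσ (F (l₁.foldl F x) a)) T) :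
    Runs (foldProg p) (.cons (.ofList (L.map eβ)) (eσ x)) (eσ (L.foldl F x))
      ((Data.ofList (L.map eβ)).size *
        (T + 40 * (Data.ofList (L.map eβ)).size + 40 * B + 50) + 4) := by
  intro r
  generalize hM : T + 40 * (Data.ofList (L.map eβ)).size + 40 * B + 50 = M
  have key : ∀ (l l₁ : List β), L = l₁ ++ l →
      (Data.ofList (l.map eβ)).size ≤ (Data.ofList (L.map eβ)).size →
      Within (.loop .s (· = some (some true)) (.case .s fun _ =>
        .seq swapBelow (.seq (.push .s (some true)) (.seq p swapTree))))
        (st ((Data.ofList (l.map eβ)).str ++ ((eσ (l₁.foldl F x)).str ++ r)) [] [] [] [] [])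
        ((Data.ofList (l.map eβ)).size * M)
        (st (Data.nil.str ++ ((eσ (L.foldl F x)).str ++ r)) [] [] [] [] []) := by
    intro l
    induction l with
    | nil =>
      intro l₁ hl _
      obtain rfl : L = l₁ := by simpa using hl
      exact (Within.loop_done (by simp [Data.ofList, Data.str])).mono (by
        simp [Data.ofList]; omega)
    | cons a l ih =>
      intro l₁ hl hs
      simp only [List.map_cons, Data.ofList, Data.size_cons] at hs
      have h1 := ih (l₁ ++ [a]) (by simpa using hl) (by omega)
      simp only [List.foldl_append, List.foldl_cons, List.foldl_nil] at h1
      have hB1 := hB l₁ _ hl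
      have hB2 := hB (l₁ ++ [a]) l (by simpa using hl)
      simp only [List.foldl_append, List.foldl_cons, List.foldl_nil] at hB2
      -- One unit of `M` is left for the test of the loop.
      have h2 : Within (.case .s fun _ => .seq swapBelow (.seq (.push .s (some true))
          (.seq p swapTree))) (st ((Data.cons (eβ a) (.ofList (l.map eβ))).str ++
            ((eσ (l₁.foldl F x)).str ++ r)) [] [] [] [] []) (M - 1)
          (st ((Data.ofList (l.map eβ)).str ++ ((eσ (F (l₁.foldl F x) a)).str ++ r))
            [] [] [] [] []) := by
        refine (Within.case (some (some true)) rfl (by simp [Data.str]; rfl)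
          ((swapBelow_within (eβ a) _ _ r).seq ((Within.push (by simp; rfl)).seq
            (Within.seq (by simpa [Data.str] using hp l₁ a _ hl _)
              (swapTree_within _ _ r))))).mono ?_
        omega
      refine (Within.loop_step (by simp [Data.str]) h2 h1).mono ?_
      simp only [List.map_cons, Data.ofList, Data.size_cons, add_mul, one_mul]
      omega
  exact (Within.case (some (some true)) rfl (by simp [Data.str])
    ((key L [] rfl le_rfl).seq (Within.case (some (some false)) rfl
      (by simp [Data.str]) Within.skip))).mono (by omega)

/-- A step pushes at most one symbol. Hence the size of an output is at most the size of the input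
plus the running time, and this is what makes polynomial time closed under composition. -/
theorem Exec.length_le {K : Type} [DecidableEq K] {p : Prog K} {s s' : K → List Symbol} {n : ℕ}
    (h : Exec p s n s') (k : K) : (s' k).length ≤ (s k).length + n := by
  induction h with
  | skip => simp
  | push s k' a =>
    by_cases hk : k = k'
    · subst hk; simp
    · simp [hk]
  | case s k' f n s' _ ih =>
    refine ih.trans ?_
    by_cases hk : k = k'
    · subst hk; simp; omega
    · simp [hk]
  | seq p q s n s' m s'' _ _ ih ih' => omega
  | loop_done => simp
  | loop_step s k S p n s' m s'' _ _ _ ih ih' => omega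

theorem Runs.size_le {p : Prog Reg} {x y : Data} {n : ℕ} (h : Runs p x y n) :
    y.size ≤ x.size + n := by
  obtain ⟨m, hm, h⟩ := h []
  have := h.length_le .s
  simp at this
  omega

end ParamQC
end

noncomputable section

namespace ParamQC

open Turing Computability

/-! ### Polynomial-time functions between encoded types -/

/-- An encoding of the elements of a type as binary trees. -/
class Enc (α : Type) where
  enc : α → Data

open Enc (enc)

/-- The size of the encoding. -/
def esize {α : Type} [Enc α] (a : α) : ℕ := (enc a).size

instance : Enc Unit := ⟨fun _ => .nil⟩

instance : Enc Bool := ⟨fun b => if b then .cons .nil .nil else .nil⟩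

instance {α β : Type} [Enc α] [Enc β] : Enc (α × β) := ⟨fun p => .cons (enc p.1) (enc p.2)⟩

instance {α : Type} [Enc α] : Enc (List α) := ⟨fun l => .ofList (l.map enc)⟩

instance {α : Type} [Enc α] : Enc (Option α) := ⟨fun o => o.elim .nil fun a => .cons (enc a) .nil⟩

instance : Enc ℕ := ⟨fun n => enc n.bits⟩

instance : Enc ℤ := ⟨fun z => enc (decide (z < 0), z.natAbs)⟩

theorem polynomial_eval_mono (q : Polynomial ℕ) : Monotone fun n : ℕ => q.eval n := by
  intro m n h
  simp only [Polynomial.eval_eq_sum, Polynomial.sum]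
  exact Finset.sum_le_sum fun i _ => Nat.mul_le_mul_left _ (Nat.pow_le_pow_left h i)

/-- The function is computable in time polynomial in the measure `μ`. -/
def PTm {α β : Type} [Enc α] [Enc β] (μ : α → ℕ) (f : α → β) : Prop :=
  ∃ (p : Prog Reg) (q : Polynomial ℕ), ∀ a, Runs p (enc a) (enc (f a)) (q.eval (μ a))

/-- The function is computable in polynomial time. -/
@[fun_prop]
def PT {α β : Type} [Enc α] [Enc β] (f : α → β) : Prop := PTm esize f

/-- The function is polynomially bounded in the measure `μ`. -/
@[fun_prop]
def PB {α : Type} (u μ : α → ℕ) : Prop := ∃ q : Polynomial ℕ, ∀ a, u a ≤ q.eval (μ a)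

namespace PB

variable {α : Type} {μ u v : α → ℕ}

theorem mono (hv : PB v μ) (h : ∀ a, u a ≤ v a) : PB u μ :=
  let ⟨q, hq⟩ := hv
  ⟨q, fun a => (h a).trans (hq a)⟩

@[fun_prop]
theorem const (n : ℕ) : PB (fun _ => n) μ := ⟨.C n, fun a => by simp⟩

theorem self : PB μ μ := ⟨.X, fun a => by simp⟩

@[fun_prop]
theorem add (hu : PB u μ) (hv : PB v μ) : PB (fun a => u a + v a) μ :=
  let ⟨q, hq⟩ := hu
  let ⟨r, hr⟩ := hv
  ⟨q + r, fun a => by simpa using Nat.add_le_add (hq a) (hr a)⟩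

@[fun_prop]
theorem mul (hu : PB u μ) (hv : PB v μ) : PB (fun a => u a * v a) μ :=
  let ⟨q, hq⟩ := hu
  let ⟨r, hr⟩ := hv
  ⟨q * r, fun a => by simpa using Nat.mul_le_mul (hq a) (hr a)⟩

@[fun_prop]
theorem add_const (hu : PB u μ) (n : ℕ) : PB (fun a => u a + n) μ := hu.add (.const n)

@[fun_prop]
theorem const_mul (hu : PB u μ) (n : ℕ) : PB (fun a => n * u a) μ := (PB.const n).mul hu

@[fun_prop]
theorem pow (hu : PB u μ) (n : ℕ) : PB (fun a => u a ^ n) μ :=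
  let ⟨q, hq⟩ := hu
  ⟨q ^ n, fun a => by simpa using Nat.pow_le_pow_left (hq a) n⟩

theorem comp {q : Polynomial ℕ} (hu : PB u μ) : PB (fun a => q.eval (u a)) μ :=
  let ⟨r, hr⟩ := hu
  ⟨q.comp r, fun a => by simpa using polynomial_eval_mono q (hr a)⟩

theorem trans (hu : PB u v) (hv : PB v μ) : PB u μ :=
  let ⟨q, hq⟩ := hu
  (comp (q := q) hv).mono hq

end PB

theorem PTm.of_runs {α β : Type} [Enc α] [Enc β] {μ : α → ℕ} {f : α → β} (p : Prog Reg) {T : α → ℕ}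
    (hT : PB T μ) (h : ∀ a, Runs p (enc a) (enc (f a)) (T a)) : PTm μ f :=
  let ⟨q, hq⟩ := hT
  ⟨p, q, fun a => (h a).mono (hq a)⟩

theorem PTm.runs {α β : Type} [Enc α] [Enc β] {μ : α → ℕ} {f : α → β} (h : PTm μ f) :
    ∃ (p : Prog Reg) (T : α → ℕ), PB T μ ∧ ∀ a, Runs p (enc a) (enc (f a)) (T a) :=
  let ⟨p, q, hq⟩ := h
  ⟨p, fun a => q.eval (μ a), ⟨q, fun _ => le_rfl⟩, hq⟩

section

variable {α β γ σ : Type} [Enc α] [Enc β] [Enc γ] [Enc σ] {μ : α → ℕ}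

theorem PTm.pb_esize {f : α → β} (h : PTm μ f) (hμ : PB esize μ) :
    PB (fun a => esize (f a)) μ := by
  obtain ⟨p, T, hT, h⟩ := h.runs
  exact (hμ.add hT).mono fun a => (h a).size_le

@[fun_prop]
theorem PT.pb_esize {f : α → β} (h : PT f) : PB (fun a => esize (f a)) esize := PTm.pb_esize h .self

theorem PTm.comp {f : β → γ} {g : α → β} (hf : PT f) (hg : PTm μ g) (hμ : PB esize μ) :
    PTm μ fun a => f (g a) := by
  obtain ⟨p, q, hq⟩ := hf
  have hs := hg.pb_esize hμ
  obtain ⟨p', T', hT', h'⟩ := hg.runs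
  exact .of_runs (.seq p' p) (hT'.add (hs.comp (q := q))) fun a => (h' a).seq (hq _)

theorem PTm.pair {f : α → β} {g : α → γ} (hf : PTm μ f) (hg : PTm μ g)
    (hμ : PB esize μ) : PTm μ fun a => (f a, g a) := by
  have hs := hf.pb_esize hμ
  have hs' := hg.pb_esize hμ
  obtain ⟨p, T, hT, h⟩ := hf.runs
  obtain ⟨p', T', hT', h'⟩ := hg.runs
  exact .of_runs (pairProg p p') (((((hT.add hT').add ((PB.const 35).mul hμ)).add
    ((PB.const 40).mul hs)).add ((PB.const 20).mul hs')).add (PB.const 46))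
    fun a => pairProg_runs (h a) (h' a)

theorem PTm.of_PT {f : α → β} (hf : PT f) (hμ : PB esize μ) : PTm μ f := by
  obtain ⟨p, q, hq⟩ := hf
  exact .of_runs p (hμ.comp (q := q)) hq

@[fun_prop]
theorem PT.id : PT (fun a : α => a) := .of_runs .skip (.const 1) fun _ => .skip _

@[fun_prop]
theorem PT.const (b : β) : PT (fun _ : α => b) :=
  .of_runs (constProg (enc b)) ((((PB.const 8).mul .self).add (.const _)).add (.const 4))
    fun _ => constProg_runs _ _

@[fun_prop]
theorem PT.comp {f : β → γ} {g : α → β} (hf : PT f) (hg : PT g) : PT fun a => f (g a) :=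
  PTm.comp hf hg .self

@[fun_prop]
theorem PT.pair {f : α → β} {g : α → γ} (hf : PT f) (hg : PT g) : PT fun a => (f a, g a) :=
  PTm.pair hf hg .self

/-- A program only sees codes, so passing between types with equal codes, such as a number and its
list of bits, is free. -/
theorem PT.of_enc_eq {f : α → β} {g : α → γ} (hf : PT f) (h : ∀ a, enc (f a) = enc (g a)) :
    PT g := by
  obtain ⟨p, T, hT, h'⟩ := hf.runs
  exact .of_runs p hT fun a => h a ▸ h' a

theorem PT.of_eq {f g : α → β} (hf : PT f) (h : ∀ a, f a = g a) : PT g :=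
  hf.of_enc_eq fun a => congrArg enc (h a)

theorem PT.fst' : PT (Prod.fst : α × β → α) :=
  .of_runs leftProg (((PB.const 30).mul .self).add (.const 30)) fun a => leftProg_runs (enc a)

theorem PT.snd' : PT (Prod.snd : α × β → β) :=
  .of_runs rightProg (((PB.const 8).mul .self).add (.const 4)) fun a => rightProg_runs (enc a)

@[fun_prop]
theorem PT.fst {f : α → β × γ} (hf : PT f) : PT fun a => (f a).1 := PT.fst'.comp hf

@[fun_prop]
theorem PT.snd {f : α → β × γ} (hf : PT f) : PT fun a => (f a).2 := PT.snd'.comp hf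

@[fun_prop]
theorem PT.cond {c : α → Bool} {f g : α → β} (hc : PT c) (hf : PT f) (hg : PT g) :
    PT fun a => bif c a then f a else g a := by
  have h1 : PT fun a => (c a, a) := hc.pair .id
  obtain ⟨p₁, T₁, hT₁, h₁⟩ := h1.runs
  obtain ⟨p₂, T₂, hT₂, h₂⟩ := hf.runs
  obtain ⟨p₃, T₃, hT₃, h₃⟩ := hg.runs
  refine .of_runs (.seq p₁ (iteProg p₃ p₂)) (hT₁.add ((hT₂.add hT₃).add (.const 24))) fun a =>
    (h₁ a).seq ?_
  cases hca : c a
  · have : enc (c a, a) = .cons .nil (enc a) := by simp [enc, hca]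
    simp only [← hca, this]
    simpa [hca] using (iteProg_runs_nil p₂ (h₃ a)).mono (by omega)
  · have : enc (c a, a) = .cons (.cons .nil .nil) (enc a) := by simp [enc, hca]
    simp only [← hca, this]
    simpa [hca] using (iteProg_runs_cons p₃ (a := .nil) (b := .nil) (h₂ a)).mono (by simp)

theorem esize_prod (p : α × β) : esize p = esize p.1 + esize p.2 + 1 := by
  simp [esize, enc]

@[simp] theorem esize_mk (a : α) (b : β) : esize (a, b) = esize a + esize b + 1 := by
  simp [esize, enc]

@[simp] theorem esize_nil : esize ([] : List α) = 1 := by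
  simp [esize, enc, Data.ofList]

@[simp] theorem esize_cons (a : α) (l : List α) :
    esize (a :: l) = esize a + esize l + 1 := by
  simp [esize, enc, Data.ofList]

@[simp] theorem esize_append (l₁ l₂ : List α) :
    esize (l₁ ++ l₂) + 1 = esize l₁ + esize l₂ := by
  induction l₁ with
  | nil => simp; omega
  | cons a l ih => simp; omega

/-- Iterating a polynomial-time step can square the size each time, so the bound `u` on all
intermediate states is essential. The fixed input `a` is carried along as part of the state, because
the step may depend on it. -/
theorem PTm.foldl {f : α → List β} {g : α → σ} {h : α → σ → β → σ} (hf : PTm μ f) (hg : PTm μ g)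
    (hh : PT fun p : α × σ × β => h p.1 p.2.1 p.2.2) (hμ : PB esize μ) (u : α → ℕ)
    (hu : PB u μ) (hB : ∀ a l₁ l₂, f a = l₁ ++ l₂ → esize (l₁.foldl (h a) (g a)) ≤ u a) :
    PTm μ fun a => (f a).foldl (h a) (g a) := by
  have h1 : PTm μ fun a => (f a, (a, g a)) := hf.pair ((of_PT .id hμ).pair hg hμ) hμ
  have h2 : PT fun p : β × α × σ => (p.2.1, h p.2.1 p.2.2 p.1) := by
    refine PT.pair (by fun_prop) ?_
    exact hh.comp (g := fun p : β × α × σ => (p.2.1, p.2.2, p.1)) (by fun_prop)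
  obtain ⟨p₂, q₂, h₂⟩ := h2
  have hs := hf.pb_esize hμ
  obtain ⟨p₁, T₁, hT₁, h₁⟩ := h1.runs
  obtain ⟨p₃, q₃, h₃⟩ := PT.snd' (α := α) (β := σ)
  have hsz : PB (fun a => esize a + u a + 1) μ := (hμ.add hu).add (.const 1)
  refine .of_runs (.seq p₁ (.seq (foldProg p₂) p₃))
    (hT₁.add (((hs.mul (((((hsz.add hs).add (.const 1)).comp (q := q₂)).add
      ((PB.const 40).mul hs)).add ((PB.const 40).mul hsz) |>.add (.const 50))).add (.const 4)).add
      (hsz.comp (q := q₃)))) fun a => (h₁ a).seq ?_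
  have fold_eq : ∀ (l : List β) (s : σ), l.foldl (fun (p : α × σ) b => (p.1, h p.1 p.2 b)) (a, s) =
      (a, l.foldl (h a) s) := by
    intro l
    induction l with
    | nil => simp
    | cons b l ih => intro s; simp [ih]
  have key := foldProg_runs (enc : β → Data) (enc : α × σ → Data) (p := p₂)
    (fun (p : α × σ) b => (p.1, h p.1 p.2 b)) (f a) (a, g a) (esize a + u a + 1)
    (q₂.eval (esize a + u a + 1 + esize (f a) + 1)) (by
      intro l₁ l₂ hl
      rw [fold_eq]
      have := hB a l₁ l₂ hl
      change esize _ ≤ _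
      simp; omega) (by
      intro l₁ b l₂ hl
      rw [fold_eq]
      refine (h₂ (b, a, l₁.foldl (h a) (g a))).mono (polynomial_eval_mono q₂ ?_)
      have h3 := hB a l₁ _ hl
      have h4 := esize_append l₁ (b :: l₂)
      have h5 : 0 < esize l₁ := Data.size_pos _
      rw [← hl] at h4
      simp at h4 ⊢; omega)
  rw [fold_eq] at key
  refine key.seq ((h₃ (a, (f a).foldl (h a) (g a))).mono (polynomial_eval_mono q₃ ?_))
  have := hB a (f a) [] (by simp)
  simp; omega

theorem PT.foldl {f : α → List β} {g : α → σ} {h : α → σ → β → σ} (hf : PT f) (hg : PT g)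
    (hh : PT fun p : α × σ × β => h p.1 p.2.1 p.2.2) (u : α → ℕ)
    (hu : PB u esize)
    (hB : ∀ a l₁ l₂, f a = l₁ ++ l₂ → esize (l₁.foldl (h a) (g a)) ≤ u a) :
    PT fun a => (f a).foldl (h a) (g a) :=
  PTm.foldl hf hg hh .self u hu hB

end

end ParamQC
end

noncomputable section

namespace ParamQC

open Turing Computability

open Enc (enc)

section

variable {α β γ σ : Type} [Enc α] [Enc β] [Enc γ] [Enc σ]

/-! ### Lists and options -/

@[fun_prop]
theorem PT.cons {f : α → β} {g : α → List β} (hf : PT f) (hg : PT g) : PT fun a => f a :: g a :=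
  (hf.pair hg).of_enc_eq fun _ => rfl

@[fun_prop]
theorem PT.tail {f : α → List β} (hf : PT f) : PT fun a => (f a).tail :=
  PT.comp (f := fun l : List β => l.tail) (.of_runs rightProg
    (((PB.const 8).mul .self).add (.const 4)) fun l => by
      have : enc l.tail = (enc l).right := by cases l <;> rfl
      rw [this]; exact rightProg_runs (enc l)) hf

@[fun_prop]
theorem PT.isEmpty {f : α → List β} (hf : PT f) : PT fun a => (f a).isEmpty := by
  refine PT.comp (f := fun l : List β => l.isEmpty) ?_ hf
  obtain ⟨p, T, hT, h⟩ := (PT.id (α := List β)).pair (PT.const ()) |>.runs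
  refine .of_runs (.seq p (iteProg (constProg (enc true)) (constProg (enc false))))
    (hT.add (((PB.const 8).mul .self).add (.const 60))) fun l => (h l).seq ?_
  cases l with
  | nil =>
    refine (iteProg_runs_nil _ (constProg_runs (enc ()) _)).mono ?_
    simp [enc]
  | cons b l =>
    refine (iteProg_runs_cons _ (constProg_runs (enc ()) _)).mono ?_
    have : (enc b).size + (Data.ofList (l.map enc)).size + 1 = esize (b :: l) := by
      simp [esize, enc, Data.ofList]
    simp [enc] at this ⊢; omega

@[fun_prop]
theorem PT.headD {f : α → List β} {g : α → β} (hf : PT f) (hg : PT g) :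
    PT fun a => (f a).headD (g a) := by
  have h1 : PT fun a => (f a, f a, g a) := hf.pair (hf.pair hg)
  obtain ⟨p₁, T₁, hT₁, h₁⟩ := h1.runs
  obtain ⟨p₂, q₂, h₂⟩ := PT.snd' (α := List β) (β := β)
  have hL : PB (fun a => 70 * esize (f a, g a) + 70 + q₂.eval (esize (f a, g a))) esize :=
    (((PB.const 70).mul (hf.pair hg).pb_esize).add (.const 70)).add ((hf.pair hg).pb_esize.comp (q := q₂))
  refine .of_runs (.seq p₁ (iteProg p₂ (.seq leftProg leftProg)))
    (hT₁.add hL) fun a => (h₁ a).seq ?_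
  have hx := h₂ (f a, g a)
  cases hfa : f a with
  | nil =>
    rw [hfa] at hx
    exact (iteProg_runs_nil _ hx).mono (by simp; omega)
  | cons b l =>
    refine (iteProg_runs_cons _ ((leftProg_runs (enc (b :: l, g a))).seq
      (leftProg_runs (enc (b :: l))))).mono ?_
    have : (enc b).size + (Data.ofList (l.map enc)).size + 1 = esize (b :: l) := by
      simp [esize, enc, Data.ofList]
    have h2 : (enc (b :: l, g a)).size = esize (b :: l) + esize (g a) + 1 := esize_mk _ _
    have h3 : (enc (b :: l)).size = esize (b :: l) := rfl
    rw [esize_mk, h2, h3]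
    omega

@[fun_prop]
theorem PT.some {f : α → β} (hf : PT f) : PT fun a => some (f a) :=
  (hf.pair (PT.const ())).of_enc_eq fun _ => rfl

@[fun_prop]
theorem PT.optionToList {f : α → Option β} (hf : PT f) : PT fun a => (f a).toList :=
  hf.of_enc_eq fun a => by cases f a <;> rfl

@[fun_prop]
theorem PT.not {f : α → Bool} (hf : PT f) : PT fun a => !(f a) :=
  (hf.cond (PT.const false) (PT.const true)).of_eq fun a => by cases f a <;> rfl

@[fun_prop]
theorem PT.and {f g : α → Bool} (hf : PT f) (hg : PT g) : PT fun a => f a && g a :=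
  (hf.cond hg (PT.const false)).of_eq fun a => by cases f a <;> rfl

@[fun_prop]
theorem PT.or {f g : α → Bool} (hf : PT f) (hg : PT g) : PT fun a => f a || g a :=
  (hf.cond (PT.const true) hg).of_eq fun a => by cases f a <;> rfl

@[fun_prop]
theorem PT.xor {f g : α → Bool} (hf : PT f) (hg : PT g) : PT fun a => Bool.xor (f a) (g a) :=
  (hf.cond hg.not hg).of_eq fun a => by cases f a <;> simp

theorem esize_list_eq_sum (l : List β) : esize l = (l.map fun b => esize b + 1).sum + 1 := by
  induction l with
  | nil => simp
  | cons b l ih => simp [ih]; omega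

theorem length_lt_esize (l : List β) : l.length < esize l := by
  induction l with
  | nil => simp
  | cons b l ih => simp; omega

theorem esize_le_of_mem {l : List β} {b : β} (h : b ∈ l) : esize b ≤ esize l := by
  induction l with
  | nil => simp at h
  | cons c l ih =>
    rcases List.mem_cons.mp h with rfl | h
    · simp; omega
    · simp; have := ih h; omega

theorem esize_list_le {l : List β} {M : ℕ} (h : ∀ b ∈ l, esize b ≤ M) :
    esize l ≤ l.length * (M + 1) + 1 := by
  induction l with
  | nil => simp
  | cons b l ih =>
    have h1 := h b (by simp)
    have h2 := ih fun c hc => h c (by simp [hc])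
    simp [add_mul] at h2 ⊢; omega

theorem esize_list_mono {l₁ l₂ : List β} (h : l₁.Sublist l₂) : esize l₁ ≤ esize l₂ := by
  induction h with
  | slnil => simp
  | cons b _ ih => simp; omega
  | cons_cons b _ ih => simp; omega

theorem esize_reverse (l : List β) : esize l.reverse = esize l := by
  simp [esize_list_eq_sum, List.map_reverse, List.sum_reverse]

@[fun_prop]
theorem PT.reverse {f : α → List β} (hf : PT f) : PT fun a => (f a).reverse := by
  have h := PT.foldl hf (PT.const ([] : List β)) (h := fun _ s b => b :: s) (by fun_prop)
    (fun a => esize (f a)) (by fun_prop) fun a l₁ l₂ h => by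
      simp only [List.foldl_flip_cons_eq_append', List.append_nil]
      rw [esize_reverse, h]
      exact esize_list_mono (List.sublist_append_left _ _)
  exact h.of_eq fun a => by simp

@[fun_prop]
theorem PT.append {f g : α → List β} (hf : PT f) (hg : PT g) : PT fun a => f a ++ g a := by
  have h := PT.foldl hf.reverse hg (h := fun _ s b => b :: s) (by fun_prop)
    (fun a => esize (f a) + esize (g a)) (by fun_prop) fun a l₁ l₂ h => by
      simp only [List.foldl_flip_cons_eq_append']
      have h1 := esize_append l₁.reverse (g a)
      have h2 : esize l₁ ≤ esize (f a) := by
        rw [← esize_reverse (f a), h]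
        exact esize_list_mono (List.sublist_append_left _ _)
      rw [esize_reverse] at h1
      omega
  exact h.of_eq fun a => by simp

theorem PT.map {f : α → List β} {h : α → β → γ} (hf : PT f) (hh : PT fun p : α × β => h p.1 p.2) :
    PT fun a => (f a).map (h a) := by
  obtain ⟨q, hq⟩ := hh.pb_esize
  have h1 : ∀ (a : α) (l : List β) (s : List γ), l.foldl (fun s b => h a b :: s) s =
      (l.map (h a)).reverse ++ s := by
    intro a l
    induction l with
    | nil => simp
    | cons b l ih => simp [ih]
  have h2 := PT.foldl hf (PT.const ([] : List γ)) (h := fun a s b => h a b :: s)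
    ((PT.comp (f := fun p : α × β => h p.1 p.2) hh
      (g := fun p : α × List γ × β => (p.1, p.2.2)) (by fun_prop)).cons (by fun_prop))
    (fun a => esize (f a) * (q.eval (esize a + esize (f a) + 1) + 1) + 1)
    ((hf.pb_esize.mul (((((PB.self).add hf.pb_esize).add (.const 1)).comp (q := q)).add (.const 1))).add
      (.const 1)) fun a l₁ l₂ hl => by
        rw [h1, List.append_nil, esize_reverse]
        refine (esize_list_le (M := q.eval (esize a + esize (f a) + 1)) ?_).trans ?_
        · intro c hc
          obtain ⟨b, hb, rfl⟩ := List.mem_map.mp hc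
          refine (hq (a, b)).trans (polynomial_eval_mono q ?_)
          have := esize_le_of_mem (l := f a) (b := b) (by rw [hl]; simp [hb])
          simp; omega
        · have h3 := length_lt_esize (f a)
          rw [List.length_map]
          have h4 : l₁.length ≤ esize (f a) := by
            rw [hl] at h3 ⊢; simp at h3; omega
          gcongr
  exact h2.reverse.of_eq fun a => by simp [h1]

@[fun_prop]
theorem PT.flatten {f : α → List (List β)} (hf : PT f) : PT fun a => (f a).flatten := by
  have h1 : ∀ (l : List (List β)) (s : List β), l.foldl (fun s b => s ++ b) s =
      s ++ l.flatten := by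
    intro l
    induction l with
    | nil => simp
    | cons b l ih => simp [ih]
  have h2 : ∀ l : List (List β), esize l.flatten ≤ esize l := by
    intro l
    induction l with
    | nil => simp
    | cons b l ih =>
      have := esize_append b l.flatten
      simp; omega
  have h3 := PT.foldl hf (PT.const ([] : List β)) (h := fun _ s b => s ++ b) (by fun_prop)
    (fun a => esize (f a)) (by fun_prop) fun a l₁ l₂ hl => by
      rw [h1, List.nil_append, hl]
      exact (h2 _).trans (esize_list_mono (List.sublist_append_left _ _))
  exact h3.of_eq fun a => by simp [h1]

theorem PT.flatMap {f : α → List β} {h : α → β → List γ} (hf : PT f)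
    (hh : PT fun p : α × β => h p.1 p.2) : PT fun a => (f a).flatMap (h a) :=
  (PT.map hf hh).flatten.of_eq fun a => by rw [List.flatMap_def]

theorem PT.filter {f : α → List β} {h : α → β → Bool} (hf : PT f)
    (hh : PT fun p : α × β => h p.1 p.2) : PT fun a => (f a).filter (h a) := by
  have h1 : PT fun a => (f a).flatMap fun b => bif h a b then [b] else [] :=
    PT.flatMap hf (PT.cond hh (by fun_prop) (by fun_prop))
  refine h1.of_eq fun a => ?_
  induction f a with
  | nil => rfl
  | cons b l ih => cases hb : h a b <;> simp [hb, ih]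

theorem PT.all {f : α → List β} {h : α → β → Bool} (hf : PT f)
    (hh : PT fun p : α × β => h p.1 p.2) : PT fun a => (f a).all (h a) := by
  refine (PT.filter (h := fun a b => !h a b) hf hh.not).isEmpty.of_eq fun a => ?_
  rw [Bool.eq_iff_iff]
  simp [List.isEmpty_iff, List.filter_eq_nil_iff]

theorem PT.any {f : α → List β} {h : α → β → Bool} (hf : PT f)
    (hh : PT fun p : α × β => h p.1 p.2) : PT fun a => (f a).any (h a) := by
  refine (PT.filter hf hh).isEmpty.not.of_eq fun a => ?_
  rw [Bool.eq_iff_iff]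
  simp [List.filter_eq_nil_iff]

end

end ParamQC
end

noncomputable section

namespace ParamQC

open Turing Computability

open Enc (enc)

section

variable {α β γ σ : Type} [Enc α] [Enc β] [Enc γ] [Enc σ]

/-! ### Arithmetic of natural numbers -/

@[fun_prop]
theorem PT.natBits {f : α → ℕ} (hf : PT f) : PT fun a => (f a).bits :=
  hf.of_enc_eq fun _ => rfl

-- The code of a number has no leading zeros, so a digit `false` on top of the number zero must not
-- be recorded.
@[fun_prop]
theorem PT.natBit {f : α → Bool} {g : α → ℕ} (hf : PT f) (hg : PT g) :
    PT fun a => Nat.bit (f a) (g a) := by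
  have h : PT fun a => bif f a || !(g a).bits.isEmpty then f a :: (g a).bits else [] := by fun_prop
  refine h.of_enc_eq fun a => ?_
  change _ = enc (Nat.bit (f a) (g a)).bits
  congr 1
  rcases Nat.eq_zero_or_pos (g a) with h0 | h0
  · rw [h0]; cases f a <;> simp
  · have h1 : (g a).bits ≠ [] := fun h => by
      have := Nat.size_eq_bits_len (g a)
      rw [h] at this
      exact h0.ne' (Nat.size_eq_zero.mp this.symm)
    rw [Nat.bits_append_bit _ _ (fun h => absurd h h0.ne')]
    cases h2 : (g a).bits with
    | nil => exact absurd h2 h1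
    | cons b l => cases f a <;> rfl

@[fun_prop]
theorem PT.div2 {f : α → ℕ} (hf : PT f) : PT fun a => (f a).div2 :=
  hf.natBits.tail.of_enc_eq fun a => by
    change _ = enc (f a).div2.bits
    rw [Nat.div2_bits_eq_tail]

@[fun_prop]
theorem PT.bodd {f : α → ℕ} (hf : PT f) : PT fun a => (f a).bodd :=
  (hf.natBits.headD (PT.const false)).of_eq fun a => by
    rw [Nat.bodd_eq_bits_head]
    cases (f a).bits <;> rfl

theorem esize_bool (b : Bool) : esize b ≤ 3 := by cases b <;> simp [esize, enc]

theorem esize_boolList (l : List Bool) : esize l ≤ 4 * l.length + 1 :=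
  (esize_list_le fun b _ => esize_bool b).trans (by omega)

theorem esize_nat (n : ℕ) : esize n ≤ 4 * n.size + 1 := by
  have := esize_boolList n.bits
  rwa [Nat.size_eq_bits_len] at this

theorem esize_nat_le {n m : ℕ} (h : n < 2 ^ m) : esize n ≤ 4 * m + 1 :=
  (esize_nat n).trans (by have := Nat.size_le.mpr h; omega)

theorem size_lt_esize (n : ℕ) : n.size < esize n := by
  have := length_lt_esize n.bits
  rwa [Nat.size_eq_bits_len] at this

theorem lt_two_pow_esize (n : ℕ) : n < 2 ^ esize n :=
  Nat.size_le.mp (size_lt_esize n).le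

theorem esize_div2 (n : ℕ) : esize n.div2 ≤ esize n := by
  change esize n.div2.bits ≤ esize n.bits
  rw [Nat.div2_bits_eq_tail]
  exact esize_list_mono (List.tail_sublist _)

/-- The number with the given binary digits, the most significant one first. -/
def msb (l : List Bool) : ℕ := l.foldl (fun n b => Nat.bit b n) 0

theorem foldl_bit (l : List Bool) (n : ℕ) :
    l.foldl (fun n b => Nat.bit b n) n = n * 2 ^ l.length + msb l := by
  induction l generalizing n with
  | nil => simp [msb]
  | cons b l ih =>
    rw [msb, List.foldl_cons, List.foldl_cons, ih, ih (Nat.bit b 0)]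
    simp only [Nat.bit_val, List.length_cons, pow_succ]
    ring

@[simp] theorem msb_nil : msb [] = 0 := rfl

theorem msb_cons (b : Bool) (l : List Bool) : msb (b :: l) = b.toNat * 2 ^ l.length + msb l := by
  rw [msb, List.foldl_cons, foldl_bit]
  simp [Nat.bit_val]

theorem msb_concat (b : Bool) (l : List Bool) : msb (l ++ [b]) = Nat.bit b (msb l) := by
  simp [msb]

theorem msb_lt (l : List Bool) : msb l < 2 ^ l.length := by
  induction l with
  | nil => simp
  | cons b l ih => cases b <;> simp [msb_cons, pow_succ] <;> omega

theorem msb_bits_reverse (n : ℕ) : msb n.bits.reverse = n := by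
  induction n using Nat.binaryRec' with
  | zero => simp
  | bit b n h ih => rw [Nat.bits_append_bit _ _ h, List.reverse_cons, msb_concat, ih]

@[fun_prop]
theorem PT.msbFn {f : α → List Bool} (hf : PT f) : PT fun a => msb (f a) :=
  PT.foldl hf (PT.const 0) (h := fun _ n b => Nat.bit b n) (by fun_prop)
    (fun a => 4 * esize (f a) + 1) (by fun_prop) fun a l₁ l₂ h => by
      refine (esize_nat_le (msb_lt l₁)).trans ?_
      have := length_lt_esize (f a)
      rw [h] at this ⊢
      simp at this ⊢; omega

theorem PT.bool3 (t : Bool → Bool → Bool → β) {f g h : α → Bool} (hf : PT f) (hg : PT g)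
    (hh : PT h) : PT fun a => t (f a) (g a) (h a) := by
  have : PT fun a => bif f a then bif g a then bif h a then t true true true else t true true false
      else bif h a then t true false true else t true false false else
      bif g a then bif h a then t false true true else t false true false
      else bif h a then t false false true else t false false false := by fun_prop
  exact this.of_eq fun a => by cases f a <;> cases g a <;> cases h a <;> rfl

/-- A digit-by-digit operation with carry, which produces the digits with the most significant one
first. -/
def rippleStep (t : Bool → Bool → Bool → Bool × Bool) (s : (ℕ × ℕ) × Bool × List Bool) :
    (ℕ × ℕ) × Bool × List Bool :=
  ((s.1.1.div2, s.1.2.div2), (t s.1.1.bodd s.1.2.bodd s.2.1).2,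
    (t s.1.1.bodd s.1.2.bodd s.2.1).1 :: s.2.2)

def rippleAux (t : Bool → Bool → Bool → Bool × Bool) (l : List Bool)
    (s : (ℕ × ℕ) × Bool × List Bool) : (ℕ × ℕ) × Bool × List Bool :=
  l.foldl (fun s _ => rippleStep t s) s

/-- The list only acts as a clock. It has one entry more than `x` and `y` have digits together,
which leaves room for the carry (`lt_two_pow_ripple`). -/
def ripple (t : Bool → Bool → Bool → Bool × Bool) (x y : ℕ) : (ℕ × ℕ) × Bool × List Bool :=
  rippleAux t (x.bits ++ y.bits ++ [true]) ((x, y), false, [])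

theorem rippleAux_length (t : Bool → Bool → Bool → Bool × Bool) (l : List Bool) :
    ∀ s, (rippleAux t l s).2.2.length = s.2.2.length + l.length := by
  induction l with
  | nil => simp [rippleAux]
  | cons b l ih =>
    intro s
    have := ih (rippleStep t s)
    simp only [rippleAux, List.foldl_cons] at this ⊢
    rw [this]
    simp [rippleStep]; omega

theorem rippleAux_esize (t : Bool → Bool → Bool → Bool × Bool) (l : List Bool) :
    ∀ s, esize (rippleAux t l s).1 ≤ esize s.1 := by
  induction l with
  | nil => simp [rippleAux]
  | cons b l ih =>
    intro s
    refine (ih (rippleStep t s)).trans ?_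
    have h1 := esize_div2 s.1.1
    have h2 := esize_div2 s.1.2
    simp only [rippleStep, esize_mk, esize_prod s.1]
    omega

theorem PT.rippleFn (t : Bool → Bool → Bool → Bool × Bool) {f g : α → ℕ} (hf : PT f) (hg : PT g) :
    PT fun a => ripple t (f a) (g a) := by
  refine PT.foldl (f := fun a => (f a).bits ++ (g a).bits ++ [true])
    (g := fun a => ((f a, g a), false, [])) (h := fun _ s _ => rippleStep t s) (by fun_prop)
    (by fun_prop) ?_ (fun a => 6 * (esize (f a) + esize (g a)) + 20)
    (by fun_prop) fun a l₁ l₂ h => ?_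
  · have h := PT.bool3 t (f := fun p : α × ((ℕ × ℕ) × Bool × List Bool) × Bool => p.2.1.1.1.bodd)
      (g := fun p => p.2.1.1.2.bodd) (h := fun p => p.2.1.2.1)
      (by fun_prop) (by fun_prop) (by fun_prop)
    refine PT.pair (by fun_prop) (PT.pair h.snd (PT.cons h.fst (by fun_prop)))
  · have h1 := rippleAux_length t l₁ ((f a, g a), false, [])
    have h2 := rippleAux_esize t l₁ ((f a, g a), false, [])
    have h3 := esize_boolList (rippleAux t l₁ ((f a, g a), false, [])).2.2
    have h4 := esize_bool (rippleAux t l₁ ((f a, g a), false, [])).2.1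
    have h5 := congrArg List.length h
    have h6 := size_lt_esize (f a)
    have h7 := size_lt_esize (g a)
    simp only [List.length_append, List.length_cons, List.length_nil,
      Nat.size_eq_bits_len] at h1 h5
    simp only [esize_mk] at h2
    change esize (rippleAux t l₁ ((f a, g a), false, [])) ≤ _
    rw [esize_prod, esize_prod (rippleAux t l₁ ((f a, g a), false, [])).2]
    omega

theorem nat_eq_bodd_add_div2 (n : ℕ) : n = n.bodd.toNat + 2 * n.div2 := by
  conv_lhs => rw [← Nat.bit_bodd_div2 n, Nat.bit_val]
  omega

theorem lt_two_pow_ripple (x y : ℕ) : x + y < 2 ^ (x.bits ++ y.bits ++ [true]).length := by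
  have h1 := Nat.lt_size_self x
  have h2 := Nat.lt_size_self y
  simp only [List.length_append, Nat.size_eq_bits_len, List.length_singleton, pow_succ, pow_add]
  have := Nat.one_le_two_pow (n := x.size)
  have := Nat.one_le_two_pow (n := y.size)
  nlinarith

def addTable (x y c : Bool) : Bool × Bool :=
  (Bool.xor x (Bool.xor y c), (x && y) || (x && c) || (y && c))

/-- Invariant of schoolbook addition: the digits already produced, plus the current power of two
times the sum of the unread parts and the carry, do not change. -/
theorem rippleAux_add (l : List Bool) : ∀ s,
    msb (rippleAux addTable l s).2.2 + 2 ^ (rippleAux addTable l s).2.2.length *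
      ((rippleAux addTable l s).1.1 + (rippleAux addTable l s).1.2 +
        (rippleAux addTable l s).2.1.toNat) =
    msb s.2.2 + 2 ^ s.2.2.length * (s.1.1 + s.1.2 + s.2.1.toNat) := by
  induction l with
  | nil => simp [rippleAux]
  | cons b l ih =>
    rintro ⟨⟨x, y⟩, c, acc⟩
    refine (ih (rippleStep addTable ((x, y), c, acc))).trans ?_
    simp only [rippleStep]
    conv_rhs => rw [nat_eq_bodd_add_div2 x, nat_eq_bodd_add_div2 y]
    rw [msb_cons, List.length_cons, pow_succ]
    cases x.bodd <;> cases y.bodd <;> cases c <;> simp [addTable] <;> ring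

@[fun_prop]
theorem PT.natAdd {f g : α → ℕ} (hf : PT f) (hg : PT g) : PT fun a => f a + g a := by
  refine (PT.msbFn (PT.rippleFn addTable hf hg).snd.snd).of_eq fun a => ?_
  have h1 := rippleAux_add ((f a).bits ++ (g a).bits ++ [true]) ((f a, g a), false, [])
  have h2 := lt_two_pow_ripple (f a) (g a)
  have h3 := rippleAux_length addTable ((f a).bits ++ (g a).bits ++ [true])
    ((f a, g a), false, [])
  simp only [List.length_nil, zero_add] at h3
  rw [h3] at h1
  simp only [msb_nil, List.length_nil, pow_zero, Bool.toNat_false, add_zero, zero_add,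
    one_mul] at h1
  rw [ripple]
  -- If anything were left over after the last step, the sum would be at least the power of two that
  -- exceeds it.
  rcases Nat.eq_zero_or_pos ((rippleAux addTable ((f a).bits ++ (g a).bits ++ [true])
    ((f a, g a), false, [])).1.1 + (rippleAux addTable ((f a).bits ++ (g a).bits ++ [true])
    ((f a, g a), false, [])).1.2 + (rippleAux addTable ((f a).bits ++ (g a).bits ++ [true])
    ((f a, g a), false, [])).2.1.toNat) with h | h
  · rw [h] at h1; simpa using h1
  · have := Nat.mul_le_mul_left (2 ^ ((f a).bits ++ (g a).bits ++ [true]).length) h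
    omega

def subTable (x y c : Bool) : Bool × Bool :=
  (Bool.xor x (Bool.xor y c), (!x && (y || c)) || (y && c))

theorem rippleAux_sub (l : List Bool) : ∀ s,
    (msb (rippleAux subTable l s).2.2 : ℤ) + 2 ^ (rippleAux subTable l s).2.2.length *
      ((rippleAux subTable l s).1.1 - (rippleAux subTable l s).1.2 -
        (rippleAux subTable l s).2.1.toNat) =
    msb s.2.2 + 2 ^ s.2.2.length * (s.1.1 - s.1.2 - s.2.1.toNat) := by
  induction l with
  | nil => simp [rippleAux]
  | cons b l ih =>
    rintro ⟨⟨x, y⟩, c, acc⟩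
    refine (ih (rippleStep subTable ((x, y), c, acc))).trans ?_
    simp only [rippleStep]
    conv_rhs => rw [nat_eq_bodd_add_div2 x, nat_eq_bodd_add_div2 y]
    rw [msb_cons, List.length_cons, pow_succ]
    cases x.bodd <;> cases y.bodd <;> cases c <;> simp [subTable] <;> ring

theorem rippleAux_div2 (t : Bool → Bool → Bool → Bool × Bool) (l : List Bool) :
    ∀ s, (rippleAux t l s).1 = (s.1.1 / 2 ^ l.length, s.1.2 / 2 ^ l.length) := by
  induction l with
  | nil => simp [rippleAux]
  | cons b l ih =>
    intro s
    refine (ih (rippleStep t s)).trans ?_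
    simp [rippleStep, Nat.div2_val, pow_succ', Nat.div_div_eq_div_mul]

/-- Both operands are used up at the end, so the digits give the difference modulo the power of two
and the last borrow tells whether it is negative. Comparison and truncated subtraction both read off
this identity. -/
theorem ripple_sub (x y : ℕ) : (x : ℤ) - y = msb (ripple subTable x y).2.2 -
    2 ^ (x.bits ++ y.bits ++ [true]).length * ((ripple subTable x y).2.1.toNat : ℤ) ∧
    msb (ripple subTable x y).2.2 < 2 ^ (x.bits ++ y.bits ++ [true]).length := by
  have h1 := rippleAux_sub (x.bits ++ y.bits ++ [true]) ((x, y), false, [])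
  have h2 := lt_two_pow_ripple x y
  have h3 := rippleAux_length subTable (x.bits ++ y.bits ++ [true]) ((x, y), false, [])
  have h4 := rippleAux_div2 subTable (x.bits ++ y.bits ++ [true]) ((x, y), false, [])
  simp only [List.length_nil, zero_add] at h3
  have h5 := msb_lt (rippleAux subTable (x.bits ++ y.bits ++ [true]) ((x, y), false, [])).2.2
  rw [h3] at h1 h5
  rw [h4] at h1
  dsimp only at h1
  rw [Nat.div_eq_of_lt (by omega), Nat.div_eq_of_lt (by omega)] at h1
  simp only [msb_nil, List.length_nil, pow_zero, Bool.toNat_false, one_mul] at h1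
  refine ⟨?_, h5⟩
  rw [ripple]
  push_cast at h1
  linarith

@[fun_prop]
theorem PT.natLt {f g : α → ℕ} (hf : PT f) (hg : PT g) : PT fun a => decide (f a < g a) := by
  refine (PT.rippleFn subTable hf hg).snd.fst.of_eq fun a => ?_
  obtain ⟨h1, h2⟩ := ripple_sub (f a) (g a)
  have h3 : (msb (ripple subTable (f a) (g a)).2.2 : ℤ) <
    2 ^ ((f a).bits ++ (g a).bits ++ [true]).length := by exact_mod_cast h2
  cases h : (ripple subTable (f a) (g a)).2.1 <;> rw [h] at h1 <;> simp at h1 h3 ⊢ <;> omega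

@[fun_prop]
theorem PT.natSub {f g : α → ℕ} (hf : PT f) (hg : PT g) : PT fun a => f a - g a := by
  have h : PT fun a => bif decide (f a < g a) then 0 else
    msb (ripple subTable (f a) (g a)).2.2 :=
    PT.cond (hf.natLt hg) (PT.const 0) (PT.msbFn (PT.rippleFn subTable hf hg).snd.snd)
  refine h.of_eq fun a => ?_
  obtain ⟨h1, h2⟩ := ripple_sub (f a) (g a)
  have h3 : (msb (ripple subTable (f a) (g a)).2.2 : ℤ) <
    2 ^ ((f a).bits ++ (g a).bits ++ [true]).length := by exact_mod_cast h2
  cases h : (ripple subTable (f a) (g a)).2.1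
  · rw [h] at h1
    simp only [Bool.toNat_false, Nat.cast_zero, mul_zero, sub_zero] at h1
    have h4 : ¬ f a < g a := by omega
    simp only [h4, decide_false, cond_false]; omega
  · rw [h] at h1
    simp only [Bool.toNat_true, Nat.cast_one, mul_one] at h1
    have h4 : f a < g a := by omega
    simp only [h4, decide_true, cond_true]; omega

@[fun_prop]
theorem PT.natLe {f g : α → ℕ} (hf : PT f) (hg : PT g) : PT fun a => decide (f a ≤ g a) :=
  (hg.natLt hf).not.of_eq fun a => by
    by_cases h : f a ≤ g a
    · simp [h]
    · simp [h, not_le.mp h]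

@[fun_prop]
theorem PT.natEq {f g : α → ℕ} (hf : PT f) (hg : PT g) : PT fun a => decide (f a = g a) :=
  ((hg.natLt hf).not.and (hf.natLt hg).not).of_eq fun a => by
    rw [Bool.eq_iff_iff]; simp; omega

/-- Horner's scheme in base two. -/
theorem mulAux (l : List Bool) (y : ℕ) :
    l.foldl (fun n b => Nat.bit false n + bif b then y else 0) 0 = msb l * y := by
  induction l using List.reverseRecOn with
  | nil => simp
  | append_singleton l b ih =>
    rw [List.foldl_append, ih, msb_concat]
    cases b <;> simp [Nat.bit_val] <;> ring

@[fun_prop]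
theorem PT.natMul {f g : α → ℕ} (hf : PT f) (hg : PT g) : PT fun a => f a * g a := by
  have h := PT.foldl (f := fun a => (f a).bits.reverse) (g := fun _ => 0)
    (h := fun a n b => Nat.bit false n + bif b then g a else 0) (by fun_prop) (by fun_prop)
    (by fun_prop) (fun a => 4 * (esize (f a) + esize (g a)) + 1) (by fun_prop)
    fun a l₁ l₂ h => by
      rw [mulAux]
      have h1 := lt_two_pow_esize (g a)
      have h2 := msb_lt l₁
      refine (esize_nat_le (m := l₁.length + esize (g a)) ?_).trans ?_
      · rw [pow_add]; exact Nat.mul_lt_mul'' h2 h1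
      · have h3 := congrArg List.length h
        have h4 := size_lt_esize (f a)
        simp [Nat.size_eq_bits_len] at h3
        omega
  exact h.of_eq fun a => by rw [mulAux, msb_bits_reverse]

def divStep (d : ℕ) (s : ℕ × ℕ) (b : Bool) : ℕ × ℕ :=
  bif decide (d ≤ Nat.bit b s.2) then (Nat.bit true s.1, Nat.bit b s.2 - d)
  else (Nat.bit false s.1, Nat.bit b s.2)

/-- Invariant of binary long division. The size bounds do not need a positive divisor, so the fold
is bounded on every input and division by zero can be separated afterwards. -/
theorem divAux (d : ℕ) (l : List Bool) : (l.foldl (divStep d) (0, 0)).1 < 2 ^ l.length ∧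
    (l.foldl (divStep d) (0, 0)).2 < 2 ^ l.length ∧
    (0 < d → (l.foldl (divStep d) (0, 0)).2 < d) ∧
    (l.foldl (divStep d) (0, 0)).1 * d + (l.foldl (divStep d) (0, 0)).2 = msb l := by
  induction l using List.reverseRecOn with
  | nil => simp
  | append_singleton l b ih =>
    obtain ⟨h1, h2, h3, h4⟩ := ih
    rw [List.foldl_append, msb_concat, ← h4]
    generalize l.foldl (divStep d) (0, 0) = s at *
    simp only [List.foldl_cons, List.foldl_nil, divStep, List.length_append, List.length_singleton,
      pow_succ, Nat.bit_val]
    have hb : b.toNat ≤ 1 := Bool.toNat_le b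
    by_cases h : d ≤ 2 * s.2 + b.toNat
    · simp only [h, decide_true, cond_true, Bool.toNat_true]
      refine ⟨by omega, by omega, fun hd => by have := h3 hd; omega, ?_⟩
      have : (2 * s.1 + 1) * d = 2 * (s.1 * d) + d := by ring
      omega
    · simp only [h, decide_false, cond_false, Bool.toNat_false]
      refine ⟨by omega, by omega, fun hd => by omega, ?_⟩
      have : (2 * s.1 + 0) * d = 2 * (s.1 * d) := by ring
      omega

@[fun_prop]
theorem PT.natDiv {f g : α → ℕ} (hf : PT f) (hg : PT g) : PT fun a => f a / g a := by
  have h := PT.foldl (f := fun a => (f a).bits.reverse) (g := fun _ => (0, 0))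
    (h := fun a s b => divStep (g a) s b) (by fun_prop) (by fun_prop)
    (PT.cond (by fun_prop) (by fun_prop) (by fun_prop)) (fun a => 8 * esize (f a) + 3)
    (by fun_prop) fun a l₁ l₂ h => by
      obtain ⟨h1, h2, -, -⟩ := divAux (g a) l₁
      have h3 := congrArg List.length h
      have h4 := size_lt_esize (f a)
      have h5 := esize_nat_le h1
      have h6 := esize_nat_le h2
      simp [Nat.size_eq_bits_len] at h3
      rw [esize_prod]
      change esize (l₁.foldl (divStep (g a)) (0, 0)).1 + esize (l₁.foldl (divStep (g a)) (0, 0)).2 + 1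
        ≤ _
      omega
  refine (((PT.const 0).natLt hg).cond h.fst (PT.const 0)).of_eq fun a => ?_
  rcases Nat.eq_zero_or_pos (g a) with h0 | h0
  · simp [h0]
  · simp only [h0, decide_true, cond_true]
    obtain ⟨-, -, h3, h4⟩ := divAux (g a) (f a).bits.reverse
    rw [msb_bits_reverse] at h4
    conv_rhs => rw [← h4, Nat.mul_comm, Nat.mul_add_div h0, Nat.div_eq_of_lt (h3 h0), add_zero]

@[fun_prop]
theorem PT.length {f : α → List β} (hf : PT f) : PT fun a => (f a).length := by
  have h1 : ∀ (l : List β), l.foldl (fun n _ => n + 1) 0 = l.length := fun l => by simp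
  have h := PT.foldl hf (PT.const 0) (h := fun _ n _ => n + 1) (by fun_prop)
    (fun a => 4 * esize (f a) + 1) (by fun_prop) fun a l₁ l₂ h => by
      rw [h1]
      have h2 : l₁.length < 2 ^ l₁.length := Nat.lt_two_pow_self
      refine (esize_nat_le h2).trans ?_
      have := length_lt_esize (f a)
      rw [h] at this ⊢
      simp at this ⊢; omega
  exact h.of_eq fun a => h1 _

/-- Powers of two with the exponent in unary. -/
theorem PT.twoPow {f : α → List β} (hf : PT f) : PT fun a => 2 ^ (f a).length := by
  have h1 : ∀ (l : List β), l.foldl (fun n _ => Nat.bit false n) 1 = 2 ^ l.length := fun l => by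
    induction l using List.reverseRecOn with
    | nil => simp
    | append_singleton l b ih => rw [List.foldl_append, ih]; simp [pow_succ, Nat.bit_val]; ring
  have h := PT.foldl hf (PT.const 1) (h := fun _ n _ => Nat.bit false n) (by fun_prop)
    (fun a => 4 * esize (f a) + 1) (by fun_prop) fun a l₁ l₂ h => by
      rw [h1]
      have h2 : 2 ^ l₁.length < 2 ^ (l₁.length + 1) := by rw [pow_succ]; have := Nat.one_le_two_pow (n := l₁.length); omega
      refine (esize_nat_le h2).trans ?_
      have := length_lt_esize (f a)
      rw [h] at this ⊢
      simp at this ⊢; omega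
  exact h.of_eq fun a => h1 _

end

end ParamQC
end

noncomputable section

namespace ParamQC

open Turing Computability

open Enc (enc)

section

variable {α β γ σ : Type} [Enc α] [Enc β] [Enc γ] [Enc σ]

/-! ### Arithmetic of integers -/

@[fun_prop]
theorem PT.intIsNeg {f : α → ℤ} (hf : PT f) : PT fun a => decide (f a < 0) := by
  have h : PT fun a => (decide (f a < 0), (f a).natAbs) := hf.of_enc_eq fun _ => rfl
  exact h.fst

@[fun_prop]
theorem PT.natAbs {f : α → ℤ} (hf : PT f) : PT fun a => (f a).natAbs := by
  have h : PT fun a => (decide (f a < 0), (f a).natAbs) := hf.of_enc_eq fun _ => rfl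
  exact h.snd

@[fun_prop]
theorem PT.natCast {f : α → ℕ} (hf : PT f) : PT fun a => (f a : ℤ) :=
  ((PT.const false).pair hf).of_enc_eq fun a => by
    change _ = enc (decide ((f a : ℤ) < 0), (f a : ℤ).natAbs)
    rw [decide_eq_false (by omega), Int.natAbs_natCast]

theorem PT.negCast {f : α → ℕ} (hf : PT f) : PT fun a => -(f a : ℤ) := by
  have h : PT fun a => (decide (0 < f a), f a) := by fun_prop
  refine h.of_enc_eq fun a => ?_
  change _ = enc (decide (-(f a : ℤ) < 0), (-(f a : ℤ)).natAbs)
  simp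

@[fun_prop]
theorem PT.subCast {f g : α → ℕ} (hf : PT f) (hg : PT g) : PT fun a => (f a : ℤ) - (g a : ℤ) := by
  have h : PT fun a => bif decide (f a < g a) then -((g a - f a : ℕ) : ℤ)
      else ((f a - g a : ℕ) : ℤ) :=
    PT.cond (hf.natLt hg) (hg.natSub hf).negCast (hf.natSub hg).natCast
  refine h.of_eq fun a => ?_
  by_cases h : f a < g a <;> simp [h] <;> omega

@[fun_prop]
theorem PT.toNat {f : α → ℤ} (hf : PT f) : PT fun a => (f a).toNat :=
  (hf.intIsNeg.cond (PT.const 0) hf.natAbs).of_eq fun a => by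
    by_cases h : f a < 0 <;> simp [h] <;> omega

@[fun_prop]
theorem PT.neg {f : α → ℤ} (hf : PT f) : PT fun a => -f a := by
  have h : PT fun a => bif decide (f a < 0) then ((f a).natAbs : ℤ) else -((f a).natAbs : ℤ) :=
    PT.cond hf.intIsNeg hf.natAbs.natCast hf.natAbs.negCast
  exact h.of_eq fun a => by by_cases h : f a < 0 <;> simp [h] <;> omega

@[fun_prop]
theorem PT.intAdd {f g : α → ℤ} (hf : PT f) (hg : PT g) : PT fun a => f a + g a := by
  have h : PT fun a => (((f a).toNat + (g a).toNat : ℕ) : ℤ) -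
      (((-f a).toNat + (-g a).toNat : ℕ) : ℤ) :=
    PT.subCast (by fun_prop) (by fun_prop)
  exact h.of_eq fun a => by omega

@[fun_prop]
theorem PT.intSub {f g : α → ℤ} (hf : PT f) (hg : PT g) : PT fun a => f a - g a :=
  (hf.intAdd hg.neg).of_eq fun a => by ring

@[fun_prop]
theorem PT.intMul {f g : α → ℤ} (hf : PT f) (hg : PT g) : PT fun a => f a * g a := by
  have h : PT fun a => bif Bool.xor (decide (f a < 0)) (decide (g a < 0)) then
      -(((f a).natAbs * (g a).natAbs : ℕ) : ℤ) else (((f a).natAbs * (g a).natAbs : ℕ) : ℤ) :=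
    PT.cond (by fun_prop) (PT.negCast (by fun_prop)) (PT.natCast (by fun_prop))
  refine h.of_eq fun a => ?_
  rcases Int.natAbs_eq (f a) with h1 | h1 <;> rcases Int.natAbs_eq (g a) with h2 | h2 <;>
    by_cases h3 : f a < 0 <;> by_cases h4 : g a < 0 <;>
    simp only [h3, h4, decide_true, decide_false, Bool.xor_self, Bool.xor_false, Bool.xor_true,
      Bool.not_false, cond_true, cond_false] <;>
    push_cast <;> first
    | (rw [abs_of_neg h3, abs_of_neg h4]; ring)
    | (rw [abs_of_neg h3, abs_of_nonneg (not_lt.mp h4)]; ring)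
    | (rw [abs_of_nonneg (not_lt.mp h3), abs_of_neg h4]; ring)
    | (rw [abs_of_nonneg (not_lt.mp h3), abs_of_nonneg (not_lt.mp h4)])

@[fun_prop]
theorem PT.intPos {f : α → ℤ} (hf : PT f) : PT fun a => decide (0 < f a) :=
  hf.neg.intIsNeg.of_eq fun a => by simp

theorem esize_int (z : ℤ) : esize z ≤ esize z.natAbs + 4 := by
  change esize (decide (z < 0), z.natAbs) ≤ _
  have := esize_bool (decide (z < 0))
  rw [esize_mk]; omega

theorem esize_int_le {z : ℤ} {m : ℕ} (h : z.natAbs < 2 ^ m) : esize z ≤ 4 * m + 5 :=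
  (esize_int z).trans (by have := esize_nat_le h; omega)

theorem natAbs_lt_two_pow_esize (z : ℤ) : z.natAbs < 2 ^ esize z := by
  refine (lt_two_pow_esize z.natAbs).trans_le (Nat.pow_le_pow_right (by norm_num) ?_)
  change _ ≤ esize (decide (z < 0), z.natAbs)
  rw [esize_mk]; omega

/-! ### Further operations on lists -/

/-- A fold whose step increases the size by a bounded amount. -/
theorem PT.foldl_additive {f : α → List β} {g : α → σ} {h : α → σ → β → σ} (hf : PT f) (hg : PT g)
    (hh : PT fun p : α × σ × β => h p.1 p.2.1 p.2.2) (u : α → ℕ) (hu : PB u esize)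
    (hB : ∀ a s, ∀ b ∈ f a, esize (h a s b) ≤ esize s + u a) :
    PT fun a => (f a).foldl (h a) (g a) := by
  refine PT.foldl hf hg hh (fun a => esize (g a) + esize (f a) * u a) (hg.pb_esize.add
    (hf.pb_esize.mul hu)) fun a l₁ l₂ hl => ?_
  have key : ∀ (l : List β) (s : σ), (∀ b ∈ l, b ∈ f a) →
      esize (l.foldl (h a) s) ≤ esize s + l.length * u a := by
    intro l
    induction l with
    | nil => simp
    | cons b l ih =>
      intro s hs
      have h1 := ih (h a s b) fun c hc => hs c (by simp [hc])
      have h2 := hB a s b (hs b (by simp))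
      rw [List.foldl_cons, List.length_cons, add_mul]
      omega
  refine (key l₁ (g a) fun b hb => by simp [hl, hb]).trans ?_
  have := length_lt_esize (f a)
  have h1 : l₁.length ≤ esize (f a) := by rw [hl] at this ⊢; simp at this; omega
  gcongr

-- The number `n a` is in binary and may be exponentially large, so the loop runs over the list
-- itself while a counter is decremented.
@[fun_prop]
theorem PT.listDrop {f : α → List β} {n : α → ℕ} (hf : PT f) (hn : PT n) :
    PT fun a => (f a).drop (n a) := by
  have h1 : ∀ (l : List β) (m : ℕ) (r : List β),
      l.foldl (fun s _ => bif decide (s.1 = 0) then s else (s.1 - 1, s.2.tail)) (m, r) =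
        (m - l.length, r.drop (min m l.length)) := by
    intro l
    induction l with
    | nil => simp
    | cons b l ih =>
      intro m r
      rw [List.foldl_cons]
      rcases m with _ | m
      · have := ih 0 r
        simpa using this
      · simp only [Nat.succ_ne_zero, decide_false, cond_false, Nat.add_sub_cancel]
        rw [ih]
        simp
  have h2 := PT.foldl hf (hn.pair hf)
    (h := fun _ s _ => bif decide (s.1 = 0) then s else (s.1 - 1, s.2.tail)) (by fun_prop)
    (fun a => 4 * esize (n a) + 1 + esize (f a) + 1) (by fun_prop) fun a l₁ l₂ h => by
      rw [h1, esize_mk]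
      have h3 : esize (n a - l₁.length) ≤ 4 * esize (n a) + 1 :=
        esize_nat_le ((Nat.sub_le _ _).trans_lt (lt_two_pow_esize (n a)))
      have h4 := esize_list_mono (List.drop_sublist (min (n a) l₁.length) (f a))
      omega
  refine h2.snd.of_eq fun a => ?_
  rw [h1]
  rcases le_total (n a) (f a).length with h | h
  · rw [Nat.min_eq_left h]
  · rw [Nat.min_eq_right h, List.drop_length, List.drop_eq_nil_of_le h]

@[fun_prop]
theorem PT.listTake {f : α → List β} {n : α → ℕ} (hf : PT f) (hn : PT n) :
    PT fun a => (f a).take (n a) := by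
  have h : PT fun a => ((f a).reverse.drop ((f a).length - n a)).reverse := by fun_prop
  refine h.of_eq fun a => ?_
  rw [List.drop_reverse, List.reverse_reverse]
  rcases le_total (n a) (f a).length with h | h
  · congr 1; omega
  · rw [Nat.sub_eq_zero_of_le h, Nat.sub_zero, List.take_length, List.take_of_length_le h]

@[fun_prop]
theorem PT.getD {f : α → List β} {n : α → ℕ} {d : α → β} (hf : PT f) (hn : PT n) (hd : PT d) :
    PT fun a => (f a).getD (n a) (d a) := by
  have h : PT fun a => ((f a).drop (n a)).headD (d a) := by fun_prop
  refine h.of_eq fun a => ?_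
  rw [List.headD_eq_head?_getD, List.head?_drop, List.getD_eq_getElem?_getD]

/-- The indices of a list. -/
@[fun_prop]
theorem PT.range {f : α → List β} (hf : PT f) : PT fun a => List.range (f a).length := by
  have h1 : ∀ l : List β, l.foldl (fun s _ => s ++ [s.length]) [] = List.range l.length := by
    intro l
    induction l using List.reverseRecOn with
    | nil => rfl
    | append_singleton l b ih => simp [ih, List.range_succ]
  have h2 := PT.foldl hf (PT.const []) (h := fun _ s _ => s ++ [s.length]) (by fun_prop)
    (fun a => esize (f a) * (4 * esize (f a) + 2) + 1) (by fun_prop) fun a l₁ l₂ h => by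
      rw [h1]
      have h3 : l₁.length ≤ esize (f a) := by
        have := length_lt_esize (f a)
        rw [h] at this ⊢; simp at this; omega
      refine (esize_list_le (M := 4 * esize (f a) + 1) fun b hb => ?_).trans ?_
      · refine esize_nat_le ((List.mem_range.mp hb).trans_le (h3.trans ?_))
        exact Nat.lt_two_pow_self.le
      · rw [List.length_range]; gcongr
  exact h2.of_eq fun a => h1 _

theorem PT.sumInt {f : α → List ℤ} (hf : PT f) : PT fun a => (f a).sum := by
  have h1 : ∀ l : List ℤ, l.foldl (fun s z => s + z) 0 = l.sum := fun l =>
    List.sum_eq_foldl.symm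
  have h2 : ∀ l : List ℤ, l.sum.natAbs < 2 ^ esize l := by
    intro l
    induction l with
    | nil => simp
    | cons z l ih =>
      have h3 := natAbs_lt_two_pow_esize z
      have h4 : 2 ^ esize z ≤ 2 ^ (esize z + esize l) := Nat.pow_le_pow_right (by norm_num) (by omega)
      have h5 : 2 ^ esize l ≤ 2 ^ (esize z + esize l) := Nat.pow_le_pow_right (by norm_num) (by omega)
      rw [List.sum_cons, esize_cons, pow_succ]
      omega
  have h3 := PT.foldl hf (PT.const 0) (h := fun _ s z => s + z) (by fun_prop)
    (fun a => 4 * esize (f a) + 5) (by fun_prop) fun a l₁ l₂ h => by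
      rw [h1]
      refine (esize_int_le (h2 l₁)).trans ?_
      have := esize_list_mono (List.sublist_append_left l₁ l₂)
      rw [h]; omega
  exact h3.of_eq fun a => h1 _

theorem PT.prodNat {f : α → List ℕ} (hf : PT f) : PT fun a => (f a).prod := by
  have h1 : ∀ l : List ℕ, l.foldl (fun s z => s * z) 1 = l.prod := fun l =>
    List.prod_eq_foldl.symm
  have h2 : ∀ l : List ℕ, l.prod < 2 ^ esize l := by
    intro l
    induction l with
    | nil => simp
    | cons z l ih =>
      have h3 := lt_two_pow_esize z
      rw [List.prod_cons, esize_cons, pow_succ, pow_add]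
      have := Nat.mul_lt_mul'' h3 ih
      omega
  have h3 := PT.foldl hf (PT.const 1) (h := fun _ s z => s * z) (by fun_prop)
    (fun a => 4 * esize (f a) + 1) (by fun_prop) fun a l₁ l₂ h => by
      rw [h1]
      refine (esize_nat_le (h2 l₁)).trans ?_
      have := esize_list_mono (List.sublist_append_left l₁ l₂)
      rw [h]; omega
  exact h3.of_eq fun a => h1 _

@[fun_prop]
theorem PT.isSome {f : α → Option β} (hf : PT f) : PT fun a => (f a).isSome :=
  hf.optionToList.isEmpty.not.of_eq fun a => by cases f a <;> rfl

@[fun_prop]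
theorem PT.optionGetD {f : α → Option β} {d : α → β} (hf : PT f) (hd : PT d) :
    PT fun a => (f a).getD (d a) :=
  (hf.optionToList.headD hd).of_eq fun a => by cases f a <;> rfl

/-- The blocks of a string that are ended by separators. -/
def tokens (x : List Symbol) : List (List Bool) :=
  (x.foldl (fun (s : List Bool × List (List Bool)) b =>
    bif b.isSome then (b.getD false :: s.1, s.2) else ([], s.1.reverse :: s.2)) ([], [])).2.reverse

@[fun_prop]
theorem PT.tokensFn {f : α → List Symbol} (hf : PT f) : PT fun a => tokens (f a) := by
  have h : PT fun a => (f a).foldl (fun (s : List Bool × List (List Bool)) b =>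
      bif b.isSome then (b.getD false :: s.1, s.2) else ([], s.1.reverse :: s.2)) ([], []) := by
    refine PT.foldl_additive (h := fun _ (s : List Bool × List (List Bool)) (b : Symbol) =>
      bif b.isSome then (b.getD false :: s.1, s.2) else ([], s.1.reverse :: s.2))
      hf (by fun_prop) (by fun_prop) (fun _ => 4) (by fun_prop)
      fun a s b _ => ?_
    obtain ⟨s, s'⟩ := s
    rcases b with _ | b
    · simp [esize_reverse]; omega
    · have := esize_bool b
      simp; omega
  exact h.snd.reverse

theorem tokens_block (l : List Bool) (x : List Symbol) :
    tokens (l.map some ++ none :: x) = l :: tokens x := by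
  have h1 : ∀ (l c : List Bool) (d : List (List Bool)),
      (l.map some).foldl (fun (s : List Bool × List (List Bool)) (b : Symbol) =>
        bif b.isSome then (b.getD false :: s.1, s.2) else ([], s.1.reverse :: s.2)) (c, d) =
      (l.reverse ++ c, d) := by
    intro l
    induction l with
    | nil => simp
    | cons b l ih => intro c d; simp [ih]
  have h2 : ∀ (x : List Symbol) (c : List Bool) (d : List (List Bool)),
      (x.foldl (fun (s : List Bool × List (List Bool)) (b : Symbol) =>
        bif b.isSome then (b.getD false :: s.1, s.2) else ([], s.1.reverse :: s.2)) (c, d)).2 =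
      (x.foldl (fun (s : List Bool × List (List Bool)) (b : Symbol) =>
        bif b.isSome then (b.getD false :: s.1, s.2) else ([], s.1.reverse :: s.2)) (c, [])).2 ++ d := by
    intro x
    induction x with
    | nil => simp
    | cons b x ih =>
      intro c d
      rcases b with _ | b
      · simp only [List.foldl_cons, Option.isSome_none, cond_false]
        rw [ih [] (c.reverse :: d), ih [] [c.reverse]]
        simp
      · simpa using ih (b :: c) d
  rw [tokens, List.foldl_append, h1, List.foldl_cons]
  simp only [Option.isSome_none, cond_false, List.append_nil, List.reverse_reverse]
  rw [h2, List.reverse_append, tokens]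
  rfl

end

/-! ### Machines of polynomial-time functions on strings -/

/-- Replace a string by its encoding. -/
def inputProg : Prog Reg := .seq (pour .s .t) (.seq (.push .s (some false))
  -- The pushed `some false` is the code of the empty list. The symbols come off `t` with the last
  -- one first, so putting each in front restores the order.
  (.loop .t Option.isSome (.case .t fun o =>
    pushAll (some true :: (enc (o.getD none : Symbol)).str))))

theorem esize_symbol (a : Symbol) : esize a ≤ 5 := by
  rcases a with _ | _ | _ <;> simp [esize, enc]

theorem esize_string (x : List Symbol) : esize x ≤ 6 * x.length + 1 :=
  (esize_list_le fun b _ => esize_symbol b).trans (by omega)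

theorem inputProg_within (x : List Symbol) : Within inputProg (st x [] [] [] [] [])
    (20 * x.length + 10) (st (enc x).str [] [] [] [] []) := by
  have h : ∀ l x : List Symbol, Within (.loop .t Option.isSome (.case .t fun o =>
      pushAll (some true :: (enc (o.getD none : Symbol)).str))) (st (enc x).str [] [] [] l [])
      (10 * l.length + 1) (st (enc (l.reverse ++ x)).str [] [] [] [] []) := by
    intro l
    induction l with
    | nil => intro x; exact Within.loop_done (by simp)
    | cons a l ih =>
      intro x
      have h1 : Within (.case .t fun o => pushAll (some true :: (enc (o.getD none : Symbol)).str))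
          (st (enc x).str [] [] [] (a :: l) []) 9 (st (enc (a :: x)).str [] [] [] l []) := by
        refine (Within.case (some a) rfl (update_st_t _ _ _ _ _ _ _) (n := 8) ?_).mono (by omega)
        have h2 : ∀ (l r t : List Symbol), Within (pushAll l) (st r [] [] [] t []) (l.length + 1)
            (st (l ++ r) [] [] [] t []) := by
          intro l r t
          induction l with
          | nil => exact Within.skip
          | cons x l ih => exact (ih.seq (Within.push (by simp))).mono (by simp)
        have h3 := esize_symbol a
        refine ((h2 (some true :: (enc a).str) (enc x).str l).mono (m := 8) ?_)
        simp [esize] at h3 ⊢; omega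
      have h2 := ih (a :: x)
      simp only [List.reverse_cons, List.append_assoc, List.singleton_append]
      exact (Within.loop_step (by simp) h1 h2).mono (by simp; omega)
  have h2 := h x.reverse []
  simp only [List.reverse_reverse, List.append_nil] at h2
  refine ((pour_within (by decide) x (by simp) (by simp; rfl)).seq ((Within.push
    (by simp; rfl)).seq h2)).mono (by simp; omega)

/-- Replace the encoding of a string by the string. -/
def outputProg : Prog Reg := .seq
  (.loop .s (· = some (some true)) (.case .s fun _ => .case .s (branch
    (.case .s (branch
      (.case .s fun _ => .case .s fun _ => .case .s fun _ => .push .t (some true))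
      (.case .s fun _ => .push .t (some false))))
    (.push .t none))))
  (.seq (.case .s fun _ => .skip) (pour .t .s))

theorem outputProg_within (x : List Symbol) : Within outputProg (st (enc x).str [] [] [] [] [])
    (20 * x.length + 10) (st x [] [] [] [] []) := by
  have h : ∀ l t : List Symbol, Within (.loop .s (· = some (some true)) (.case .s fun _ =>
      .case .s (branch (.case .s (branch
        (.case .s fun _ => .case .s fun _ => .case .s fun _ => .push .t (some true))
        (.case .s fun _ => .push .t (some false))))
      (.push .t none)))) (st (enc l).str [] [] [] t [])
      (10 * l.length + 1) (st [some false] [] [] [] (l.reverse ++ t) []) := by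
    intro l
    induction l with
    | nil => intro t; exact Within.loop_done (by simp [enc, Data.ofList, Data.str])
    | cons a l ih =>
      intro t
      have h2 := ih (a :: t)
      simp only [List.reverse_cons, List.append_assoc, List.singleton_append]
      refine (Within.loop_step (n := 7) (by simp [enc, Data.ofList, Data.str]) ?_ h2).mono
        (by simp; omega)
      have hs : (enc (a :: l)).str = some true :: ((enc a).str ++ (enc l).str) := rfl
      rw [hs]
      generalize (enc l).str = e
      rcases a with _ | _ | _
      · exact (Within.case (some (some true)) rfl (by simp; rfl)
          (Within.case (some (some false)) rfl (by simp [enc, Data.str]; rfl)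
            (Within.push (by simp)))).mono (by omega)
      · exact (Within.case (some (some true)) rfl (by simp; rfl)
          (Within.case (some (some true)) rfl (by simp [enc, Data.str]; rfl)
          (Within.case (some (some false)) rfl (by simp; rfl)
          (Within.case (some (some false)) rfl (by simp; rfl)
            (Within.push (by simp)))))).mono (by omega)
      · exact (Within.case (some (some true)) rfl (by simp; rfl)
          (Within.case (some (some true)) rfl (by simp [enc, Data.str]; rfl)
          (Within.case (some (some true)) rfl (by simp; rfl)
          (Within.case (some (some false)) rfl (by simp; rfl)
          (Within.case (some (some false)) rfl (by simp; rfl)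
          (Within.case (some (some false)) rfl (by simp; rfl)
            (Within.push (by simp)))))))).mono (by omega)
  exact ((h x []).seq ((Within.case (some (some false)) rfl (by simp; rfl) Within.skip).seq
    (pour_within (by decide) x.reverse (by simp) (by simp)))).mono (by simp; omega)

theorem PTm.exists_machine {μ : List Symbol → ℕ} {f : List Symbol → List Symbol}
    (hf : PTm μ f) (hμ : PB esize μ) : ∃ (M : TM2ComputableAux Symbol Symbol) (q : Polynomial ℕ),
    ∀ x, OutputsWithin M x (f x) (q.eval (μ x)) := by
  have hs := hf.pb_esize hμ
  obtain ⟨p, T, hT, h⟩ := hf.runs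
  obtain ⟨q, hq⟩ := (((PB.const_mul hμ 20).add (.const 10)).add (hT.add
    ((PB.const_mul hs 20).add (.const 10)))).add (.const 1)
  refine ⟨(Prog.seq inputProg (.seq p outputProg)).machine .s, q, fun x => ?_⟩
  have h2 := h x []
  simp only [List.append_nil] at h2
  obtain ⟨n, hn, h3⟩ := (inputProg_within x).seq (h2.seq (outputProg_within (f x)))
  have h4 : ∀ y, Function.update (fun _ => []) Reg.s y = st y [] [] [] [] [] := by
    intro y; funext k; cases k <;> rfl
  refine Exec.outputsWithin (n := n) (by rw [h4, h4]; exact h3) ((Nat.succ_le_succ hn).trans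
    (le_trans ?_ (hq x)))
  have := length_lt_esize x
  have := length_lt_esize (f x)
  simp only [Nat.succ_eq_add_one]
  omega

end ParamQC
end

noncomputable section

namespace ParamQC

open Turing Computability

/-! ### Composition of Turing machines -/

theorem Steps.succ_iff {K Λ σ : Type} [DecidableEq K] {Γ : K → Type} {m : Λ → TM2.Stmt Γ Λ σ}
    {n : ℕ} {c c' : TM2.Cfg Γ Λ σ} :
    Steps m (n + 1) c c' ↔ ∃ c₁, TM2.step m c = some c₁ ∧ Steps m n c₁ c' := by
  rw [Steps, Function.iterate_succ_apply]
  change (flip bind (TM2.step m))^[n] (TM2.step m c) = some c' ↔ _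
  cases h : TM2.step m c with
  | none =>
    have : ∀ n, (flip bind (TM2.step m))^[n] none = none := by
      intro n
      induction n with
      | zero => rfl
      | succ n ih => rw [Function.iterate_succ_apply]; exact ih
    rw [this]; simp
  | some c₁ => simp [Steps]

/-- An upper bound on the number of symbols that a statement pushes. -/
def pushes {K Λ σ : Type} {Γ : K → Type} : TM2.Stmt Γ Λ σ → ℕ
  | .push _ _ q => pushes q + 1
  | .peek _ _ q => pushes q
  | .pop _ _ q => pushes q
  | .load _ q => pushes q
  | .branch _ q r => pushes q + pushes r
  | .goto _ => 0
  | .halt => 0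

theorem stepAux_length_le {K Λ σ : Type} [DecidableEq K] {Γ : K → Type} (q : TM2.Stmt Γ Λ σ)
    (v : σ) (S : ∀ k, List (Γ k)) (k : K) :
    ((TM2.stepAux q v S).stk k).length ≤ (S k).length + pushes q := by
  induction q generalizing v S with
  | push k' f q ih =>
    refine (ih _ _).trans ?_
    rcases eq_or_ne k k' with rfl | h
    · simp [pushes]; omega
    · simp [pushes, h]
  | peek k' f q ih => exact ih _ _
  | pop k' f q ih =>
    refine (ih _ _).trans ?_
    rcases eq_or_ne k k' with rfl | h
    · simp [pushes]
    · simp [pushes, h]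
  | load f q ih => exact ih _ _
  | branch p q r ih ih' =>
    rw [TM2.stepAux, pushes]
    cases p v
    · have := ih' v S; simp; omega
    · have := ih v S; simp; omega
  | goto l => simp [TM2.stepAux]
  | halt => simp [TM2.stepAux]

/-- A machine has finitely many statements, each of which pushes boundedly many symbols. This is
needed for arbitrary machines, which occur in the complexity classes and are not compiled programs.
-/
theorem OutputsWithin.length_le {Γ Δ : Type} (M : TM2ComputableAux Γ Δ) : ∃ c : ℕ, ∀ x y T,
    OutputsWithin M x y T → y.length ≤ x.length + c * T := by
  let := M.tm.ΛFin
  refine ⟨∑ l, pushes (M.tm.m l), fun x y T h => ?_⟩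
  obtain ⟨n, hn, h⟩ := (outputsWithin_iff M x y T).mp h
  have key : ∀ (n : ℕ) (c c' : TM2.Cfg M.tm.Γ M.tm.Λ M.tm.σ), Steps M.tm.m n c c' → ∀ k,
      (c'.stk k).length ≤ (c.stk k).length + (∑ l, pushes (M.tm.m l)) * n := by
    intro n
    induction n with
    | zero =>
      intro c c' h k
      obtain rfl : c = c' := by simpa [Steps] using h
      simp
    | succ n ih =>
      intro c c' h k
      obtain ⟨c₁, h1, h2⟩ := Steps.succ_iff.mp h
      have h3 := ih _ _ h2 k
      obtain ⟨_ | l, v, S⟩ := c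
      · simp [TM2.step] at h1
      · simp only [TM2.step, Option.some.injEq] at h1
        subst h1
        have h4 := stepAux_length_le (M.tm.m l) v S k
        have h5 : pushes (M.tm.m l) ≤ ∑ l, pushes (M.tm.m l) :=
          Finset.single_le_sum (f := fun l => pushes (M.tm.m l)) (fun _ _ => Nat.zero_le _)
            (Finset.mem_univ l)
        rw [mul_add, mul_one]
        dsimp only at h3 ⊢
        omega
  have h1 := key n _ _ h M.tm.k₁
  simp only [Function.update_self, List.length_map] at h1
  refine h1.trans (Nat.add_le_add ?_ (Nat.mul_le_mul_left _ hn))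
  rcases eq_or_ne M.tm.k₁ M.tm.k₀ with h | h
  -- Stated for a variable `k`, since the type of the stack contents depends on the stack and the
  -- equality can only be substituted for a variable.
  · have : ∀ k, k = M.tm.k₀ → (Function.update (fun _ => [] : ∀ k, List (M.tm.Γ k)) M.tm.k₀
        (x.map M.inputAlphabet.invFun) k).length = x.length := by
      rintro _ rfl; simp
    exact (this _ h).le
  · simp [h]

section

variable {Γ Δ Γ' Θ : Type} (M : TM2ComputableAux Γ Δ)
  (M' : TM2ComputableAux Γ' Θ)

/-- The stack alphabets of a composition; there is one additional stack. -/
def CompΓ : M.tm.K ⊕ M'.tm.K ⊕ Unit → Type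
  | .inl k => M.tm.Γ k
  | .inr (.inl k) => M'.tm.Γ k
  | .inr (.inr _) => Γ'

abbrev CompΛ : Type := M.tm.Λ ⊕ M'.tm.Λ ⊕ Bool

abbrev Compσ : Type := (M.tm.σ × M'.tm.σ) × Option Γ'

def compStmtLeft : TM2.Stmt M.tm.Γ M.tm.Λ M.tm.σ →
    TM2.Stmt (CompΓ M M') (CompΛ M M') (Compσ M M')
  | .push k f q => .push (.inl k) (fun v => f v.1.1) (compStmtLeft q)
  | .peek k f q => .peek (.inl k) (fun v o => ((f v.1.1 o, v.1.2), v.2)) (compStmtLeft q)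
  | .pop k f q => .pop (.inl k) (fun v o => ((f v.1.1 o, v.1.2), v.2)) (compStmtLeft q)
  | .load f q => .load (fun v => ((f v.1.1, v.1.2), v.2)) (compStmtLeft q)
  | .branch p q r => .branch (fun v => p v.1.1) (compStmtLeft q) (compStmtLeft r)
  | .goto l => .goto fun v => .inl (l v.1.1)
  | .halt => .goto fun _ => .inr (.inr false)

def compStmtRight : TM2.Stmt M'.tm.Γ M'.tm.Λ M'.tm.σ →
    TM2.Stmt (CompΓ M M') (CompΛ M M') (Compσ M M')
  | .push k f q => .push (.inr (.inl k)) (fun v => f v.1.2) (compStmtRight q)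
  | .peek k f q => .peek (.inr (.inl k)) (fun v o => ((v.1.1, f v.1.2 o), v.2)) (compStmtRight q)
  | .pop k f q => .pop (.inr (.inl k)) (fun v o => ((v.1.1, f v.1.2 o), v.2)) (compStmtRight q)
  | .load f q => .load (fun v => ((v.1.1, f v.1.2), v.2)) (compStmtRight q)
  | .branch p q r => .branch (fun v => p v.1.2) (compStmtRight q) (compStmtRight r)
  | .goto l => .goto fun v => .inr (.inl (l v.1.2))
  | .halt => .halt

/-- When `M` halts, control passes to the label `false`, which moves its output to the additional
stack; the label `true` moves it on to the input stack of `M'`. The two reversals cancel. Finally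
the internal states are reset, so that `M'` starts properly. -/
def compStmt [Inhabited Γ'] (g : Δ → Γ') : CompΛ M M' → TM2.Stmt (CompΓ M M') (CompΛ M M') (Compσ M M')
  | .inl l => compStmtLeft M M' (M.tm.m l)
  | .inr (.inl l) => compStmtRight M M' (M'.tm.m l)
  | .inr (.inr false) => .pop (.inl M.tm.k₁)
      (fun v (o : Option (M.tm.Γ M.tm.k₁)) => (v.1, o.map fun a => g (M.outputAlphabet a)))
      (.branch (fun v => v.2.isSome) (.push (.inr (.inr ())) (fun v => (v.2.getD default : Γ'))
        (.goto fun _ => .inr (.inr false))) (.goto fun _ => .inr (.inr true)))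
  | .inr (.inr true) => .pop (.inr (.inr ())) (fun v (o : Option Γ') => (v.1, o))
      (.branch (fun v => v.2.isSome) (.push (.inr (.inl M'.tm.k₀))
        (fun v => M'.inputAlphabet.symm (v.2.getD default)) (.goto fun _ => .inr (.inr true)))
        (.load (fun _ => ((M.tm.initialState, M'.tm.initialState), none))
          (.goto fun _ => .inr (.inl M'.tm.main))))

/-- The machine that runs `M`, transforms the symbols of the output by `g`, and runs `M'` on the
result. -/
def compMachine [Fintype Γ'] [Inhabited Γ'] (g : Δ → Γ') : TM2ComputableAux Γ Θ :=
  letI := M.tm.kFin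
  letI := M'.tm.kFin
  letI := M.tm.ΛFin
  letI := M'.tm.ΛFin
  letI := M.tm.σFin
  letI := M'.tm.σFin
  letI := M.tm.Γk₀Fin
  { tm :=
      { K := M.tm.K ⊕ M'.tm.K ⊕ Unit
        k₀ := .inl M.tm.k₀
        k₁ := .inr (.inl M'.tm.k₁)
        Γ := CompΓ M M'
        Λ := CompΛ M M'
        main := .inl M.tm.main
        σ := Compσ M M'
        initialState := ((M.tm.initialState, M'.tm.initialState), none)
        Γk₀Fin := inferInstanceAs (Fintype (M.tm.Γ M.tm.k₀))
        m := compStmt M M' g }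
    inputAlphabet := M.inputAlphabet
    outputAlphabet := M'.outputAlphabet }

def joinStk (S : ∀ k, List (M.tm.Γ k)) (S' : ∀ k, List (M'.tm.Γ k)) (t : List Γ') :
    ∀ k, List (CompΓ M M' k)
  | .inl k => S k
  | .inr (.inl k) => S' k
  | .inr (.inr _) => t

theorem update_joinStk_left (S : ∀ k, List (M.tm.Γ k)) (S' : ∀ k, List (M'.tm.Γ k)) (t : List Γ')
    (k : M.tm.K) (x : List (M.tm.Γ k)) : Function.update (joinStk M M' S S' t) (.inl k) x =
      joinStk M M' (Function.update S k x) S' t := by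
  funext k'
  rcases k' with k' | k' | k'
  · rcases eq_or_ne k' k with rfl | h
    · exact (Function.update_self _ _ _).trans
        (show Function.update S k' x k' = x from Function.update_self _ _ _).symm
    · exact (Function.update_of_ne (by simpa using h) _ _).trans (Function.update_of_ne h _ _).symm
  · exact Function.update_of_ne (by simp) _ _
  · exact Function.update_of_ne (by simp) _ _

theorem update_joinStk_right (S : ∀ k, List (M.tm.Γ k)) (S' : ∀ k, List (M'.tm.Γ k)) (t : List Γ')
    (k : M'.tm.K) (x : List (M'.tm.Γ k)) : Function.update (joinStk M M' S S' t) (.inr (.inl k)) x =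
      joinStk M M' S (Function.update S' k x) t := by
  funext k'
  rcases k' with k' | k' | k'
  · exact Function.update_of_ne (by simp) _ _
  · rcases eq_or_ne k' k with rfl | h
    · exact (Function.update_self _ _ _).trans
        (show Function.update S' k' x k' = x from Function.update_self _ _ _).symm
    · exact (Function.update_of_ne (by simpa using h) _ _).trans (Function.update_of_ne h _ _).symm
  · exact Function.update_of_ne (by simp) _ _

theorem update_joinStk_extra (S : ∀ k, List (M.tm.Γ k)) (S' : ∀ k, List (M'.tm.Γ k))
    (t x : List Γ') : Function.update (joinStk M M' S S' t) (.inr (.inr ())) x =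
      joinStk M M' S S' x := by
  funext k'
  rcases k' with k' | k' | k'
  · exact Function.update_of_ne (by simp) _ _
  · exact Function.update_of_ne (by simp) _ _
  · exact Function.update_self _ _ _

/-- A halted configuration of `M` is identified with the beginning of the copying phase. -/
def leftCfg (v' : M'.tm.σ) (o : Option Γ') (S' : ∀ k, List (M'.tm.Γ k)) (t : List Γ')
    (c : TM2.Cfg M.tm.Γ M.tm.Λ M.tm.σ) : TM2.Cfg (CompΓ M M') (CompΛ M M') (Compσ M M') :=
  ⟨some (c.l.elim (.inr (.inr false)) .inl), ((c.var, v'), o), joinStk M M' c.stk S' t⟩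

def rightCfg (v : M.tm.σ) (o : Option Γ') (S : ∀ k, List (M.tm.Γ k)) (t : List Γ')
    (c : TM2.Cfg M'.tm.Γ M'.tm.Λ M'.tm.σ) : TM2.Cfg (CompΓ M M') (CompΛ M M') (Compσ M M') :=
  ⟨c.l.map fun l => .inr (.inl l), ((v, c.var), o), joinStk M M' S c.stk t⟩

theorem stepAux_compStmtLeft (v' : M'.tm.σ) (o : Option Γ') (S' : ∀ k, List (M'.tm.Γ k))
    (t : List Γ') (q : TM2.Stmt M.tm.Γ M.tm.Λ M.tm.σ) : ∀ (v : M.tm.σ) (S : ∀ k, List (M.tm.Γ k)),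
    TM2.stepAux (compStmtLeft M M' q) ((v, v'), o) (joinStk M M' S S' t) =
      leftCfg M M' v' o S' t (TM2.stepAux q v S) := by
  induction q with
  | push k f q ih =>
    intro v S
    exact (congrArg (TM2.stepAux (compStmtLeft M M' q) ((v, v'), o))
      (update_joinStk_left M M' S S' t k _)).trans (ih _ _)
  | peek k f q ih => intro v S; exact ih _ _
  | pop k f q ih =>
    intro v S
    exact (congrArg (TM2.stepAux (compStmtLeft M M' q) _)
      (update_joinStk_left M M' S S' t k _)).trans (ih _ _)
  | load f q ih => intro v S; exact ih _ _
  | branch p q r ih ih' =>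
    intro v S
    simp only [compStmtLeft, TM2.stepAux]
    cases p v
    · exact ih' _ _
    · exact ih _ _
  | goto l => intro v S; rfl
  | halt => intro v S; rfl

theorem stepAux_compStmtRight (v : M.tm.σ) (o : Option Γ') (S : ∀ k, List (M.tm.Γ k))
    (t : List Γ') (q : TM2.Stmt M'.tm.Γ M'.tm.Λ M'.tm.σ) :
    ∀ (v' : M'.tm.σ) (S' : ∀ k, List (M'.tm.Γ k)),
    TM2.stepAux (compStmtRight M M' q) ((v, v'), o) (joinStk M M' S S' t) =
      rightCfg M M' v o S t (TM2.stepAux q v' S') := by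
  induction q with
  | push k f q ih =>
    intro v' S'
    exact (congrArg (TM2.stepAux (compStmtRight M M' q) ((v, v'), o))
      (update_joinStk_right M M' S S' t k _)).trans (ih _ _)
  | peek k f q ih => intro v' S'; exact ih _ _
  | pop k f q ih =>
    intro v' S'
    exact (congrArg (TM2.stepAux (compStmtRight M M' q) _)
      (update_joinStk_right M M' S S' t k _)).trans (ih _ _)
  | load f q ih => intro v' S'; exact ih _ _
  | branch p q r ih ih' =>
    intro v' S'
    simp only [compStmtRight, TM2.stepAux]
    cases p v'
    · exact ih' _ _
    · exact ih _ _
  | goto l => intro v' S'; rfl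
  | halt => intro v' S'; rfl

theorem update_empty_left (k : M.tm.K) (x : List (M.tm.Γ k)) :
    Function.update (fun _ => [] : ∀ k, List (CompΓ M M' k)) (.inl k) x =
      joinStk M M' (Function.update (fun _ => []) k x) (fun _ => []) [] := by
  rw [← update_joinStk_left]
  congr 1
  funext k'
  rcases k' with k' | k' | k' <;> rfl

theorem update_empty_right (k : M'.tm.K) (x : List (M'.tm.Γ k)) :
    Function.update (fun _ => [] : ∀ k, List (CompΓ M M' k)) (.inr (.inl k)) x =
      joinStk M M' (fun _ => []) (Function.update (fun _ => []) k x) [] := by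
  rw [← update_joinStk_right]
  congr 1
  funext k'
  rcases k' with k' | k' | k' <;> rfl

variable [Fintype Γ'] [Inhabited Γ']

theorem steps_left (g : Δ → Γ') (v' : M'.tm.σ) (o : Option Γ') (S' : ∀ k, List (M'.tm.Γ k))
    (t : List Γ') (n : ℕ) : ∀ c c', Steps M.tm.m n c c' →
    Steps (compMachine M M' g).tm.m n (leftCfg M M' v' o S' t c) (leftCfg M M' v' o S' t c') := by
  induction n with
  | zero =>
    intro c c' h
    obtain rfl : c = c' := by simpa [Steps] using h
    exact Steps.refl _
  | succ n ih =>
    intro c c' h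
    obtain ⟨c₁, h1, h2⟩ := Steps.succ_iff.mp h
    refine Steps.succ_iff.mpr ⟨_, ?_, ih _ _ h2⟩
    obtain ⟨_ | l, v, S⟩ := c
    · simp [TM2.step] at h1
    · simp only [TM2.step, Option.some.injEq] at h1
      subst h1
      exact congrArg some (stepAux_compStmtLeft M M' v' o S' t _ _ _)

theorem steps_right (g : Δ → Γ') (v : M.tm.σ) (o : Option Γ') (S : ∀ k, List (M.tm.Γ k))
    (t : List Γ') (n : ℕ) : ∀ c c', Steps M'.tm.m n c c' →
    Steps (compMachine M M' g).tm.m n (rightCfg M M' v o S t c) (rightCfg M M' v o S t c') := by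
  induction n with
  | zero =>
    intro c c' h
    obtain rfl : c = c' := by simpa [Steps] using h
    exact Steps.refl _
  | succ n ih =>
    intro c c' h
    obtain ⟨c₁, h1, h2⟩ := Steps.succ_iff.mp h
    refine Steps.succ_iff.mpr ⟨_, ?_, ih _ _ h2⟩
    obtain ⟨_ | l, v', S'⟩ := c
    · simp [TM2.step] at h1
    · simp only [TM2.step, Option.some.injEq] at h1
      subst h1
      exact congrArg some (stepAux_compStmtRight M M' v o S t _ _ _)

theorem step_copy_out (g : Δ → Γ') (w : Compσ M M') (S : ∀ k, List (M.tm.Γ k))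
    (S' : ∀ k, List (M'.tm.Γ k)) (t : List Γ') (b : M.tm.Γ M.tm.k₁) (l : List (M.tm.Γ M.tm.k₁))
    (hS : S M.tm.k₁ = b :: l) : TM2.step (compMachine M M' g).tm.m
      ⟨some (.inr (.inr false)), w, joinStk M M' S S' t⟩ =
      some ⟨some (.inr (.inr false)), (w.1, some (g (M.outputAlphabet b))),
        joinStk M M' (Function.update S M.tm.k₁ l) S' (g (M.outputAlphabet b) :: t)⟩ := by
  have h : TM2.step (compMachine M M' g).tm.m
      ⟨some (.inr (.inr false)), w, joinStk M M' S S' t⟩ = some (TM2.stepAux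
      (.branch (fun v : Compσ M M' => v.2.isSome) (.push (.inr (.inr ()))
        (fun v => (v.2.getD default : Γ'))
        (.goto fun _ => .inr (.inr false))) (.goto fun _ => .inr (.inr true)))
      (w.1, (S M.tm.k₁).head?.map fun a => g (M.outputAlphabet a))
      (Function.update (joinStk M M' S S' t) (.inl M.tm.k₁) (S M.tm.k₁).tail)) := rfl
  rw [h, update_joinStk_left, hS]
  exact congrArg (fun S => some (TM2.Cfg.mk (some (Sum.inr (Sum.inr false)))
    (w.1, some (g (M.outputAlphabet b))) S)) (update_joinStk_extra M M' _ _ t _)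

theorem step_copy_in (g : Δ → Γ') (w : Compσ M M') (S : ∀ k, List (M.tm.Γ k))
    (S' : ∀ k, List (M'.tm.Γ k)) (t : List Γ') (a : Γ') : TM2.step (compMachine M M' g).tm.m
      ⟨some (.inr (.inr true)), w, joinStk M M' S S' (a :: t)⟩ =
      some ⟨some (.inr (.inr true)), (w.1, some a), joinStk M M' S (Function.update S' M'.tm.k₀
        (M'.inputAlphabet.symm a :: S' M'.tm.k₀)) t⟩ := by
  have h : TM2.step (compMachine M M' g).tm.m
      ⟨some (.inr (.inr true)), w, joinStk M M' S S' (a :: t)⟩ = some (TM2.stepAux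
      (.branch (fun v : Compσ M M' => v.2.isSome)
        (.push (.inr (.inl M'.tm.k₀))
        (fun v => M'.inputAlphabet.symm (v.2.getD default)) (.goto fun _ => .inr (.inr true)))
        (.load (fun _ => ((M.tm.initialState, M'.tm.initialState), none))
        (.goto fun _ => .inr (.inl M'.tm.main)))) (w.1, some a)
        (Function.update (joinStk M M' S S' (a :: t)) (.inr (.inr ())) t)) := rfl
  rw [h, update_joinStk_extra]
  exact congrArg (fun S => some (TM2.Cfg.mk (some (Sum.inr (Sum.inr true))) (w.1, some a) S))
    (update_joinStk_right M M' _ _ t M'.tm.k₀ _)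

theorem steps_copy_out (g : Δ → Γ') (y : List Δ) : ∀ (w : Compσ M M') (t : List Γ'), ∃ w',
    Steps (compMachine M M' g).tm.m (y.length + 1)
      ⟨some (.inr (.inr false)), w, joinStk M M' (Function.update (fun _ => []) M.tm.k₁
        (y.map M.outputAlphabet.invFun)) (fun _ => []) t⟩
      ⟨some (.inr (.inr true)), w', joinStk M M' (fun _ => []) (fun _ => [])
        ((y.map g).reverse ++ t)⟩ := by
  induction y with
  | nil =>
    intro w t
    refine ⟨(w.1, none), Steps.one ?_⟩
    have h : Function.update (fun _ => [] : ∀ k, List (M.tm.Γ k)) M.tm.k₁ [] = fun _ => [] := by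
      simp
    rw [List.map_nil, h]
    exact congrArg (fun S => some (TM2.Cfg.mk (some (Sum.inr (Sum.inr true))) (w.1, none) S))
      ((update_joinStk_left M M' _ _ t M.tm.k₁ []).trans (by rw [h]; rfl))
  | cons a y ih =>
    intro w t
    obtain ⟨w', h⟩ := ih (w.1, some (g a)) (g a :: t)
    refine ⟨w', Steps.succ_iff.mpr ⟨_, ?_, by simpa using h⟩⟩
    have h1 := step_copy_out M M' g w (Function.update (fun _ => []) M.tm.k₁
      ((a :: y).map M.outputAlphabet.invFun)) (fun _ => []) t (M.outputAlphabet.invFun a)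
      (y.map M.outputAlphabet.invFun) (Function.update_self _ _ _)
    have h3 : M.outputAlphabet (M.outputAlphabet.invFun a) = a := M.outputAlphabet.apply_symm_apply a
    rw [h3, Function.update_idem] at h1
    exact h1

theorem steps_copy_in (g : Δ → Γ') (t : List Γ') : ∀ (w : Compσ M M') (y : List Γ'),
    Steps (compMachine M M' g).tm.m (t.length + 1)
      ⟨some (.inr (.inr true)), w, joinStk M M' (fun _ => []) (Function.update (fun _ => [])
        M'.tm.k₀ (y.map M'.inputAlphabet.invFun)) t⟩
      ⟨some (.inr (.inl M'.tm.main)), ((M.tm.initialState, M'.tm.initialState), none),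
        joinStk M M' (fun _ => []) (Function.update (fun _ => [])
        M'.tm.k₀ ((t.reverse ++ y).map M'.inputAlphabet.invFun)) []⟩ := by
  induction t with
  | nil =>
    intro w y
    refine Steps.one ?_
    exact congrArg (fun S => some (TM2.Cfg.mk (some (Sum.inr (Sum.inl M'.tm.main)))
      ((M.tm.initialState, M'.tm.initialState), none) S)) (update_joinStk_extra M M' _ _ [] [])
  | cons a t ih =>
    intro w y
    refine Steps.succ_iff.mpr ⟨_, ?_, by simpa using ih (w.1, some a) (a :: y)⟩
    rw [step_copy_in, Function.update_idem, Function.update_self]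
    rfl

/-- The definition of output demands that `M` halts with all stacks other than its output stack
empty, so the copying phases start and end in known configurations. Each of the two takes `y.length
+ 1` steps. -/
theorem OutputsWithin.comp (g : Δ → Γ') {x : List Γ} {y : List Δ} {z : List Θ} {T T' : ℕ}
    (h : OutputsWithin M x y T) (h' : OutputsWithin M' (y.map g) z T') :
    OutputsWithin (compMachine M M' g) x z (T + T' + 2 * y.length + 2) := by
  obtain ⟨n, hn, h⟩ := (outputsWithin_iff _ _ _ _).mp h
  obtain ⟨n', hn', h'⟩ := (outputsWithin_iff _ _ _ _).mp h'
  refine (outputsWithin_iff _ _ _ _).mpr ⟨n + (y.length + 1) + (y.length + 1) + n', by omega, ?_⟩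
  have h1 := steps_left M M' g M'.tm.initialState none (fun _ => []) [] _ _ _ h
  obtain ⟨w, h2⟩ := steps_copy_out M M' g y ((M.tm.initialState, M'.tm.initialState), none) []
  have h3 := steps_copy_in M M' g (y.map g).reverse w []
  have h4 := steps_right M M' g M.tm.initialState none (fun _ => []) [] _ _ _ h'
  simp only [List.append_nil, List.length_reverse, List.length_map, List.reverse_reverse,
    List.map_nil, Function.update_eq_self] at h2 h3
  have e1 := update_empty_left M M' M.tm.k₀ (x.map M.inputAlphabet.invFun)
  have e2 := update_empty_right M M' M'.tm.k₁ (z.map M'.outputAlphabet.invFun)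
  refine Eq.mp ?_ (((h1.trans h2).trans h3).trans h4)
  exact congrArg₂ (fun S S' => Steps (compMachine M M' g).tm.m
    (n + (y.length + 1) + (y.length + 1) + n')
    ⟨some (Sum.inl M.tm.main), ((M.tm.initialState, M'.tm.initialState), none), S⟩
    ⟨none, ((M.tm.initialState, M'.tm.initialState), none), S'⟩) e1.symm e2.symm

end

end ParamQC
end

noncomputable section

namespace ParamQC

/-! ### A division-free test of positive definiteness -/

/-- The matrices of the Faddeev–LeVerrier algorithm, scaled by factorials. -/
def leVerrier {ι R : Type} [Fintype ι] [DecidableEq ι] [CommRing R] (A : Matrix ι ι R) :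
    ℕ → Matrix ι ι R
  | 0 => 1
  | j + 1 => (A * leVerrier A j).trace • (1 : Matrix ι ι R) -
      ((j : R) + 1) • (A * leVerrier A j)

/-- The recursion uses ring operations only, so the integer computation can be compared with the
real one. -/
theorem leVerrier_map {ι R S : Type} [Fintype ι] [DecidableEq ι] [CommRing R] [CommRing S]
    (f : R →+* S) (A : Matrix ι ι R) (j : ℕ) :
    leVerrier (f.mapMatrix A) j = f.mapMatrix (leVerrier A j) := by
  induction j with
  | zero => simp [leVerrier]
  | succ j ih =>
    have ht : ∀ B : Matrix ι ι R, (f.mapMatrix B).trace = f B.trace := fun B => by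
      simp [Matrix.trace]
    have hs : ∀ (c : R) (B : Matrix ι ι R), f.mapMatrix (c • B) = f c • f.mapMatrix B :=
      fun c B => by ext; simp
    rw [leVerrier, leVerrier, ih, map_sub, hs, hs, ← map_mul, ht]
    simp

/-! ### Newton's identities and the traces of the recursion -/

section Newton

open MvPolynomial

variable {ι : Type} [Fintype ι] (d : ι → ℝ)

/-- Newton's identity evaluated at `d`, summed over the exponent of the power sum instead of the
degree of the symmetric function. The global sign and the sign of the term combine to (-1)^m because
their exponents add up to m plus an even number. -/
theorem esymm_newton (j : ℕ) : ((j : ℝ) + 1) * (Finset.univ.val.map d).esymm (j + 1) =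
    ∑ m ∈ Finset.range (j + 1), (-1) ^ m * (Finset.univ.val.map d).esymm (j - m) *
      ∑ i, d i ^ (m + 1) := by
  classical
  have h := congrArg (aeval d) (mul_esymm_eq_sum ι ℝ (j + 1))
  rw [map_mul, map_mul, map_sum, map_pow, map_neg, map_one, map_natCast,
    aeval_esymm_eq_multiset_esymm, Finset.sum_filter,
    Finset.Nat.sum_antidiagonal_eq_sum_range_succ (fun a b => if a < j + 1 then
      aeval d ((-1) ^ a * esymm ι ℝ a * psum ι ℝ b) else 0), Finset.sum_range_succ,
    ← Finset.sum_range_reflect] at h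
  push_cast at h
  rw [h, if_neg (lt_irrefl _), add_zero, Finset.mul_sum]
  refine Finset.sum_congr rfl fun m hm => ?_
  have hm' : m ≤ j := Nat.lt_succ_iff.mp (Finset.mem_range.mp hm)
  rw [if_pos (by omega), map_mul, map_mul, map_pow, map_neg, map_one,
    aeval_esymm_eq_multiset_esymm, psum, map_sum]
  simp only [map_pow, aeval_X]
  obtain ⟨r, rfl⟩ := Nat.exists_eq_add_of_le hm'
  rw [show m + r - m = r by omega,
    show m + r + 1 - r = m + 1 by omega, ← mul_assoc, ← mul_assoc, ← pow_add,
    show m + r + 1 + 1 + r = m + 2 * (r + 1) by ring, pow_add, pow_mul]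
  simp

variable [DecidableEq ι] {d}

/-- All that matters about `A` is that the traces of its powers are the power sums of `d`. Given the
expansion of the j-th matrix in powers of `A`, Newton's identity computes the trace, and this trace
is the constant term that the recursion adds to form the next matrix. The scaling by j! absorbs the
divisions of the usual algorithm. -/
theorem leVerrier_eq_sum (A : Matrix ι ι ℝ) (hA : ∀ m, (A ^ (m + 1)).trace = ∑ i, d i ^ (m + 1))
    (j : ℕ) :
    leVerrier A j = ∑ m ∈ Finset.range (j + 1),
      ((-1) ^ m * (j.factorial * (Finset.univ.val.map d).esymm (j - m))) • A ^ m ∧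
    (A * leVerrier A j).trace = (j + 1).factorial * (Finset.univ.val.map d).esymm (j + 1) := by
  have key : ∀ j, leVerrier A j = ∑ m ∈ Finset.range (j + 1),
      ((-1) ^ m * (j.factorial * (Finset.univ.val.map d).esymm (j - m))) • A ^ m →
      (A * leVerrier A j).trace = (j + 1).factorial * (Finset.univ.val.map d).esymm (j + 1) := by
    intro j hj
    rw [hj, Nat.factorial_succ, Nat.cast_mul, mul_comm ((j + 1 : ℕ) : ℝ), mul_assoc, Nat.cast_succ,
      esymm_newton, Finset.mul_sum, Finset.mul_sum, Matrix.trace_sum]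
    refine Finset.sum_congr rfl fun m _ => ?_
    rw [mul_smul_comm, Matrix.trace_smul, ← pow_succ', hA, smul_eq_mul]
    ring
  induction j with
  | zero =>
    have h0 : leVerrier A 0 = ∑ m ∈ Finset.range (0 + 1), ((-1) ^ m *
        (((Nat.factorial 0 : ℕ) : ℝ) * (Finset.univ.val.map d).esymm (0 - m))) • A ^ m := by
      simp [leVerrier, Multiset.esymm]
    exact ⟨h0, key 0 h0⟩
  | succ j ih =>
    have h1 : leVerrier A (j + 1) = ∑ m ∈ Finset.range (j + 1 + 1), ((-1) ^ m *
        ((Nat.factorial (j + 1) : ℕ) * (Finset.univ.val.map d).esymm (j + 1 - m))) • A ^ m := by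
      rw [leVerrier, ih.2, ih.1, Finset.mul_sum, Finset.smul_sum,
        sub_eq_neg_add, ← Finset.sum_neg_distrib, Finset.sum_range_succ' _ (j + 1)]
      congr 1
      · refine Finset.sum_congr rfl fun m _ => ?_
        rw [mul_smul_comm, ← pow_succ', smul_smul, ← neg_smul, Nat.factorial_succ]
        congr 1
        rw [Nat.add_sub_add_right]
        push_cast
        ring
      · simp
    exact ⟨h1, key _ h1⟩

end Newton

/-- If all numbers are positive, each function is a nonempty sum of positive products. Conversely,
the elementary symmetric functions are the coefficients of the product of the X + x. If all are
positive, this polynomial is positive on the nonnegative reals, so it has no root -x with x ≤ 0. -/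
theorem forall_pos_iff_forall_esymm_pos (s : Multiset ℝ) :
    (∀ x ∈ s, 0 < x) ↔ ∀ j < Multiset.card s, 0 < s.esymm (j + 1) := by
  constructor
  · intro h j hj
    rw [Multiset.esymm]
    have hne : (s.powersetCard (j + 1)) ≠ 0 := by
      rw [← Multiset.card_pos, Multiset.card_powersetCard]
      exact Nat.choose_pos hj
    obtain ⟨t, ht⟩ := Multiset.exists_mem_of_ne_zero hne
    obtain ⟨u, hu⟩ := Multiset.exists_cons_of_mem ht
    have hpos : ∀ t ∈ s.powersetCard (j + 1), 0 < t.prod := fun t ht =>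
      Multiset.prod_pos fun x hx =>
        h x (Multiset.mem_of_le (Multiset.mem_powersetCard.mp ht).1 hx)
    rw [hu, Multiset.map_cons, Multiset.sum_cons]
    refine add_pos_of_pos_of_nonneg (hpos t ht) (Multiset.sum_nonneg ?_)
    intro x hx
    obtain ⟨v, hv, rfl⟩ := Multiset.mem_map.mp hx
    exact (hpos v (hu ▸ Multiset.mem_cons_of_mem hv)).le
  · intro h x hx
    by_contra hx0
    have hx0 : 0 ≤ -x := by linarith
    have h1 := congrArg (Polynomial.eval (-x)) (Multiset.prod_X_add_C_eq_sum_esymm s)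
    rw [Polynomial.eval_multiset_prod, Multiset.map_map, Polynomial.eval_finsetSum,
      Multiset.prod_eq_zero (Multiset.mem_map.mpr ⟨x, hx, by simp⟩)] at h1
    have hc : 0 < Multiset.card s := Multiset.card_pos_iff_exists_mem.mpr ⟨x, hx⟩
    have h2 : 0 < s.esymm (Multiset.card s) := by
      obtain ⟨c, hc⟩ := Nat.exists_eq_succ_of_ne_zero hc.ne'
      rw [hc]; exact h c (by omega)
    refine absurd h1.symm (ne_of_gt ?_)
    rw [Finset.sum_range_succ]
    refine add_pos_of_nonneg_of_pos (Finset.sum_nonneg fun j hj => ?_) (by simpa using h2)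
    have hj : j < Multiset.card s := Finset.mem_range.mp hj
    have : 0 ≤ s.esymm j := by
      cases j with
      | zero => simp [Multiset.esymm]
      | succ j => exact (h j (by omega)).le
    simp only [Polynomial.eval_mul, Polynomial.eval_C, Polynomial.eval_pow, Polynomial.eval_X]
    positivity

/-- By the spectral theorem the trace of a power is the power sum of the eigenvalues, so the traces
in the test are factorials times elementary symmetric functions of the eigenvalues. -/
theorem posDef_iff_leVerrier {ι : Type} [Fintype ι] [DecidableEq ι] {A : Matrix ι ι ℝ}
    (hA : A.IsHermitian) :
    A.PosDef ↔ ∀ j < Fintype.card ι, 0 < (A * leVerrier A j).trace := by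
  have htr : ∀ m, (A ^ (m + 1)).trace = ∑ i, hA.eigenvalues i ^ (m + 1) := by
    intro m
    conv_lhs => rw [hA.spectral_theorem, ← map_pow, Unitary.conjStarAlgAut_apply,
      Matrix.trace_mul_cycle, Unitary.coe_star_mul_self, one_mul, Matrix.diagonal_pow]
    simp [Matrix.trace]
  rw [hA.posDef_iff_eigenvalues_pos]
  have h := forall_pos_iff_forall_esymm_pos (Finset.univ.val.map hA.eigenvalues)
  simp only [Multiset.mem_map, Finset.mem_val, Finset.mem_univ, true_and, forall_exists_index,
    forall_apply_eq_imp_iff, Multiset.card_map, Finset.card_val, Finset.card_univ] at h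
  rw [h]
  refine forall₂_congr fun j _ => ?_
  rw [(leVerrier_eq_sum A htr j).2]
  exact (mul_pos_iff_of_pos_left (by positivity)).symm

theorem posDef_map_iff_leVerrier {ι : Type} [Fintype ι] [DecidableEq ι] {A : Matrix ι ι ℤ}
    (hA : A.IsSymm) :
    ((Int.castRingHom ℝ).mapMatrix A).PosDef ↔
      ∀ j < Fintype.card ι, 0 < (A * leVerrier A j).trace := by
  rw [posDef_iff_leVerrier]
  · refine forall₂_congr fun j _ => ?_
    rw [leVerrier_map, ← map_mul]
    have : ∀ B : Matrix ι ι ℤ, ((Int.castRingHom ℝ).mapMatrix B).trace = (B.trace : ℝ) :=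
      fun B => by simp [Matrix.trace]
    rw [this]
    exact_mod_cast Iff.rfl
  · ext i j
    simpa using hA.apply i j

end ParamQC

end

noncomputable section

namespace ParamQC

open Enc (enc)

section

variable {α β : Type} [Enc α] [Enc β]

/-! ### Numbers, membership, and matrices given by lists of rows -/

/-- The number with the given binary digits, the least significant one first. -/
def ofBits (l : List Bool) : ℕ := msb l.reverse

@[simp] theorem ofBits_nil : ofBits [] = 0 := rfl

@[simp] theorem ofBits_cons (b : Bool) (l : List Bool) : ofBits (b :: l) = Nat.bit b (ofBits l) := by
  rw [ofBits, List.reverse_cons, msb_concat, ofBits]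

@[simp] theorem ofBits_bits (n : ℕ) : ofBits n.bits = n := msb_bits_reverse n

theorem ofBits_lt (l : List Bool) : ofBits l < 2 ^ l.length := by
  simpa [ofBits] using msb_lt l.reverse

theorem testBit_ofBits (l : List Bool) : ∀ i, (ofBits l).testBit i = l.getD i false := by
  induction l with
  | nil => simp
  | cons b l ih =>
    intro i
    cases i with
    | zero => simp
    | succ i => simp [Nat.testBit_bit_succ, ih]

@[fun_prop]
theorem PT.ofBitsFn {f : α → List Bool} (hf : PT f) : PT fun a => ofBits (f a) := by
  unfold ofBits
  fun_prop

/-- The integer with the given sign bit and binary digits. -/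
def tokInt (l : List Bool) : ℤ := bif l.headD false then -(ofBits l.tail : ℤ) else ofBits l.tail

@[fun_prop]
theorem PT.tokIntFn {f : α → List Bool} (hf : PT f) : PT fun a => tokInt (f a) := by
  unfold tokInt
  fun_prop

@[fun_prop]
theorem PT.natMem {f : α → List ℕ} {g : α → ℕ} (hf : PT f) (hg : PT g) :
    PT fun a => decide (g a ∈ f a) := by
  refine (PT.any (h := fun a b => decide (b = g a)) hf (by fun_prop)).of_eq fun a => ?_
  rw [Bool.eq_iff_iff]
  simp

/-- The matrix with entries `f i j`, with `i` and `j` from the list. -/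
def tab (R : List ℕ) (f : ℕ → ℕ → ℤ) : List (List ℤ) := R.map fun i => R.map fun j => f i j

def entry (M : List (List ℤ)) (i j : ℕ) : ℤ := (M.getD i []).getD j 0

@[fun_prop]
theorem PT.entryFn {M : α → List (List ℤ)} {i j : α → ℕ} (hM : PT M) (hi : PT i) (hj : PT j) :
    PT fun a => entry (M a) (i a) (j a) := by
  unfold entry
  fun_prop

theorem PT.tabFn {R : α → List ℕ} {f : α → ℕ → ℕ → ℤ} (hR : PT R)
    (hf : PT fun p : (α × ℕ) × ℕ => f p.1.1 p.1.2 p.2) : PT fun a => tab (R a) (f a) := by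
  unfold tab
  refine PT.map (h := fun a i => (R a).map fun j => f a i j) hR ?_
  exact PT.map (α := α × ℕ) (h := fun p j => f p.1 p.2 j) (f := fun p => R p.1) (by fun_prop) hf

theorem entry_tab {D i j : ℕ} (hi : i < D) (hj : j < D) (f : ℕ → ℕ → ℤ) :
    entry (tab (List.range D) f) i j = f i j := by
  simp [entry, tab, List.getD, hi, hj]

theorem entry_tab_eq_or {D i j : ℕ} (f : ℕ → ℕ → ℤ) :
    entry (tab (List.range D) f) i j = f i j ∨ entry (tab (List.range D) f) i j = 0 := by
  by_cases hi : i < D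
  · by_cases hj : j < D
    · exact .inl (entry_tab hi hj f)
    · right; simp [entry, tab, List.getD, hi, hj]
  · right; simp [entry, tab, List.getD, hi]

theorem length_tab (R : List ℕ) (f : ℕ → ℕ → ℤ) : (tab R f).length = R.length := by simp [tab]

theorem natAbs_entry_lt (M : List (List ℤ)) (i j : ℕ) : (entry M i j).natAbs < 2 ^ esize M := by
  have h : ∀ {γ : Type} [Enc γ] (l : List γ) (d : γ) (i : ℕ), l.getD i d = d ∨ l.getD i d ∈ l := by
    intro γ _ l d i
    by_cases hi : i < l.length
    · right; simp [List.getD, hi]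
    · left; simp [List.getD, hi]
  unfold entry
  rcases h M [] i with h1 | h1
  · rw [h1]; simp
  · rcases h (M.getD i []) 0 j with h2 | h2
    · rw [h2]; simp
    · exact (natAbs_lt_two_pow_esize _).trans_le (Nat.pow_le_pow_right two_pos
        ((esize_le_of_mem h2).trans (esize_le_of_mem h1)))

theorem esize_tab_le {R : List ℕ} {f : ℕ → ℕ → ℤ} {m : ℕ}
    (h : ∀ i j, (f i j).natAbs < 2 ^ m) :
    esize (tab R f) ≤ R.length * (R.length * (4 * m + 6) + 2) + 1 := by
  have h1 : ∀ l ∈ tab R f, esize l ≤ R.length * (4 * m + 6) + 1 := by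
    intro l hl
    obtain ⟨i, _, rfl⟩ := List.mem_map.mp hl
    refine (esize_list_le (M := 4 * m + 5) ?_).trans (by simp)
    intro b hb
    obtain ⟨j, _, rfl⟩ := List.mem_map.mp hb
    exact esize_int_le (h i j)
  refine (esize_list_le h1).trans (by simp [length_tab])

/-- The matrix `u * M - w`. -/
def shift (u w : ℤ) (M : List (List ℤ)) : List (List ℤ) :=
  tab (List.range M.length) fun i j => u * entry M i j - bif decide (i = j) then w else 0

@[fun_prop]
theorem PT.shiftFn {u w : α → ℤ} {M : α → List (List ℤ)} (hu : PT u) (hw : PT w) (hM : PT M) :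
    PT fun a => shift (u a) (w a) (M a) :=
  PT.tabFn (f := fun a i j => u a * entry (M a) i j - bif decide (i = j) then w a else 0)
    (by fun_prop) (by fun_prop)

/-! ### The test of positive definiteness -/

def matMul (A B : List (List ℤ)) : List (List ℤ) :=
  tab (List.range A.length) fun i j =>
    ((List.range A.length).map fun m => entry A i m * entry B m j).sum

def matTrace (A : List (List ℤ)) : ℤ := ((List.range A.length).map fun i => entry A i i).sum

@[fun_prop]
theorem PT.matMulFn {A B : α → List (List ℤ)} (hA : PT A) (hB : PT B) :
    PT fun a => matMul (A a) (B a) :=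
  PT.tabFn (f := fun a i j =>
    ((List.range (A a).length).map fun m => entry (A a) i m * entry (B a) m j).sum) (by fun_prop)
    (PT.sumInt (PT.map (h := fun (p : (α × ℕ) × ℕ) m => entry (A p.1.1) p.1.2 m *
      entry (B p.1.1) m p.2) (by fun_prop) (by fun_prop)))

@[fun_prop]
theorem PT.matTraceFn {A : α → List (List ℤ)} (hA : PT A) : PT fun a => matTrace (A a) :=
  PT.sumInt (PT.map (h := fun a i => entry (A a) i i) (by fun_prop) (by fun_prop))

/-- The Boolean remembers whether all traces so far were positive. -/
def leVerrierStep (A : List (List ℤ)) (s : Bool × List (List ℤ)) (j : ℕ) :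
    Bool × List (List ℤ) :=
  (s.1 && decide (0 < matTrace (matMul A s.2)),
    tab (List.range A.length) fun i i' => (bif decide (i = i') then matTrace (matMul A s.2) else 0) -
      ((j + 1 : ℕ) : ℤ) * entry (matMul A s.2) i i')

theorem PT.leVerrierStepFn {A : α → List (List ℤ)} {s : α → Bool × List (List ℤ)} {j : α → ℕ}
    (hA : PT A) (hs : PT s) (hj : PT j) : PT fun a => leVerrierStep (A a) (s a) (j a) := by
  have h : PT fun q : List (List ℤ) × ℤ × List (List ℤ) × ℕ =>
      tab (List.range q.1.length) fun i i' => (bif decide (i = i') then q.2.1 else 0) -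
        ((q.2.2.2 + 1 : ℕ) : ℤ) * entry q.2.2.1 i i' :=
    PT.tabFn (f := fun (q : List (List ℤ) × ℤ × List (List ℤ) × ℕ) i i' =>
      (bif decide (i = i') then q.2.1 else 0) - ((q.2.2.2 + 1 : ℕ) : ℤ) * entry q.2.2.1 i i')
      (by fun_prop) (by fun_prop)
  have hP : PT fun a => matMul (A a) (s a).2 := hA.matMulFn hs.snd
  have ht : PT fun a => matTrace (matMul (A a) (s a).2) := hP.matTraceFn
  have h1 := h.comp (hA.pair (ht.pair (hP.pair hj)))
  have h2 := hs.fst.and (PT.intPos ht)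
  simp only at h1
  unfold leVerrierStep
  exact h2.pair h1

/-- Positive definiteness of a symmetric integer matrix. -/
def posTest (A : List (List ℤ)) : Bool :=
  ((List.range A.length).foldl (leVerrierStep A)
    (true, tab (List.range A.length) fun i j => bif decide (i = j) then 1 else 0)).1

theorem natAbs_sum_range_lt {D m : ℕ} {f : ℕ → ℤ} (h : ∀ i, (f i).natAbs < 2 ^ m) :
    (((List.range D).map f).sum).natAbs < 2 ^ (D + m) := by
  have : (((List.range D).map f).sum).natAbs ≤ D * 2 ^ m := by
    induction D with
    | zero => simp
    | succ D ih =>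
      rw [List.range_succ, List.map_append, List.sum_append]
      have h1 := h D
      have h2 := Int.natAbs_add_le ((List.range D).map f).sum (f D)
      simp only [List.map_cons, List.map_nil, List.sum_cons, List.sum_nil, add_zero]
      rw [add_mul, one_mul]
      omega
  refine this.trans_lt ?_
  rw [pow_add]
  exact Nat.mul_lt_mul_of_pos_right D.lt_two_pow_self (by positivity)

/-- A step enlarges entries at most by a fixed power of two: a matrix product costs `A.length +
esize A` bits, the trace `A.length` more, and the difference one more. So bit lengths grow linearly
with the number of steps, and the recursion stays polynomial. -/
theorem leVerrierStep_bound (A : List (List ℤ)) {s : Bool × List (List ℤ)} {m j : ℕ}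
    (hj : j < A.length) (hs : ∀ i i', (entry s.2 i i').natAbs < 2 ^ m) :
    ∃ f, (leVerrierStep A s j).2 = tab (List.range A.length) f ∧
      ∀ i i', (f i i').natAbs < 2 ^ (m + (esize A + 3 * A.length + 1)) := by
  have h1 : ∀ i i', (entry (matMul A s.2) i i').natAbs < 2 ^ (A.length + (esize A + m)) := by
    intro i i'
    rcases entry_tab_eq_or (D := A.length) (i := i) (j := i') (fun i j =>
      ((List.range A.length).map fun m => entry A i m * entry s.2 m j).sum) with h | h
    · rw [matMul, h]
      refine natAbs_sum_range_lt fun l => ?_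
      rw [Int.natAbs_mul, pow_add]
      exact Nat.mul_lt_mul'' (natAbs_entry_lt A i l) (hs l i')
    · rw [matMul, h]; simp
  have h2 : (matTrace (matMul A s.2)).natAbs < 2 ^ (A.length + (A.length + (esize A + m))) := by
    have := natAbs_sum_range_lt (D := A.length) fun i => h1 i i
    rwa [matTrace, matMul, length_tab, List.length_range]
  refine ⟨_, rfl, fun i i' => ?_⟩
  have h3 : ((bif decide (i = i') then matTrace (matMul A s.2) else 0)).natAbs <
      2 ^ (A.length + (A.length + (esize A + m))) := by
    cases decide (i = i')
    · simp
    · exact h2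
  have h4 : (((j + 1 : ℕ) : ℤ) * entry (matMul A s.2) i i').natAbs <
      2 ^ (A.length + (A.length + (esize A + m))) := by
    rw [Int.natAbs_mul, Int.natAbs_natCast, pow_add]
    exact Nat.mul_lt_mul'' (lt_of_le_of_lt hj A.length.lt_two_pow_self) (h1 i i')
  calc _ ≤ _ := Int.natAbs_sub_le _ _
    _ < 2 ^ (A.length + (A.length + (esize A + m))) + 2 ^ (A.length + (A.length + (esize A + m))) :=
        Nat.add_lt_add h3 h4
    _ = 2 ^ (A.length + (A.length + (esize A + m)) + 1) := by rw [pow_succ, mul_two]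
    _ ≤ _ := Nat.pow_le_pow_right two_pos (by omega)

theorem leVerrierStep_foldl_bound (A : List (List ℤ)) (l : List ℕ) :
    ∀ (s : Bool × List (List ℤ)) (m : ℕ), (∀ j ∈ l, j < A.length) →
    (∃ f, s.2 = tab (List.range A.length) f ∧ ∀ i i', (f i i').natAbs < 2 ^ m) →
    esize (l.foldl (leVerrierStep A) s) ≤ A.length * (A.length * (4 * (m + l.length *
      (esize A + 3 * A.length + 1)) + 6) + 2) + 5 := by
  induction l with
  | nil =>
    rintro ⟨b, M⟩ m - ⟨f, rfl, hf⟩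
    have := esize_tab_le (R := List.range A.length) hf
    have := esize_bool b
    simp only [List.length_range] at *
    simp
    omega
  | cons j l ih =>
    rintro s m hl ⟨f, hs, hf⟩
    have hb : ∀ i i', (entry s.2 i i').natAbs < 2 ^ m := by
      intro i i'
      rcases entry_tab_eq_or (D := A.length) (i := i) (j := i') f with h | h
      · rw [hs, h]; exact hf i i'
      · rw [hs, h]; simp
    have := ih (leVerrierStep A s j) _ (fun i hi => hl i (by simp [hi]))
      (leVerrierStep_bound A (hl j (by simp)) hb)
    rw [List.foldl_cons]
    refine this.trans (le_of_eq ?_)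
    rw [List.length_cons]
    ring

@[fun_prop]
theorem PT.posTestFn {A : α → List (List ℤ)} (hA : PT A) : PT fun a => posTest (A a) := by
  have h : PT fun A : List (List ℤ) => (List.range A.length).foldl (leVerrierStep A)
      (true, tab (List.range A.length) fun i j => bif decide (i = j) then 1 else 0) := by
    refine PT.foldl (h := fun A s j => leVerrierStep A s j) (by fun_prop)
      (.pair (by fun_prop) ?_) ?_
      (fun A => A.length * (A.length * (4 * (1 + A.length *
        (esize A + 3 * A.length + 1)) + 6) + 2) + 5) ?_ ?_
    · exact PT.tabFn (f := fun _ i j => bif decide (i = j) then 1 else 0) (by fun_prop)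
        (by fun_prop)
    · exact PT.leVerrierStepFn (by fun_prop) (by fun_prop) (by fun_prop)
    · have : PB (fun A : List (List ℤ) => A.length) esize :=
        PB.mono .self fun A => (length_lt_esize A).le
      have h' : PB (esize : List (List ℤ) → ℕ) esize := .self
      exact ((this.mul ((this.mul (((PB.const 4).mul ((PB.const 1).add (this.mul
        ((h'.add ((PB.const 3).mul this)).add_const 1)))).add_const 6)).add_const 2))).add_const 5
    · intro A l₁ l₂ hl
      have hlen : l₁.length ≤ A.length := by
        have := congrArg List.length hl
        simp at this
        omega
      refine (leVerrierStep_foldl_bound A l₁ _ 1 ?_ ⟨_, rfl, ?_⟩).trans ?_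
      · intro j hj
        have : j ∈ List.range A.length := by rw [hl]; simp [hj]
        simpa using this
      · intro i i'
        cases decide (i = i') <;> simp
      · gcongr
  exact (PT.fst h).comp hA

end

end ParamQC

end

noncomputable section

namespace ParamQC

open Enc (enc)

section

variable {α β : Type} [Enc α] [Enc β]

/-! ### Reading a Hamiltonian and listing its matrix -/

/-- The qubits of a term, in unary, and the numerators and denominators of its entries. -/
abbrev RawTerm := List (List Bool) × List (List Bool)

/-- A term of arity r consists of a token of length r, then r tokens for the qubits, then 4 · 2^r ·
2^r = 2^(r + (r + 2)) tokens for numerators and denominators of the real and imaginary parts. The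
list `[true, true]` supplies the summand 2. -/
def parseStep (s : List (List Bool) × List RawTerm) : List (List Bool) × List RawTerm :=
  ((s.1.tail.drop (s.1.headD []).length).drop
      (2 ^ (s.1.headD [] ++ (s.1.headD [] ++ [true, true])).length),
    s.2 ++ [(s.1.tail.take (s.1.headD []).length, (s.1.tail.drop (s.1.headD []).length).take
      (2 ^ (s.1.headD [] ++ (s.1.headD [] ++ [true, true])).length))])

/-- Splits off as many terms as the length of the first argument. -/
def parse (c : List Bool) (toks : List (List Bool)) : List (List Bool) × List RawTerm :=
  c.foldl (fun s _ => parseStep s) (toks, [])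

theorem esize_take_drop (l : List β) (n : ℕ) :
    esize (l.take n) + esize (l.drop n) = esize l + 1 := by
  rw [← esize_append, List.take_append_drop]

theorem esize_tail_le (l : List β) : esize l.tail ≤ esize l := esize_list_mono (List.tail_sublist l)

@[fun_prop]
theorem PT.parseFn {c : α → List Bool} {f : α → List (List Bool)} (hc : PT c) (hf : PT f) :
    PT fun a => parse (c a) (f a) := by
  unfold parse
  -- Tokens are only moved from the remaining input to the parsed terms, so a step adds no more than
  -- a constant to the size.
  refine PT.foldl_additive (h := fun _ s _ => parseStep s) hc (by fun_prop) ?_ (fun _ => 100)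
    (by fun_prop) ?_
  · have h1 : PT fun p : α × (List (List Bool) × List RawTerm) × Bool =>
        2 ^ (p.2.1.1.headD [] ++ (p.2.1.1.headD [] ++ [true, true])).length :=
      PT.twoPow (by fun_prop)
    unfold parseStep
    fun_prop
  · intro a s b _
    have h1 := esize_take_drop s.1.tail (s.1.headD []).length
    have h2 := esize_take_drop (s.1.tail.drop (s.1.headD []).length)
      (2 ^ (s.1.headD [] ++ (s.1.headD [] ++ [true, true])).length)
    have h3 := esize_tail_le s.1
    have h4 := esize_append s.2 [(s.1.tail.take (s.1.headD []).length,
      (s.1.tail.drop (s.1.headD []).length).take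
        (2 ^ (s.1.headD [] ++ (s.1.headD [] ++ [true, true])).length))]
    rw [esize_cons, esize_prod, esize_nil] at h4
    rw [parseStep, esize_prod, esize_prod s]
    dsimp only at h4 ⊢
    omega

/-- Whether two basis states, given by the positions of the ones, agree outside of the qubits. -/
def agree (Q : List (List Bool)) (s t : List ℕ) : Bool :=
  s.all (fun a => decide (a ∈ t) || decide (a ∈ Q.map List.length)) &&
    t.all (fun a => decide (a ∈ s) || decide (a ∈ Q.map List.length))

@[fun_prop]
theorem PT.agreeFn {Q : α → List (List Bool)} {s t : α → List ℕ} (hQ : PT Q) (hs : PT s)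
    (ht : PT t) : PT fun a => agree (Q a) (s a) (t a) := by
  have h : PT fun a => (Q a).map List.length := PT.map (h := fun _ l => l.length) hQ (by fun_prop)
  have h1 : ∀ {s t : α → List ℕ}, PT s → PT t → PT fun a => (s a).all fun b =>
      decide (b ∈ t a) || decide (b ∈ (Q a).map List.length) := fun hs ht =>
    PT.all (h := fun a b => decide (b ∈ _) || decide (b ∈ (Q a).map List.length)) hs
      (PT.or (PT.natMem (ht.comp .fst') .snd') (PT.natMem (h.comp .fst') .snd'))
  exact (h1 hs ht).and (h1 ht hs)

/-- The number whose binary expansion is given by the values of a basis state at the qubits. -/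
def rowIndex (Q : List (List Bool)) (s : List ℕ) : ℕ :=
  ofBits (Q.map fun l => decide (l.length ∈ s))

@[fun_prop]
theorem PT.rowIndexFn {Q : α → List (List Bool)} {s : α → List ℕ} (hQ : PT Q) (hs : PT s) :
    PT fun a => rowIndex (Q a) (s a) :=
  PT.ofBitsFn (PT.map (h := fun a (l : List Bool) => decide (l.length ∈ s a)) hQ (by fun_prop))

/-- The real (`c = 0`) or imaginary part (`c = 2`) of the entry of a term, multiplied by `Δ`. -/
def termEntry (Δ : ℕ) (c : ℕ) (h : RawTerm) (s t : List ℕ) : ℤ :=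
  bif agree h.1 s t then
    -- Each entry takes four tokens: numerator and denominator of the real part, then of the
    -- imaginary part. The natural-number quotient is exact whenever the denominator divides `Δ`.
    tokInt (h.2.getD (4 * (2 ^ h.1.length * rowIndex h.1 s + rowIndex h.1 t) + c) []) *
      ((Δ / ofBits (h.2.getD (4 * (2 ^ h.1.length * rowIndex h.1 s + rowIndex h.1 t) + c + 1) []) :
        ℕ) : ℤ)
  else 0

@[fun_prop]
theorem PT.termEntryFn {Δ c : α → ℕ} {h : α → RawTerm} {s t : α → List ℕ} (hΔ : PT Δ) (hc : PT c)
    (hh : PT h) (hs : PT s) (ht : PT t) :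
    PT fun a => termEntry (Δ a) (c a) (h a) (s a) (t a) := by
  have h1 : PT fun a => 2 ^ (h a).1.length := PT.twoPow (by fun_prop)
  have h2 : PT fun a => 4 * (2 ^ (h a).1.length * rowIndex (h a).1 (s a) +
      rowIndex (h a).1 (t a)) + c a := by fun_prop
  refine .cond (by fun_prop) (.intMul (.tokIntFn (.getD (by fun_prop) h2 (by fun_prop)))
    (.natCast (.natDiv hΔ (.ofBitsFn (.getD (by fun_prop) (.natAdd h2 (.const 1))
    (by fun_prop)))))) (.const 0)

def sumEntry (Δ : ℕ) (c : ℕ) (H : List RawTerm) (s t : List ℕ) : ℤ :=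
  (H.map fun h => termEntry Δ c h s t).sum

@[fun_prop]
theorem PT.sumEntryFn {Δ c : α → ℕ} {H : α → List RawTerm} {s t : α → List ℕ} (hΔ : PT Δ)
    (hc : PT c) (hH : PT H) (hs : PT s) (ht : PT t) :
    PT fun a => sumEntry (Δ a) (c a) (H a) (s a) (t a) :=
  PT.sumInt (PT.map (h := fun a h => termEntry (Δ a) (c a) h (s a) (t a)) hH (by fun_prop))

/-- The entries of the real symmetric matrix `[[Re, -Im], [Im, Re]]`. -/
def realEntry (Δ : ℕ) (H : List RawTerm) (i j : Bool × List ℕ) : ℤ :=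
  bif Bool.xor i.1 j.1 then
    (bif i.1 then sumEntry Δ 2 H i.2 j.2 else -sumEntry Δ 2 H i.2 j.2)
  else sumEntry Δ 0 H i.2 j.2

def realIndices (L : List (List ℕ)) : List (Bool × List ℕ) :=
  L.map (fun s => (false, s)) ++ L.map fun s => (true, s)

def realMatrix (Δ : ℕ) (H : List RawTerm) (L : List (List ℕ)) : List (List ℤ) :=
  (realIndices L).map fun i => (realIndices L).map fun j => realEntry Δ H i j

@[fun_prop]
theorem PT.realMatrixFn {Δ : α → ℕ} {H : α → List RawTerm} {L : α → List (List ℕ)} (hΔ : PT Δ)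
    (hH : PT H) (hL : PT L) : PT fun a => realMatrix (Δ a) (H a) (L a) := by
  have h1 : ∀ b : Bool, PT fun a => (L a).map fun s => (b, s) := fun b =>
    PT.map (h := fun _ s => (b, s)) hL (by fun_prop)
  have h2 : PT fun a => realIndices (L a) := (h1 false).append (h1 true)
  have h3 : PT fun p : (α × Bool × List ℕ) × Bool × List ℕ =>
      realEntry (Δ p.1.1) (H p.1.1) p.1.2 p.2 := by
    unfold realEntry
    fun_prop
  exact PT.map (h := fun a i => (realIndices (L a)).map fun j => realEntry (Δ a) (H a) i j) h2
    (PT.map (h := fun (p : α × Bool × List ℕ) j => realEntry (Δ p.1) (H p.1) p.2 j)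
      (h2.comp .fst') h3)

/-! ### Listing the basis states of given weight -/

/-- The increasing lists of numbers less than the length of `N` with as many members as `K`. -/
def basis (K N : List Bool) : List (List ℕ) :=
  K.foldl (fun L _ => L.flatMap fun t => ((List.range N.length).filter fun a =>
    t.all fun b => decide (a < b)).map fun a => a :: t) [[]]

/-- Each round multiplies the number of lists by at most n. The base n + 1 makes the bound increase
with the number of rounds even for n = 0. -/
theorem basis_foldl_bound (n : ℕ) (K : List Bool) : ∀ (L : List (List ℕ)) (m c : ℕ),
    (∀ t ∈ L, esize t ≤ m) → L.length ≤ c →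
    (∀ t ∈ K.foldl (fun L _ => L.flatMap fun t => ((List.range n).filter fun a =>
      t.all fun b => decide (a < b)).map fun a => a :: t) L,
      esize t ≤ m + K.length * (4 * n + 2)) ∧
    (K.foldl (fun L _ => L.flatMap fun t => ((List.range n).filter fun a =>
      t.all fun b => decide (a < b)).map fun a => a :: t) L).length ≤ c * (n + 1) ^ K.length := by
  induction K with
  | nil => intro L m c h1 h2; simpa using ⟨h1, h2⟩
  | cons b K ih =>
    intro L m c hL hc
    have hs : ∀ t ∈ L.flatMap fun t => ((List.range n).filter fun a =>
        t.all fun b => decide (a < b)).map fun a => a :: t, esize t ≤ m + (4 * n + 2) := by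
      intro t ht
      obtain ⟨s, hs, ht⟩ := List.mem_flatMap.mp ht
      obtain ⟨a, ha, rfl⟩ := List.mem_map.mp ht
      have ha : a < n := by simpa using (List.mem_filter.mp ha).1
      have h3 : esize a ≤ 4 * n + 1 := esize_nat_le (ha.trans n.lt_two_pow_self)
      have := hL s hs
      rw [esize_cons]
      omega
    have hl : (L.flatMap fun t => ((List.range n).filter fun a =>
        t.all fun b => decide (a < b)).map fun a => a :: t).length ≤ c * (n + 1) := by
      rw [List.length_flatMap]
      refine (List.sum_le_card_nsmul _ (n + 1) ?_).trans ?_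
      · intro x hx
        obtain ⟨t, _, rfl⟩ := List.mem_map.mp hx
        rw [List.length_map]
        exact (List.length_filter_le _ _).trans (by simp)
      · rw [List.length_map, smul_eq_mul]
        gcongr
    obtain ⟨h1, h2⟩ := ih _ _ _ hs hl
    refine ⟨fun t ht => (h1 t ht).trans (le_of_eq ?_), h2.trans (le_of_eq ?_)⟩
    · rw [List.length_cons]; ring
    · rw [List.length_cons]; ring

/-- Listing the basis is the only part whose cost is not polynomial in the input; the measure has to
dominate (n + 1)^k, and everything else is polynomial in the list. -/
theorem PTm.basisFn {μ : α → ℕ} {K N : α → List Bool} (hK : PT K) (hN : PT N) (hμ : PB esize μ)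
    (hpow : PB (fun a => ((N a).length + 1) ^ (K a).length) μ) :
    PTm μ fun a => basis (K a) (N a) := by
  have hK' : PB (fun a => (K a).length) μ :=
    (hK.pb_esize.trans hμ).mono fun a => (length_lt_esize _).le
  have hN' : PB (fun a => (N a).length) μ :=
    (hN.pb_esize.trans hμ).mono fun a => (length_lt_esize _).le
  refine PTm.foldl (h := fun a (L : List (List ℕ)) _ => L.flatMap fun t => ((List.range (N a).length).filter fun b =>
    t.all fun c => decide (b < c)).map fun b => b :: t) (.of_PT hK hμ) (.of_PT (.const _) hμ) ?_ hμ
    (fun a => ((N a).length + 1) ^ (K a).length *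
      (1 + (K a).length * (4 * (N a).length + 2) + 1) + 1) ?_ ?_
  · refine PT.flatMap (h := fun (p : α × List (List ℕ) × Bool) t => ((List.range
      (N p.1).length).filter fun b => t.all fun c => decide (b < c)).map fun b => b :: t)
      (f := fun p => p.2.1) (by fun_prop) ?_
    refine PT.map (h := fun (p : (α × List (List ℕ) × Bool) × List ℕ) b => b :: p.2) ?_
      (by fun_prop)
    refine PT.filter (h := fun (p : (α × List (List ℕ) × Bool) × List ℕ) b => p.2.all fun c =>
      decide (b < c)) (f := fun p => List.range (N p.1.1).length) (by fun_prop) ?_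
    exact PT.all (h := fun (p : ((α × List (List ℕ) × Bool) × List ℕ) × ℕ) c =>
      decide (p.2 < c)) (f := fun p => p.1.2) (by fun_prop) (by fun_prop)
  · exact ((hpow.mul ((((PB.const 1).add (hK'.mul ((hN'.const_mul 4).add_const 2)))).add_const
      1))).add_const 1
  · intro a l₁ l₂ hl
    have hlen : l₁.length ≤ (K a).length := by
      have := congrArg List.length hl
      rw [List.length_append] at this
      omega
    obtain ⟨h1, h2⟩ := basis_foldl_bound (N a).length l₁ [[]] 1 1
      (by simp [esize_nil]) (by simp)
    refine (esize_list_le h1).trans ?_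
    rw [one_mul] at h2
    refine Nat.add_le_add_right (Nat.mul_le_mul (h2.trans ?_) ?_) 1
    · exact Nat.pow_le_pow_right (Nat.succ_pos _) hlen
    · gcongr

/-! ### The algorithms -/

/-- A common multiple of the denominators that occur in the input. -/
def commonDenom (toks : List (List Bool)) : ℕ :=
  -- All nonzero tokens are multiplied, whether or not they are denominators: only a positive common
  -- multiple of polynomial length is needed.
  (toks.map fun t => bif decide (ofBits t = 0) then 1 else ofBits t).prod

/-- The tokens 0, 1 and 2 are k, n and the number of terms. The first component of the result
contains the tokens after the Hamiltonian. -/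
def inputTerms (x : List Symbol) : List (List Bool) × List RawTerm :=
  parse ((tokens x).getD 2 []) ((tokens x).drop 3)

def inputMatrix (x : List Symbol) (L : List (List ℕ)) : List (List ℤ) :=
  realMatrix (commonDenom (tokens x)) (inputTerms x).2 L

/-- Whether some eigenvalue is at most the rational number that follows the Hamiltonian. -/
def lowEnergy (x : List Symbol) (L : List (List ℕ)) : Bool :=
  -- The listed matrix is Δ · B up to realification. For a rational u/v, the matrix v · (Δ · B) - u
  -- · Δ is a positive multiple of B - u/v.
  !posTest (shift (ofBits ((inputTerms x).1.getD 1 []) : ℤ)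
    (tokInt ((inputTerms x).1.headD []) * (commonDenom (tokens x) : ℤ)) (inputMatrix x L))

def searchStep (M : List (List ℤ)) (Δ : ℤ) (s : ℤ × ℕ) : ℤ × ℕ :=
  (bif posTest (shift 1 ((s.1 + s.2) * Δ) M) then s.1 + s.2 else s.1, s.2.div2)

/-- The largest integer `z` between `- 2 ^ |l|` and `2 ^ |l|` such that `M - z * Δ` is positive
definite. -/
def search (M : List (List ℤ)) (Δ : ℤ) (l : List Bool) : ℤ :=
  -- The first step is half the length of the interval from -2^|l| to 2^|l|; `|l| + 1` bisections
  -- reduce this length to 1.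
  ((true :: l).foldl (fun s _ => searchStep M Δ s) (-((2 ^ l.length : ℕ) : ℤ), 2 ^ l.length)).1

def absSum (M : List (List ℤ)) : ℤ := (M.flatten.map fun z => ((z.natAbs : ℕ) : ℤ)).sum

/-- Here t is the length of the token after the Hamiltonian. The matrix is 2^t Δ B, so subtracting z
Δ leaves a positive definite matrix exactly when z < 2^t λ. The sum of the absolute values of the
entries bounds the spectrum and fixes the range of the search. -/
def lowestEnergy (x : List Symbol) (L : List (List ℕ)) : ℤ :=
  let M := shift ((2 ^ ((inputTerms x).1.headD []).length : ℕ) : ℤ) 0 (inputMatrix x L)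
  search M (commonDenom (tokens x)) (absSum M).natAbs.bits

@[fun_prop]
theorem PT.commonDenomFn {f : α → List (List Bool)} (hf : PT f) : PT fun a => commonDenom (f a) :=
  PT.prodNat (PT.map (h := fun _ t => bif decide (ofBits t = 0) then 1 else ofBits t) hf
    (by fun_prop))

@[fun_prop]
theorem PT.inputTermsFn {f : α → List Symbol} (hf : PT f) : PT fun a => inputTerms (f a) := by
  unfold inputTerms
  fun_prop

@[fun_prop]
theorem PT.inputMatrixFn {f : α → List Symbol} {L : α → List (List ℕ)} (hf : PT f) (hL : PT L) :
    PT fun a => inputMatrix (f a) (L a) := by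
  unfold inputMatrix
  fun_prop

@[fun_prop]
theorem PT.lowEnergyFn {f : α → List Symbol} {L : α → List (List ℕ)} (hf : PT f) (hL : PT L) :
    PT fun a => lowEnergy (f a) (L a) := by
  unfold lowEnergy
  fun_prop

theorem search_foldl_bound (M : List (List ℤ)) (Δ : ℤ) (m : ℕ) (l : List Bool) :
    ∀ (s : ℤ × ℕ) (c : ℕ), s.1.natAbs ≤ c * 2 ^ m → s.2 ≤ 2 ^ m →
    (l.foldl (fun s _ => searchStep M Δ s) s).1.natAbs ≤ (c + l.length) * 2 ^ m ∧
      (l.foldl (fun s _ => searchStep M Δ s) s).2 ≤ 2 ^ m := by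
  induction l with
  | nil => intro s c h1 h2; simpa using ⟨h1, h2⟩
  | cons b l ih =>
    intro s c h1 h2
    rw [List.foldl_cons, List.length_cons, show c + (l.length + 1) = (c + 1) + l.length by ring]
    refine ih _ _ ?_ ?_
    · rw [searchStep, Nat.add_mul c 1]
      dsimp only
      generalize posTest (shift 1 ((s.1 + s.2) * Δ) M) = b
      cases b <;> simp only [cond_true, cond_false] <;> omega
    · rw [searchStep, Nat.div2_val]
      dsimp only
      omega

@[fun_prop]
theorem PT.searchFn {M : α → List (List ℤ)} {Δ : α → ℤ} {l : α → List Bool} (hM : PT M)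
    (hΔ : PT Δ) (hl : PT l) : PT fun a => search (M a) (Δ a) (l a) := by
  have h2 : PT fun a => 2 ^ (l a).length := PT.twoPow hl
  have hlen : PB (fun a => (l a).length) esize :=
    hl.pb_esize.mono fun a => (length_lt_esize _).le
  refine .fst (PT.foldl (h := fun a s _ => searchStep (M a) (Δ a) s) (by fun_prop) (by fun_prop) ?_
    (fun a => (4 * (2 * (l a).length + 2) + 5) + (4 * ((l a).length + 1) + 1) + 1) ?_ ?_)
  · have h3 : PT fun q : (α × (ℤ × ℕ)) => posTest (shift 1 ((q.2.1 + q.2.2) * Δ q.1) (M q.1)) := by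
      fun_prop
    have h4 : PT fun p : α × (ℤ × ℕ) × Bool => (p.1, p.2.1) := by fun_prop
    exact ((h3.comp h4).cond (by fun_prop) (by fun_prop)).pair (by fun_prop)
  · exact ((((((hlen.const_mul 2).add_const 2).const_mul 4).add_const 5).add
      (((hlen.add_const 1).const_mul 4).add_const 1))).add_const 1
  · intro a l₁ l₂ h
    have hlen : l₁.length ≤ (l a).length + 1 := by
      have := congrArg List.length h
      simp at this
      omega
    obtain ⟨h1, h2⟩ := search_foldl_bound (M a) (Δ a) (l a).length l₁
      (-((2 ^ (l a).length : ℕ) : ℤ), 2 ^ (l a).length) 1 (by simp) le_rfl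
    rw [esize_prod]
    have h3 : (1 + l₁.length) * 2 ^ (l a).length < 2 ^ (2 * (l a).length + 2) := by
      rw [show 2 * (l a).length + 2 = ((l a).length + 2) + (l a).length by ring, pow_add _ _
        (l a).length]
      refine Nat.mul_lt_mul_of_pos_right ?_ (by positivity)
      exact lt_of_le_of_lt (by omega) (Nat.lt_two_pow_self (n := (l a).length + 2))
    have h4 := esize_int_le (h1.trans_lt h3)
    have h5 := esize_nat_le (h2.trans_lt (Nat.pow_lt_pow_right one_lt_two (Nat.lt_succ_self _)))
    exact Nat.add_le_add_right (Nat.add_le_add h4 h5) 1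

@[fun_prop]
theorem PT.lowestEnergyFn {f : α → List Symbol} {L : α → List (List ℕ)} (hf : PT f) (hL : PT L) :
    PT fun a => lowestEnergy (f a) (L a) := by
  have h1 : PT fun a => 2 ^ ((inputTerms (f a)).1.headD []).length := PT.twoPow (by fun_prop)
  have h2 : PT fun a => shift ((2 ^ ((inputTerms (f a)).1.headD []).length : ℕ) : ℤ) 0
      (inputMatrix (f a) (L a)) := .shiftFn (.natCast h1) (.const 0) (by fun_prop)
  have h3 : PT fun M : List (List ℤ) => absSum M :=
    PT.sumInt (PT.map (h := fun _ (z : ℤ) => ((z.natAbs : ℕ) : ℤ)) (by fun_prop) (by fun_prop))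
  have h4 := h3.comp h2
  exact .searchFn h2 (by fun_prop) (by fun_prop)

/-! ### Encoding integers as strings -/

def intString (z : ℤ) : List Symbol :=
  some (decide (z < 0)) :: (z.natAbs.bits.map Option.some ++ [none])

@[fun_prop]
theorem PT.intStringFn {f : α → ℤ} (hf : PT f) : PT fun a => intString (f a) := by
  have h : PT fun a => (f a).natAbs.bits.map Option.some :=
    PT.map (h := fun _ b => Option.some b) (by fun_prop) (by fun_prop)
  unfold intString
  fun_prop

theorem encodeNat_eq_bits (n : ℕ) : Computability.encodeNat n = n.bits := by
  have hp : ∀ p : PosNum, Computability.encodePosNum p = (p : ℕ).bits := by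
    intro p
    induction p with
    | one => simp [Computability.encodePosNum]
    | bit0 p ih =>
      rw [Computability.encodePosNum, ih, PosNum.cast_bit0, ← two_mul,
        Nat.bit0_bits _ (PosNum.cast_pos p).ne']
    | bit1 p ih =>
      rw [Computability.encodePosNum, ih, PosNum.cast_bit1, ← two_mul, Nat.bit1_bits]
  rw [Computability.encodeNat]
  conv_rhs => rw [← Num.to_of_nat n]
  cases (n : Num) with
  | zero => simp [Computability.encodeNum]
  | pos p => simpa [Computability.encodeNum] using hp p

theorem intString_eq (z : ℤ) : intString z = encInt z := by
  rw [intString, encInt, encNat, encodeNat_eq_bits]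

end

end ParamQC

end

noncomputable section

namespace ParamQC

/-! ### Correctness of the test of positive definiteness -/

/-- The square matrix of the given size listed by rows. -/
def toMatrix (D : ℕ) (M : List (List ℤ)) : Matrix (Fin D) (Fin D) ℤ :=
  Matrix.of fun i j => entry M i j

theorem sum_map_range {R : Type} [AddCommMonoid R] (D : ℕ) (f : ℕ → R) :
    ((List.range D).map f).sum = ∑ i : Fin D, f i := by
  rw [← Finset.sum_range]
  rfl

theorem toMatrix_matMul {D : ℕ} {A : List (List ℤ)} (hA : A.length = D) (B : List (List ℤ)) :
    toMatrix D (matMul A B) = toMatrix D A * toMatrix D B := by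
  subst hA
  ext i j
  simp [toMatrix, matMul, entry_tab i.2 j.2, Matrix.mul_apply, sum_map_range]

theorem matTrace_eq {D : ℕ} {A : List (List ℤ)} (hA : A.length = D) :
    matTrace A = (toMatrix D A).trace := by
  subst hA
  simp [matTrace, sum_map_range, Matrix.trace, toMatrix]

theorem toMatrix_leVerrierStep {D : ℕ} {A : List (List ℤ)} (hA : A.length = D) (b : Bool)
    (B : List (List ℤ)) (j : ℕ) :
    (leVerrierStep A (b, B) j).1 =
      (b && decide (0 < (toMatrix D A * toMatrix D B).trace)) ∧
    toMatrix D (leVerrierStep A (b, B) j).2 = (toMatrix D A * toMatrix D B).trace • 1 -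
      ((j : ℤ) + 1) • (toMatrix D A * toMatrix D B) := by
  have hl : (matMul A B).length = D := by rw [matMul, length_tab, List.length_range, hA]
  have h1 := matTrace_eq hl
  have h2 := toMatrix_matMul hA B
  constructor
  · rw [leVerrierStep, h1, h2]
  · ext i j'
    have h3 : entry (matMul A B) i j' = (toMatrix D A * toMatrix D B) i j' := by rw [← h2]; rfl
    rw [toMatrix, leVerrierStep, Matrix.of_apply, hA, entry_tab i.2 j'.2, h1, h2, h3,
      Matrix.sub_apply, Matrix.smul_apply, Matrix.smul_apply, smul_eq_mul, smul_eq_mul,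
      Matrix.one_apply]
    by_cases h : i = j'
    · simp [h]
    · have h' : (i : ℕ) ≠ j' := fun h' => h (Fin.ext h')
      simp [h, h']

theorem posTest_foldl {D : ℕ} {A : List (List ℤ)} (hA : A.length = D) (m : ℕ) :
    (((List.range m).foldl (leVerrierStep A)
      (true, tab (List.range A.length) fun i j => bif decide (i = j) then 1 else 0)).1 = true ↔
      ∀ j < m, 0 < (toMatrix D A * leVerrier (toMatrix D A) j).trace) ∧
    toMatrix D ((List.range m).foldl (leVerrierStep A)
      (true, tab (List.range A.length) fun i j => bif decide (i = j) then 1 else 0)).2 =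
      leVerrier (toMatrix D A) m := by
  induction m with
  | zero =>
    refine ⟨by simp, ?_⟩
    ext i j
    rw [List.range_zero, List.foldl_nil, toMatrix, Matrix.of_apply, hA, entry_tab i.2 j.2,
      leVerrier, Matrix.one_apply]
    by_cases h : i = j
    · simp [h]
    · have h' : (i : ℕ) ≠ j := fun h' => h (Fin.ext h')
      simp [h, h']
  | succ m ih =>
    rw [List.range_succ, List.foldl_append, List.foldl_cons, List.foldl_nil]
    obtain ⟨h1, h2⟩ := ih
    obtain ⟨h3, h4⟩ := toMatrix_leVerrierStep hA ((List.range m).foldl (leVerrierStep A)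
      (true, tab (List.range A.length) fun i j => bif decide (i = j) then 1 else 0)).1
      ((List.range m).foldl (leVerrierStep A)
      (true, tab (List.range A.length) fun i j => bif decide (i = j) then 1 else 0)).2 m
    rw [h2] at h3 h4
    refine ⟨?_, h4⟩
    rw [h3, Bool.and_eq_true, h1, decide_eq_true_eq]
    constructor
    · rintro ⟨h5, h6⟩ j hj
      rcases Nat.lt_succ_iff_lt_or_eq.mp hj with h | rfl
      exacts [h5 j h, h6]
    · exact fun h => ⟨fun j hj => h j (hj.trans (Nat.lt_succ_self m)), h m (Nat.lt_succ_self m)⟩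

theorem posTest_iff {D : ℕ} {A : List (List ℤ)} (hA : A.length = D) (hs : (toMatrix D A).IsSymm) :
    posTest A = true ↔ ((Int.castRingHom ℝ).mapMatrix (toMatrix D A)).PosDef := by
  rw [posDef_map_iff_leVerrier hs, Fintype.card_fin, posTest, ← (posTest_foldl hA D).1, hA]

theorem toMatrix_shift {D : ℕ} {M : List (List ℤ)} (hM : M.length = D) (u w : ℤ) :
    toMatrix D (shift u w M) = u • toMatrix D M - w • 1 := by
  ext i j
  rw [toMatrix, shift, Matrix.of_apply, hM, entry_tab i.2 j.2, Matrix.sub_apply,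
    Matrix.smul_apply, Matrix.smul_apply, smul_eq_mul, smul_eq_mul, Matrix.one_apply]
  by_cases h : i = j
  · simp [h, toMatrix]
  · have h' : (i : ℕ) ≠ j := fun h' => h (Fin.ext h')
    simp [h, h', toMatrix]

theorem length_shift (u w : ℤ) (M : List (List ℤ)) : (shift u w M).length = M.length := by
  simp [shift, length_tab]

/-! ### Hermitian matrices and their smallest eigenvalue -/

open scoped ComplexOrder

section

variable {ι : Type} [Fintype ι] [DecidableEq ι]

theorem posDef_sub_smul_one_iff {B : Matrix ι ι ℂ} (hB : B.IsHermitian) (c : ℝ) :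
    (B - (c : ℂ) • 1).PosDef ↔ ∀ i, c < hB.eigenvalues i := by
  have h : B - (c : ℂ) • 1 = Unitary.conjStarAlgAut ℂ _ hB.eigenvectorUnitary
      (Matrix.diagonal fun i => ((hB.eigenvalues i - c : ℝ) : ℂ)) := by
    have h1 : (Matrix.diagonal fun i => ((hB.eigenvalues i - c : ℝ) : ℂ)) =
        Matrix.diagonal (RCLike.ofReal ∘ hB.eigenvalues) - (c : ℂ) • 1 := by
      ext i j
      by_cases h : i = j <;> simp [h]
    rw [h1, map_sub, map_smul, map_one]
    conv_lhs => rw [hB.spectral_theorem]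
  rw [h]
  have hu : IsUnit (hB.eigenvectorUnitary : Matrix ι ι ℂ) := Unitary.isUnit_coe
  rw [Unitary.conjStarAlgAut_apply, Matrix.IsUnit.posDef_star_right_conjugate_iff hu, Matrix.posDef_diagonal_iff]
  refine forall_congr' fun i => ?_
  rw [Complex.zero_lt_real, sub_pos]

theorem posDef_sub_smul_one_iff_re {B : Matrix ι ι ℂ} (hB : B.IsHermitian) (c : ℝ) :
    (B - (c : ℂ) • 1).PosDef ↔
      ∀ v : ι → ℂ, v ≠ 0 → 0 < (star v ⬝ᵥ B.mulVec v).re - c * ∑ i, ‖v i‖ ^ 2 := by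
  have hH : (B - (c : ℂ) • 1).IsHermitian := hB.sub (by
    rw [Matrix.IsHermitian, Matrix.conjTranspose_smul, Matrix.conjTranspose_one]
    simp)
  rw [Matrix.posDef_iff_dotProduct_mulVec, and_iff_right hH]
  refine forall₂_congr fun v _ => ?_
  have h1 : (star v ⬝ᵥ (B - (c : ℂ) • 1).mulVec v).re =
      (star v ⬝ᵥ B.mulVec v).re - c * ∑ i, ‖v i‖ ^ 2 := by
    have h2 : star v ⬝ᵥ v = ((∑ i, ‖v i‖ ^ 2 : ℝ) : ℂ) := by
      simp [dotProduct, ← Complex.conj_mul', Complex.ofReal_sum]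
    rw [Matrix.sub_mulVec, dotProduct_sub, Matrix.smul_mulVec, Matrix.one_mulVec, dotProduct_smul,
      h2, smul_eq_mul, ← Complex.ofReal_mul, Complex.sub_re, Complex.ofReal_re]
  have h3 := hH.im_star_dotProduct_mulVec_self v
  rw [← h1, Complex.lt_def]
  simp only [Complex.zero_re, Complex.zero_im, and_iff_left_iff_imp]
  exact fun _ => h3.symm

/-- The minimum λ among the eigenvalues of the spectral theorem is exactly the threshold below which
B - c is positive definite. A real eigenvalue μ below λ is impossible, since an eigenvector
annihilates the form of B - μ. The algorithms use only this threshold property. -/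
theorem exists_isSmallestEigenvalue [Nonempty ι] {B : Matrix ι ι ℂ} (hB : B.IsHermitian) :
    ∃ lam : ℝ, IsSmallestEigenvalue B lam ∧
      (∀ c : ℝ, (B - (c : ℂ) • 1).PosDef ↔ c < lam) ∧ ∃ i, lam = hB.eigenvalues i := by
  obtain ⟨i, hi⟩ := Finite.exists_min hB.eigenvalues
  have h1 : ∀ c : ℝ, (B - (c : ℂ) • 1).PosDef ↔ c < hB.eigenvalues i := fun c => by
    rw [posDef_sub_smul_one_iff hB]
    exact ⟨fun h => h i, fun h j => h.trans_le (hi j)⟩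
  refine ⟨hB.eigenvalues i, ⟨?_, ?_⟩, h1, i, rfl⟩
  · refine Module.End.hasEigenvalue_of_hasEigenvector
      (x := WithLp.ofLp (hB.eigenvectorBasis i)) ⟨?_, ?_⟩
    · rw [Module.End.mem_eigenspace_iff, Matrix.toLin'_apply, hB.mulVec_eigenvectorBasis]
      rfl
    · intro h
      refine hB.eigenvectorBasis.orthonormal.ne_zero i ?_
      ext j
      exact congrFun h j
  · intro μ hμ
    obtain ⟨v, hv, hv0⟩ := hμ.exists_hasEigenvector
    rw [Module.End.mem_eigenspace_iff, Matrix.toLin'_apply] at hv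
    by_contra hlt
    have h2 := ((h1 μ).mpr (not_le.mp hlt))
    rw [Matrix.posDef_iff_dotProduct_mulVec] at h2
    have h3 := h2.2 hv0
    rw [Matrix.sub_mulVec, hv, Matrix.smul_mulVec, Matrix.one_mulVec, sub_self,
      dotProduct_zero] at h3
    exact lt_irrefl _ h3

end

/-! ### Hermitian matrices as real symmetric matrices of twice the size -/

section

variable {ι : Type}

/-- The real symmetric matrix `[[Re, -Im], [Im, Re]]`. -/
def realify (B : Matrix ι ι ℂ) : Matrix (Bool × ι) (Bool × ι) ℝ :=
  Matrix.of fun i j => bif Bool.xor i.1 j.1 then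
    (bif i.1 then (B i.2 j.2).im else -(B i.2 j.2).im) else (B i.2 j.2).re

theorem realify_isHermitian {B : Matrix ι ι ℂ} (hB : B.IsHermitian) :
    (realify B).IsHermitian := by
  ext ⟨b, i⟩ ⟨b', j⟩
  have h := hB.apply i j
  have h1 := congrArg Complex.re h
  have h2 := congrArg Complex.im h
  simp only [RCLike.star_def, Complex.conj_re, Complex.conj_im] at h1 h2
  cases b <;> cases b' <;> simp [realify] <;> linarith

/-- The two halves of x are the real and imaginary parts of a complex vector. For Hermitian `B` the
complex form is real, so positivity of one form is positivity of the other. -/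
theorem realify_form [Fintype ι] (B : Matrix ι ι ℂ) (x : Bool × ι → ℝ) :
    star x ⬝ᵥ (realify B).mulVec x =
      (star (fun i => (⟨x (false, i), x (true, i)⟩ : ℂ)) ⬝ᵥ
        B.mulVec fun i => (⟨x (false, i), x (true, i)⟩ : ℂ)).re := by
  simp only [dotProduct, Matrix.mulVec, Fintype.sum_prod_type, Fintype.sum_bool, Complex.re_sum,
    Complex.im_sum, Pi.star_apply, star_trivial, Complex.mul_re, RCLike.star_def, Complex.conj_re,
    Complex.conj_im, Complex.mul_im, realify, Matrix.of_apply, Bool.xor_true, Bool.xor_false,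
    Bool.not_true, Bool.not_false, cond_true, cond_false]
  rw [← Finset.sum_add_distrib]
  refine Finset.sum_congr rfl fun i _ => ?_
  rw [← Finset.sum_add_distrib, ← Finset.sum_add_distrib, Finset.mul_sum, Finset.mul_sum,
    Finset.mul_sum, Finset.mul_sum, ← Finset.sum_add_distrib, ← Finset.sum_sub_distrib]
  refine Finset.sum_congr rfl fun j _ => ?_
  ring

theorem realify_posDef_iff [Fintype ι] {B : Matrix ι ι ℂ} (hB : B.IsHermitian) :
    (realify B).PosDef ↔ B.PosDef := by
  classical
  have h := posDef_sub_smul_one_iff_re hB 0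
  rw [Complex.ofReal_zero, zero_smul, sub_zero] at h
  rw [h, Matrix.posDef_iff_dotProduct_mulVec, and_iff_right (realify_isHermitian hB)]
  constructor
  · intro hx v hv
    have := hx (x := fun p => bif p.1 then (v p.2).im else (v p.2).re) (by
      intro h0
      apply hv
      funext i
      exact Complex.ext (congrFun h0 (false, i)) (congrFun h0 (true, i)))
    rw [realify_form] at this
    simpa using this
  · intro hv x hx
    rw [realify_form]
    have := hv (fun i => ⟨x (false, i), x (true, i)⟩) (by
      intro h0
      apply hx
      funext ⟨b, i⟩
      have h1 := congrFun h0 i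
      cases b
      · exact congrArg Complex.re h1
      · exact congrArg Complex.im h1)
    simpa using this

theorem realify_smul_sub [DecidableEq ι] (B : Matrix ι ι ℂ) (u w : ℝ) :
    realify ((u : ℂ) • B - (w : ℂ) • 1) = u • realify B - w • 1 := by
  ext ⟨b, i⟩ ⟨b', j⟩
  by_cases h : i = j <;> cases b <;> cases b' <;> simp [realify, Matrix.one_apply, h]

end

end ParamQC

end

noncomputable section

namespace ParamQC

/-! ### Reading encoded Hamiltonians -/

theorem tokens_encUnary (m : ℕ) (x : List Symbol) :
    tokens (encUnary m ++ x) = List.replicate m true :: tokens x := by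
  rw [← tokens_block, encUnary, List.map_replicate, List.append_assoc]
  rfl

theorem tokens_encNat (m : ℕ) (x : List Symbol) :
    tokens (encNat m ++ x) = m.bits :: tokens x := by
  rw [← tokens_block, encNat, encodeNat_eq_bits, List.append_assoc]
  rfl

theorem tokens_encInt (z : ℤ) (x : List Symbol) :
    tokens (encInt z ++ x) = (decide (z < 0) :: z.natAbs.bits) :: tokens x := by
  rw [← tokens_block, encInt, encNat, encodeNat_eq_bits, List.cons_append, List.append_assoc]
  rfl

def ratTokens (q : ℚ) : List (List Bool) :=
  [decide (q.num < 0) :: q.num.natAbs.bits, q.den.bits]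

theorem tokens_encRat (q : ℚ) (x : List Symbol) :
    tokens (encRat q ++ x) = ratTokens q ++ tokens x := by
  rw [encRat, List.append_assoc, tokens_encInt, tokens_encNat]
  rfl

theorem tokInt_num (z : ℤ) : tokInt (decide (z < 0) :: z.natAbs.bits) = z := by
  rw [tokInt, List.headD_cons, List.tail_cons, ofBits_bits]
  by_cases h : z < 0
  · simp only [h, decide_true, cond_true]; omega
  · simp only [h, decide_false, cond_false]; omega

theorem tokens_flatMap {ι : Type} {f : ι → List Symbol} {g : ι → List (List Bool)}
    (h : ∀ i x, tokens (f i ++ x) = g i ++ tokens x) (L : List ι) (x : List Symbol) :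
    tokens (L.flatMap f ++ x) = L.flatMap g ++ tokens x := by
  induction L with
  | nil => simp
  | cons i L ih => rw [List.flatMap_cons, List.append_assoc, h, ih, List.flatMap_cons,
      List.append_assoc]

/-- The tokens of a term other than the first one. -/
def LocalTerm.raw {n : ℕ} (h : LocalTerm n) : RawTerm :=
  ((List.finRange h.arity).map fun i => List.replicate (h.qubit i) true,
    (List.range (2 ^ h.arity)).flatMap fun i => (List.range (2 ^ h.arity)).flatMap fun j =>
      ratTokens (h.re (bitString _ i) (bitString _ j)) ++
        ratTokens (h.im (bitString _ i) (bitString _ j)))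

theorem LocalTerm.tokens_encode {n : ℕ} (h : LocalTerm n) (x : List Symbol) :
    tokens (h.encode ++ x) =
      (List.replicate h.arity true :: (h.raw.1 ++ h.raw.2)) ++ tokens x := by
  rw [LocalTerm.encode, List.append_assoc, List.append_assoc, tokens_encUnary,
    tokens_flatMap (g := fun i => [List.replicate (h.qubit i) true])
      (fun i x => tokens_encUnary _ x),
    tokens_flatMap (g := fun i => (List.range (2 ^ h.arity)).flatMap fun j =>
      ratTokens (h.re (bitString _ i) (bitString _ j)) ++
        ratTokens (h.im (bitString _ i) (bitString _ j)))
      (fun i x => tokens_flatMap (fun j x => by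
        rw [List.append_assoc, tokens_encRat, tokens_encRat, List.append_assoc]) _ x)]
  simp [LocalTerm.raw, ← List.map_eq_flatMap]

theorem tokens_encHamiltonian (k : ℕ) {n : ℕ} (H : Hamiltonian n) (x : List Symbol) :
    tokens (encHamiltonian k H ++ x) = List.replicate k true :: List.replicate n true ::
      List.replicate (List.length H) true ::
        ((H.flatMap fun h => List.replicate h.arity true :: (h.raw.1 ++ h.raw.2)) ++ tokens x) := by
  rw [encHamiltonian, List.append_assoc, List.append_assoc, tokens_encUnary, tokens_encUnary,
    encList, List.append_assoc, tokens_encUnary, tokens_flatMap LocalTerm.tokens_encode]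

theorem length_flatMap_const {ι β : Type} {f : ι → List β} {m : ℕ} (l : List ι)
    (h : ∀ i, (f i).length = m) : (l.flatMap f).length = l.length * m := by
  simp [List.length_flatMap, h]

theorem getD_flatMap {ι β : Type} {f : ι → List β} {m : ℕ} (h : ∀ i, (f i).length = m) (d : β)
    (l : List ι) : ∀ (a : ℕ) (ha : a < l.length) (b : ℕ), b < m →
    (l.flatMap f).getD (m * a + b) d = (f l[a]).getD b d := by
  induction l with
  | nil => simp
  | cons i l ih =>
    intro a ha b hb
    rw [List.flatMap_cons]
    cases a with
    | zero =>
      rw [mul_zero, zero_add, List.getD_append _ _ _ _ (by rw [h]; exact hb)]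
      rfl
    | succ a =>
      rw [List.getD_append_right _ _ _ _ (by rw [h]; nlinarith), h,
        show m * (a + 1) + b - m = m * a + b by rw [mul_add, mul_one]; omega,
        ih a (by simpa using ha) b hb]
      rfl

theorem LocalTerm.length_raw {n : ℕ} (h : LocalTerm n) : h.raw.1.length = h.arity ∧
    h.raw.2.length = 2 ^ (h.arity + (h.arity + 2)) := by
  refine ⟨by simp [LocalTerm.raw], ?_⟩
  rw [LocalTerm.raw]
  dsimp only
  rw [length_flatMap_const (m := 2 ^ h.arity * 4), List.length_range]
  · ring
  · intro i
    rw [length_flatMap_const (m := 4), List.length_range]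
    intro j
    rfl

theorem LocalTerm.getD_raw {n : ℕ} (h : LocalTerm n) {i j b : ℕ} (hi : i < 2 ^ h.arity)
    (hj : j < 2 ^ h.arity) (hb : b < 4) :
    h.raw.2.getD (4 * (2 ^ h.arity * i + j) + b) [] =
      (ratTokens (h.re (bitString _ i) (bitString _ j)) ++
        ratTokens (h.im (bitString _ i) (bitString _ j))).getD b [] := by
  rw [show 4 * (2 ^ h.arity * i + j) + b = (2 ^ h.arity * 4) * i + (4 * j + b) by ring,
    LocalTerm.raw]
  dsimp only
  rw [getD_flatMap (m := 2 ^ h.arity * 4) _ _ _ i (by simpa using hi) _ (by omega),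
    getD_flatMap (m := 4) _ _ _ j (by simpa using hj) _ hb, List.getElem_range, List.getElem_range]
  · intro; rfl
  · intro i
    rw [length_flatMap_const (m := 4), List.length_range]
    intro j
    rfl

theorem parseStep_raw {n : ℕ} (h : LocalTerm n) (x : List (List Bool)) (acc : List RawTerm) :
    parseStep ((List.replicate h.arity true :: (h.raw.1 ++ h.raw.2)) ++ x, acc) =
      (x, acc ++ [h.raw]) := by
  obtain ⟨h1, h2⟩ := h.length_raw
  have h3 : (List.replicate h.arity true ++
      (List.replicate h.arity true ++ [true, true])).length = h.arity + (h.arity + 2) := by simp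
  rw [parseStep]
  simp only [List.cons_append, List.headD_cons, List.tail_cons, List.append_assoc, h3,
    List.length_replicate]
  rw [List.drop_left' h1, List.take_left' h1, List.drop_left' h2, List.take_left' h2]

theorem parse_raw {n : ℕ} (H : List (LocalTerm n)) (x : List (List Bool)) :
    parse (List.replicate H.length true)
      ((H.flatMap fun h => List.replicate h.arity true :: (h.raw.1 ++ h.raw.2)) ++ x) =
      (x, H.map LocalTerm.raw) := by
  have key : ∀ acc, (List.replicate H.length true).foldl (fun s _ => parseStep s)
      ((H.flatMap fun h => List.replicate h.arity true :: (h.raw.1 ++ h.raw.2)) ++ x, acc) =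
      (x, acc ++ H.map LocalTerm.raw) := by
    induction H with
    | nil => simp
    | cons h H ih =>
      intro acc
      rw [List.length_cons, List.replicate_succ, List.foldl_cons, List.flatMap_cons,
        List.append_assoc, parseStep_raw, ih, List.map_cons, List.append_assoc]
      rfl
  exact key []

/-! ### Basis states as increasing lists -/

theorem mem_basis {n : ℕ} (k : ℕ) {s : List ℕ} :
    s ∈ basis (List.replicate k true) (List.replicate n true) ↔
      s.length = k ∧ s.Pairwise (· < ·) ∧ ∀ a ∈ s, a < n := by
  induction k generalizing s with
  | zero =>
    simp only [basis, List.replicate_zero, List.foldl_nil, List.mem_singleton]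
    constructor
    · rintro rfl; simp
    · rintro ⟨h, -⟩; exact List.eq_nil_of_length_eq_zero h
  | succ k ih =>
    rw [basis, List.replicate_succ', List.foldl_append, List.foldl_cons, List.foldl_nil,
      ← basis, List.mem_flatMap]
    constructor
    · rintro ⟨t, ht, hs⟩
      obtain ⟨a, ha, rfl⟩ := List.mem_map.mp hs
      obtain ⟨h1, h2, h3⟩ := ih.mp ht
      rw [List.mem_filter] at ha
      simp only [List.length_replicate, List.mem_range, List.all_eq_true, decide_eq_true_eq] at ha
      refine ⟨by simp [h1], List.pairwise_cons.mpr ⟨ha.2, h2⟩, ?_⟩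
      intro b hb
      rcases List.mem_cons.mp hb with rfl | hb
      exacts [ha.1, h3 b hb]
    · rintro ⟨h1, h2, h3⟩
      cases s with
      | nil => simp at h1
      | cons a t =>
        rw [List.pairwise_cons] at h2
        refine ⟨t, ih.mpr ⟨by simpa using h1, h2.2, fun b hb => h3 b (by simp [hb])⟩, ?_⟩
        refine List.mem_map.mpr ⟨a, List.mem_filter.mpr ⟨?_, ?_⟩, rfl⟩
        · simpa using h3 a (by simp)
        · simpa using h2.1

theorem nodup_basis {n : ℕ} (k : ℕ) :
    (basis (List.replicate k true) (List.replicate n true)).Nodup := by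
  induction k with
  | zero => simp [basis]
  | succ k ih =>
    rw [basis, List.replicate_succ', List.foldl_append, List.foldl_cons, List.foldl_nil,
      ← basis, List.nodup_flatMap]
    refine ⟨fun t _ => ?_, ?_⟩
    · refine (List.nodup_range.filter _).map fun a b h => ?_
      simpa using h
    · refine List.Pairwise.imp ?_ ih
      intro s t hst u hs ht
      obtain ⟨a, _, rfl⟩ := List.mem_map.mp hs
      obtain ⟨b, _, h⟩ := List.mem_map.mp ht
      exact hst (List.cons.inj h).2.symm

def toBits (n : ℕ) (s : List ℕ) : Fin n → Bool := fun i => decide ((i : ℕ) ∈ s)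

theorem toBits_inj {n : ℕ} {s t : List ℕ} (hs : s.Pairwise (· < ·)) (hs' : ∀ a ∈ s, a < n)
    (ht : t.Pairwise (· < ·)) (ht' : ∀ a ∈ t, a < n) (h : toBits n s = toBits n t) : s = t := by
  have hst : ∀ a, a ∈ s ↔ a ∈ t := by
    intro a
    constructor
    · intro ha
      have := congrFun h ⟨a, hs' a ha⟩
      simpa [toBits, ha] using this
    · intro ha
      have := congrFun h ⟨a, ht' a ha⟩
      simpa [toBits, ha] using this
  have hn : ∀ {s : List ℕ}, s.Pairwise (· < ·) → s.Nodup := fun hs => hs.imp fun h => ne_of_lt h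
  exact List.Perm.eq_of_pairwise (fun a b _ _ h1 h2 => absurd h1 (not_lt.mpr h2.le)) hs ht
    ((List.perm_ext_iff_of_nodup (hn hs) (hn ht)).mpr hst)

theorem hammingWeight_toBits {n : ℕ} {s : List ℕ} (hs : s.Pairwise (· < ·))
    (hs' : ∀ a ∈ s, a < n) : hammingWeight (toBits n s) = s.length := by
  have hn : s.Nodup := hs.imp fun h => ne_of_lt h
  rw [hammingWeight, ← List.toFinset_card_of_nodup hn]
  refine Finset.card_bij (fun i _ => (i : ℕ)) ?_ ?_ ?_
  · intro i hi
    simpa [toBits] using hi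
  · intro i _ j _ h
    exact Fin.ext h
  · intro a ha
    have ha : a ∈ s := List.mem_toFinset.mp ha
    exact ⟨⟨a, hs' a ha⟩, by simpa [toBits] using ha, rfl⟩

theorem exists_toBits {n : ℕ} (x : Fin n → Bool) : ∃ s : List ℕ, s.Pairwise (· < ·) ∧
    (∀ a ∈ s, a < n) ∧ toBits n s = x := by
  refine ⟨(List.range n).filter fun a => decide (∃ h : a < n, x ⟨a, h⟩ = true),
    List.Pairwise.filter _ List.pairwise_lt_range, ?_, ?_⟩
  · intro a ha
    simpa using (List.mem_filter.mp ha).1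
  · funext i
    rw [toBits, Bool.eq_iff_iff]
    simp

/-! ### The matrix of a Hamiltonian -/

theorem agree_iff {n : ℕ} (h : LocalTerm n) {s t : List ℕ} (hs : ∀ a ∈ s, a < n)
    (ht : ∀ a ∈ t, a < n) : agree h.raw.1 s t = true ↔
      ∀ i, i ∉ Set.range h.qubit → toBits n s i = toBits n t i := by
  have hQ : ∀ i : Fin n, (i : ℕ) ∈ h.raw.1.map List.length ↔ i ∈ Set.range h.qubit := by
    intro i
    simp [LocalTerm.raw, Fin.ext_iff]
  simp only [agree, Bool.and_eq_true, List.all_eq_true, Bool.or_eq_true, decide_eq_true_eq]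
  constructor
  · rintro ⟨h1, h2⟩ i hi
    rw [toBits, toBits, Bool.eq_iff_iff, decide_eq_true_eq, decide_eq_true_eq]
    rw [← hQ] at hi
    exact ⟨fun h => (h1 _ h).resolve_right hi, fun h => (h2 _ h).resolve_right hi⟩
  · intro hi
    have h1 : ∀ i : Fin n, ((i : ℕ) ∈ s ↔ (i : ℕ) ∈ t) ∨ (i : ℕ) ∈ h.raw.1.map List.length := by
      intro i
      by_cases hq : i ∈ Set.range h.qubit
      · exact .inr ((hQ i).mpr hq)
      · left
        have := hi i hq
        rwa [toBits, toBits, Bool.eq_iff_iff, decide_eq_true_eq, decide_eq_true_eq] at this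
    exact ⟨fun a ha => (h1 ⟨a, hs a ha⟩).imp_left fun h => h.mp ha,
      fun a ha => (h1 ⟨a, ht a ha⟩).imp_left fun h => h.mpr ha⟩

theorem bitString_rowIndex {n : ℕ} (h : LocalTerm n) (s : List ℕ) :
    bitString h.arity (rowIndex h.raw.1 s) = toBits n s ∘ h.qubit ∧
      rowIndex h.raw.1 s < 2 ^ h.arity := by
  constructor
  · funext i
    rw [bitString, rowIndex, testBit_ofBits]
    simp [LocalTerm.raw, List.getD, toBits]
  · have := ofBits_lt (h.raw.1.map fun l => decide (l.length ∈ s))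
    rwa [List.length_map, h.length_raw.1] at this

theorem termEntry_eq {n : ℕ} (h : LocalTerm n) {Δ : ℕ}
    (hΔ : ∀ t ∈ h.raw.2, ofBits t ≠ 0 → ofBits t ∣ Δ) {s t : List ℕ} (hs : ∀ a ∈ s, a < n)
    (ht : ∀ a ∈ t, a < n) :
    ((termEntry Δ 0 h.raw s t : ℤ) : ℝ) = Δ * (h.op (toBits n s) (toBits n t)).re ∧
    ((termEntry Δ 2 h.raw s t : ℤ) : ℝ) = Δ * (h.op (toBits n s) (toBits n t)).im := by
  classical
  obtain ⟨hs1, hs2⟩ := bitString_rowIndex h s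
  obtain ⟨ht1, ht2⟩ := bitString_rowIndex h t
  have hmem : ∀ i, h.raw.2.getD i [] = [] ∨ h.raw.2.getD i [] ∈ h.raw.2 := by
    intro i
    by_cases hi : i < h.raw.2.length
    · right; simp [List.getD, hi]
    · left; simp [List.getD, hi]
  -- The default value `[]` of `getD` would stand for the denominator zero, so the token really
  -- occurs in the list and its value divides `Δ`.
  have hcast : ∀ (q : ℚ) (i : ℕ), h.raw.2.getD i [] = q.den.bits →
      ((q.num * ((Δ / ofBits q.den.bits : ℕ) : ℤ) : ℤ) : ℝ) = Δ * (q : ℝ) := by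
    intro q i hi
    have hd : q.den ∣ Δ := by
      rcases hmem i with h1 | h1
      · rw [h1] at hi
        have := congrArg ofBits hi
        rw [ofBits_bits] at this
        exact absurd this.symm q.den_nz
      · have := hΔ _ h1
        rw [hi, ofBits_bits] at this
        exact this q.den_nz
    have hq : (q.den : ℝ) ≠ 0 := Nat.cast_ne_zero.mpr q.den_nz
    rw [ofBits_bits]
    obtain ⟨e, rfl⟩ := hd
    rw [Nat.mul_div_cancel_left _ (Nat.pos_of_ne_zero q.den_nz)]
    rw [Rat.cast_def]
    push_cast
    field_simp
  by_cases ha : agree h.raw.1 s t = true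
  · have hop := (agree_iff h hs ht).mp ha
    have h0 := h.getD_raw hs2 ht2 (b := 0) (by omega)
    have h1 := h.getD_raw hs2 ht2 (b := 1) (by omega)
    have h2 := h.getD_raw hs2 ht2 (b := 2) (by omega)
    have h3 := h.getD_raw hs2 ht2 (b := 3) (by omega)
    rw [hs1, ht1] at h0 h1 h2 h3
    rw [add_zero] at h0
    rw [termEntry, termEntry, ha, cond_true, cond_true, h.length_raw.1, add_zero, h0, h2, h1, h3,
      LocalTerm.op, Matrix.of_apply, if_pos hop]
    simp only [ratTokens, List.cons_append, List.nil_append, List.getD_cons_zero,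
      List.getD_cons_succ, tokInt_num]
    exact ⟨hcast _ _ h1, hcast _ _ h3⟩
  · have hop := mt (agree_iff h hs ht).mpr ha
    rw [Bool.not_eq_true] at ha
    rw [termEntry, termEntry, ha, LocalTerm.op, Matrix.of_apply, if_neg hop]
    simp

theorem sumEntry_eq {n : ℕ} (H : List (LocalTerm n)) {Δ : ℕ}
    (hΔ : ∀ h ∈ H, ∀ t ∈ h.raw.2, ofBits t ≠ 0 → ofBits t ∣ Δ) {s t : List ℕ}
    (hs : ∀ a ∈ s, a < n) (ht : ∀ a ∈ t, a < n) :
    ((sumEntry Δ 0 (H.map LocalTerm.raw) s t : ℤ) : ℝ) =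
      Δ * (Hamiltonian.op H (toBits n s) (toBits n t)).re ∧
    ((sumEntry Δ 2 (H.map LocalTerm.raw) s t : ℤ) : ℝ) =
      Δ * (Hamiltonian.op H (toBits n s) (toBits n t)).im := by
  induction H with
  | nil => simp [sumEntry, Hamiltonian.op]
  | cons h H ih =>
    obtain ⟨h1, h2⟩ := ih fun g hg => hΔ g (by simp [hg])
    obtain ⟨h3, h4⟩ := termEntry_eq h (hΔ h (by simp)) hs ht
    simp only [sumEntry, Hamiltonian.op, List.map_cons, List.sum_cons, Int.cast_add,
      Matrix.add_apply, Complex.add_re, Complex.add_im, mul_add] at h1 h2 ⊢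
    rw [h1, h2, h3, h4]
    exact ⟨rfl, rfl⟩

end ParamQC

end

noncomputable section

namespace ParamQC

open scoped ComplexOrder

/-! ### The listed matrix and the restricted Hamiltonian -/

abbrev WeightBasis (n k : ℕ) := {x : Fin n → Bool // hammingWeight x = k}

/-- The increasing lists of length `k` of numbers less than `n`. -/
abbrev basisLists (n k : ℕ) : List (List ℕ) :=
  basis (List.replicate k true) (List.replicate n true)

theorem mem_realIndices {L : List (List ℕ)} {p : Bool × List ℕ} :
    p ∈ realIndices L ↔ p.2 ∈ L := by
  obtain ⟨b, s⟩ := p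
  cases b <;> simp [realIndices]

theorem nodup_realIndices {L : List (List ℕ)} (hL : L.Nodup) : (realIndices L).Nodup := by
  refine List.Nodup.append (hL.map fun s t h => (Prod.mk.inj h).2)
    (hL.map fun s t h => (Prod.mk.inj h).2) ?_
  intro p hp hq
  obtain ⟨s, _, rfl⟩ := List.mem_map.mp hp
  obtain ⟨t, _, h⟩ := List.mem_map.mp hq
  exact Bool.noConfusion (Prod.mk.inj h).1

def indexMap (n k : ℕ) (i : Fin (realIndices (basisLists n k)).length) :
    Bool × WeightBasis n k :=
  ((realIndices (basisLists n k))[i].1, ⟨toBits n (realIndices (basisLists n k))[i].2, by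
    obtain ⟨h1, h2, h3⟩ := (mem_basis k).mp (mem_realIndices.mp
      (List.getElem_mem (l := realIndices (basisLists n k)) i.2))
    exact (hammingWeight_toBits h2 h3).trans h1⟩)

theorem indexMap_bijective (n k : ℕ) : Function.Bijective (indexMap n k) := by
  constructor
  · intro i j h
    obtain ⟨h1, h2⟩ := Prod.mk.inj h
    obtain ⟨-, hi, hi'⟩ := (mem_basis k).mp (mem_realIndices.mp
      (List.getElem_mem (l := realIndices (basisLists n k)) i.2))
    obtain ⟨-, hj, hj'⟩ := (mem_basis k).mp (mem_realIndices.mp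
      (List.getElem_mem (l := realIndices (basisLists n k)) j.2))
    have h3 := toBits_inj hi hi' hj hj' (congrArg Subtype.val h2)
    exact Fin.ext ((nodup_realIndices (nodup_basis k)).getElem_inj_iff.mp (Prod.ext h1 h3))
  · rintro ⟨b, x, hx⟩
    obtain ⟨s, hs, hs', rfl⟩ := exists_toBits x
    rw [hammingWeight_toBits hs hs'] at hx
    have hmem : (b, s) ∈ realIndices (basisLists n k) :=
      mem_realIndices.mpr ((mem_basis k).mpr ⟨hx, hs, hs'⟩)
    obtain ⟨i, hi, h⟩ := List.getElem_of_mem hmem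
    refine ⟨⟨i, hi⟩, ?_⟩
    simp only [indexMap, Fin.getElem_fin, h]

def indexEquiv (n k : ℕ) :
    Fin (realIndices (basisLists n k)).length ≃ Bool × WeightBasis n k :=
  Equiv.ofBijective _ (indexMap_bijective n k)

/-- The link between the algorithm and the mathematics: increasing lists of length k enumerate the
basis states of weight k without repetition, so the listed matrix is the scaled realification up to
a renaming of indices. -/
theorem realMatrix_eq {n k : ℕ} (H : Hamiltonian n) {Δ : ℕ}
    (hΔ : ∀ h ∈ H, ∀ t ∈ h.raw.2, ofBits t ≠ 0 → ofBits t ∣ Δ) :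
    (Int.castRingHom ℝ).mapMatrix (toMatrix (realIndices (basisLists n k)).length
      (realMatrix Δ (List.map LocalTerm.raw H) (basisLists n k))) =
      ((Δ : ℝ) • realify (H.restrict k)).submatrix (indexEquiv n k) (indexEquiv n k) := by
  ext i j
  obtain ⟨-, -, hi⟩ := (mem_basis k).mp (mem_realIndices.mp
    (List.getElem_mem (l := realIndices (basisLists n k)) i.2))
  obtain ⟨-, -, hj⟩ := (mem_basis k).mp (mem_realIndices.mp
    (List.getElem_mem (l := realIndices (basisLists n k)) j.2))
  obtain ⟨h1, h2⟩ := sumEntry_eq H hΔ hi hj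
  have h3 : entry (realMatrix Δ (List.map LocalTerm.raw H) (basisLists n k)) i j =
      realEntry Δ (List.map LocalTerm.raw H) (realIndices (basisLists n k))[i]
        (realIndices (basisLists n k))[j] := by
    simp [entry, realMatrix, List.getD]
  rw [RingHom.mapMatrix_apply, Matrix.map_apply, toMatrix, Matrix.of_apply, h3,
    Matrix.submatrix_apply, Matrix.smul_apply, realify, Matrix.of_apply, realEntry]
  change _ = (Δ : ℝ) • (bif Bool.xor (realIndices (basisLists n k))[i].1
    (realIndices (basisLists n k))[j].1 then
    (bif (realIndices (basisLists n k))[i].1 then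
      (H.op (toBits n (realIndices (basisLists n k))[i].2)
        (toBits n (realIndices (basisLists n k))[j].2)).im else
      -(H.op (toBits n (realIndices (basisLists n k))[i].2)
        (toBits n (realIndices (basisLists n k))[j].2)).im)
    else (H.op (toBits n (realIndices (basisLists n k))[i].2)
        (toBits n (realIndices (basisLists n k))[j].2)).re)
  simp only [Fin.getElem_fin] at *
  cases Bool.xor (realIndices (basisLists n k))[(i : ℕ)].1 (realIndices (basisLists n k))[(j : ℕ)].1
  · simpa using h1
  · cases (realIndices (basisLists n k))[(i : ℕ)].1
    · simpa using h2
    · simpa using h2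

theorem Hamiltonian.op_isHermitian {n : ℕ} {H : Hamiltonian n} (hH : H.TermsHermitian) :
    H.op.IsHermitian := by
  have key : ∀ H : List (LocalTerm n), (∀ h ∈ H, h.op.IsHermitian) →
      (List.map LocalTerm.op H).sum.IsHermitian := by
    intro H
    induction H with
    | nil => simp
    | cons h H ih =>
      intro hH
      rw [List.map_cons, List.sum_cons]
      exact (hH h (by simp)).add (ih fun g hg => hH g (by simp [hg]))
  exact key H hH

theorem Hamiltonian.restrict_isHermitian {n : ℕ} {H : Hamiltonian n} (hH : H.TermsHermitian)
    (k : ℕ) : (H.restrict k).IsHermitian := (Hamiltonian.op_isHermitian hH).submatrix _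

theorem length_realMatrix (Δ : ℕ) (H : List RawTerm) (L : List (List ℕ)) :
    (realMatrix Δ H L).length = (realIndices L).length := by simp [realMatrix]

theorem realMatrix_isSymm {n k : ℕ} {H : Hamiltonian n} (hH : H.TermsHermitian) {Δ : ℕ}
    (hΔ : ∀ h ∈ H, ∀ t ∈ h.raw.2, ofBits t ≠ 0 → ofBits t ∣ Δ) :
    (toMatrix (realIndices (basisLists n k)).length
      (realMatrix Δ (List.map LocalTerm.raw H) (basisLists n k))).IsSymm := by
  have h1 := realMatrix_eq (k := k) H hΔ
  have h2 := realify_isHermitian (Hamiltonian.restrict_isHermitian hH k)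
  ext i j
  have h3 := h2.apply (indexEquiv n k i) (indexEquiv n k j)
  have h4 := congrFun (congrFun h1 i) j
  have h5 := congrFun (congrFun h1 j) i
  simp only [RingHom.mapMatrix_apply, Matrix.map_apply, Int.coe_castRingHom,
    Matrix.submatrix_apply, Matrix.smul_apply, smul_eq_mul, star_trivial] at h3 h4 h5
  rw [Matrix.transpose_apply]
  exact_mod_cast h5.trans ((congrArg _ h3).trans h4.symm)

/-- The tested matrix represents uΔB - w = uΔ(B - w/(uΔ)). Renaming indices, realification and
multiplication by the positive number uΔ preserve positive definiteness in both directions. -/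
theorem posTest_iff_posDef {n k : ℕ} {H : Hamiltonian n} (hH : H.TermsHermitian) {Δ : ℕ}
    (hΔ0 : 0 < Δ) (hΔ : ∀ h ∈ H, ∀ t ∈ h.raw.2, ofBits t ≠ 0 → ofBits t ∣ Δ)
    {A : List (List ℤ)} (hA : A.length = (realIndices (basisLists n k)).length) {u w : ℤ}
    (hu : 0 < u) (hAM : toMatrix _ A = u • toMatrix (realIndices (basisLists n k)).length
      (realMatrix Δ (List.map LocalTerm.raw H) (basisLists n k)) - w • 1) :
    posTest A = true ↔ (H.restrict k - ((w / (u * Δ) : ℝ) : ℂ) • 1).PosDef := by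
  have hB := Hamiltonian.restrict_isHermitian hH k
  have hc : (0 : ℝ) < u * Δ := mul_pos (by exact_mod_cast hu) (by exact_mod_cast hΔ0)
  have h1 : (Int.castRingHom ℝ).mapMatrix (toMatrix (realIndices (basisLists n k)).length A) =
      (realify (((u * Δ : ℝ) : ℂ) • H.restrict k - ((w : ℝ) : ℂ) • 1)).submatrix
        (indexEquiv n k) (indexEquiv n k) := by
    have hs : ∀ (c : ℤ) (X : Matrix (Fin (realIndices (basisLists n k)).length)
        (Fin (realIndices (basisLists n k)).length) ℤ), (Int.castRingHom ℝ).mapMatrix (c • X) =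
        (c : ℝ) • (Int.castRingHom ℝ).mapMatrix X := fun c X => by
      ext
      simp only [RingHom.mapMatrix_apply, Matrix.map_apply, Matrix.smul_apply, smul_eq_mul,
        Int.coe_castRingHom, Int.cast_mul]
    rw [hAM, map_sub, hs, hs, realMatrix_eq H hΔ, realify_smul_sub, map_one, mul_smul,
      Matrix.submatrix_sub, Matrix.submatrix_smul, Matrix.submatrix_smul]
    simp [Matrix.submatrix_one_equiv, Matrix.submatrix_smul]
  have h2 : ((u * Δ : ℝ) : ℂ) • H.restrict k - ((w : ℝ) : ℂ) • 1 =
      ((u * Δ : ℝ) : ℂ) • (H.restrict k - ((w / (u * Δ) : ℝ) : ℂ) • 1) := by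
    rw [smul_sub, smul_smul, ← Complex.ofReal_mul, mul_div_cancel₀ _ hc.ne']
  have h3 : (H.restrict k - ((w / (u * Δ) : ℝ) : ℂ) • 1).IsHermitian := hB.sub (by
    rw [Matrix.IsHermitian, Matrix.conjTranspose_smul, Matrix.conjTranspose_one]
    simp)
  have h4 : (((u * Δ : ℝ) : ℂ) • H.restrict k - ((w : ℝ) : ℂ) • 1).IsHermitian := by
    rw [h2, Matrix.IsHermitian, Matrix.conjTranspose_smul, h3]
    simp
  have hsymm : (toMatrix (realIndices (basisLists n k)).length A).IsSymm := by
    rw [hAM]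
    exact ((realMatrix_isSymm hH hΔ).smul u).sub (Matrix.isSymm_one.smul w)
  rw [posTest_iff hA hsymm, h1]
  have h6 : ∀ (X : Matrix (Bool × WeightBasis n k) (Bool × WeightBasis n k) ℝ),
      (X.submatrix (indexEquiv n k) (indexEquiv n k)).PosDef ↔ X.PosDef := fun X =>
    ⟨fun h => by simpa using h.submatrix (indexEquiv n k).symm.injective,
      fun h => h.submatrix (indexEquiv n k).injective⟩
  rw [h6, realify_posDef_iff h4, h2]
  constructor
  · intro h
    have h7 := h.smul (inv_pos.mpr (Complex.zero_lt_real.mpr hc))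
    rwa [inv_smul_smul₀ (Complex.ofReal_ne_zero.mpr hc.ne')] at h7
  · exact fun h => h.smul (Complex.zero_lt_real.mpr hc)

/-! ### The common denominator -/

theorem commonDenom_pos (l : List (List Bool)) : 0 < commonDenom l := by
  refine List.prod_pos fun x hx => ?_
  obtain ⟨t, _, rfl⟩ := List.mem_map.mp hx
  by_cases h : ofBits t = 0
  · simp [h]
  · simpa [h] using Nat.pos_of_ne_zero h

theorem dvd_commonDenom {l : List (List Bool)} {t : List Bool} (ht : t ∈ l) (h0 : ofBits t ≠ 0) :
    ofBits t ∣ commonDenom l := by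
  have : (bif decide (ofBits t = 0) then 1 else ofBits t) ∣ commonDenom l :=
    List.dvd_prod (List.mem_map_of_mem ht)
  simpa [h0] using this

/-! ### The input of the algorithms -/

section

variable {n : ℕ} (k : ℕ) (H : Hamiltonian n) (x : List Symbol)

theorem inputTerms_eq :
    inputTerms (encHamiltonian k H ++ x) = (tokens x, List.map LocalTerm.raw H) := by
  rw [inputTerms, tokens_encHamiltonian]
  exact parse_raw H _

theorem dvd_inputDenom : ∀ h ∈ H, ∀ t ∈ h.raw.2, ofBits t ≠ 0 →
    ofBits t ∣ commonDenom (tokens (encHamiltonian k H ++ x)) := by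
  intro h hh t ht
  refine dvd_commonDenom ?_
  rw [tokens_encHamiltonian]
  simp only [List.mem_cons, List.mem_append, List.mem_flatMap]
  exact .inr (.inr (.inr (.inl ⟨h, hh, .inr (.inr ht)⟩)))

theorem inputMatrix_eq : inputMatrix (encHamiltonian k H ++ x) (basisLists n k) =
    realMatrix (commonDenom (tokens (encHamiltonian k H ++ x))) (List.map LocalTerm.raw H)
      (basisLists n k) := by
  rw [inputMatrix, inputTerms_eq]

variable {H}

theorem lowEnergy_iff (hH : H.TermsHermitian) (a b : ℚ) :
    lowEnergy (encHamiltonian k H ++ encRat a ++ encRat b) (basisLists n k) = true ↔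
      ¬ (H.restrict k - ((a : ℝ) : ℂ) • 1).PosDef := by
  rw [List.append_assoc, lowEnergy, inputMatrix_eq, inputTerms_eq, tokens_encRat]
  simp only [ratTokens, List.cons_append, List.nil_append, List.headD_cons, List.getD_cons_succ,
    List.getD_cons_zero, ofBits_bits, tokInt_num, Bool.not_eq_true', ← Bool.not_eq_true]
  set Δ := commonDenom (tokens (encHamiltonian k H ++ (encRat a ++ encRat b)))
  have hΔ0 : 0 < Δ := commonDenom_pos _
  have hl := length_realMatrix Δ (List.map LocalTerm.raw H) (basisLists n k)
  rw [posTest_iff_posDef hH hΔ0 (dvd_inputDenom k H _) ((length_shift _ _ _).trans hl)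
    (Int.natCast_pos.mpr a.den_pos) (toMatrix_shift hl _ _)]
  have h1 : (((a.num * (Δ : ℤ) : ℤ) : ℝ) / (((a.den : ℤ) : ℝ) * Δ)) = a := by
    have : (Δ : ℝ) ≠ 0 := Nat.cast_ne_zero.mpr hΔ0.ne'
    rw [Rat.cast_def]
    push_cast
    rw [mul_div_mul_right _ _ this]
  rw [h1]

end

/-! ### Binary search -/

/-- Invariant of the bisection: `lam` lies in the interval from `z` (excluded) to z + 2^|l|, where
|l| is the number of remaining rounds and the next step is half the length. -/
theorem searchStep_foldl {M : List (List ℤ)} {Δ : ℤ} {lam : ℝ}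
    (h : ∀ z : ℤ, posTest (shift 1 (z * Δ) M) = true ↔ (z : ℝ) < lam) (l : List Bool) :
    ∀ z : ℤ, (z : ℝ) < lam → lam ≤ z + 2 ^ l.length →
      (((l.foldl (fun s _ => searchStep M Δ s) (z, 2 ^ l.length / 2)).1 : ℤ) : ℝ) < lam ∧
      lam ≤ ((l.foldl (fun s _ => searchStep M Δ s) (z, 2 ^ l.length / 2)).1 : ℤ) + 1 := by
  induction l with
  | nil => intro z h1 h2; simpa using ⟨h1, h2⟩
  | cons b l ih =>
    intro z h1 h2
    have h3 : 2 ^ (b :: l).length / 2 = 2 ^ l.length := by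
      rw [List.length_cons, pow_succ, Nat.mul_div_cancel _ two_pos]
    rw [List.foldl_cons, h3, searchStep, Nat.div2_val]
    have h4 := h (z + (2 ^ l.length : ℕ))
    dsimp only
    rw [List.length_cons, pow_succ] at h2
    cases hc : posTest (shift 1 ((z + ((2 ^ l.length : ℕ) : ℤ)) * Δ) M)
    · rw [hc] at h4
      simp only [Bool.false_eq_true, false_iff, not_lt] at h4
      push_cast at h4
      exact ih z h1 h4
    · have h5 := h4.mp hc
      refine ih (z + ((2 ^ l.length : ℕ) : ℤ)) h5 ?_
      push_cast
      linarith

theorem search_spec {M : List (List ℤ)} {Δ : ℤ} {lam : ℝ} {l : List Bool}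
    (h : ∀ z : ℤ, posTest (shift 1 (z * Δ) M) = true ↔ (z : ℝ) < lam)
    (h1 : -(2 : ℝ) ^ l.length < lam) (h2 : lam ≤ 2 ^ l.length) :
    ((search M Δ l : ℤ) : ℝ) < lam ∧ lam ≤ (search M Δ l : ℤ) + 1 := by
  have h3 := searchStep_foldl h (true :: l) (-((2 ^ l.length : ℕ) : ℤ)) (by push_cast; exact h1) (by
    rw [List.length_cons, pow_succ]; push_cast; linarith)
  have h4 : 2 ^ (true :: l).length / 2 = 2 ^ l.length := by
    rw [List.length_cons, pow_succ, Nat.mul_div_cancel _ two_pos]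
  rw [h4] at h3
  exact h3

/-! ### An a priori bound on the spectrum, and the approximation -/

theorem sum_map_flatten (l : List (List ℤ)) (f : ℤ → ℤ) :
    (l.flatten.map f).sum = (l.map fun r => (r.map f).sum).sum := by
  induction l with
  | nil => rfl
  | cons r l ih => rw [List.flatten_cons, List.map_append, List.sum_append, ih, List.map_cons,
      List.sum_cons]

theorem absSum_tab (D : ℕ) (f : ℕ → ℕ → ℤ) :
    absSum (tab (List.range D) f) = ∑ i : Fin D, ∑ j : Fin D, |f i j| := by
  rw [absSum, sum_map_flatten, tab, List.map_map, sum_map_range]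
  refine Finset.sum_congr rfl fun i _ => ?_
  rw [Function.comp_apply, List.map_map, sum_map_range]
  refine Finset.sum_congr rfl fun j _ => ?_
  simp

theorem abs_form_le {ι : Type} [Fintype ι] (R : Matrix ι ι ℝ) (x : ι → ℝ) :
    |x ⬝ᵥ R.mulVec x| ≤ (∑ i, ∑ j, |R i j|) * ∑ i, x i ^ 2 := by
  simp only [dotProduct, Matrix.mulVec]
  rw [Finset.sum_mul]
  refine (Finset.abs_sum_le_sum_abs _ _).trans (Finset.sum_le_sum fun i _ => ?_)
  rw [Finset.mul_sum, Finset.sum_mul]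
  refine (Finset.abs_sum_le_sum_abs _ _).trans (Finset.sum_le_sum fun j _ => ?_)
  have h : ∀ i, x i ^ 2 ≤ ∑ i, x i ^ 2 := fun i =>
    Finset.single_le_sum (f := fun i => x i ^ 2) (fun i _ => sq_nonneg _) (Finset.mem_univ i)
  have h1 : |x i * x j| ≤ ∑ i, x i ^ 2 := by
    rw [abs_le]
    constructor <;> nlinarith [h i, h j, sq_nonneg (x i + x j), sq_nonneg (x i - x j)]
  rw [show x i * (R i j * x j) = R i j * (x i * x j) by ring, abs_mul]
  exact mul_le_mul_of_nonneg_left h1 (abs_nonneg _)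

/-- The sum of the absolute values of the entries bounds the quadratic form on unit vectors, which
gives the initial bracket of the search. A vector is needed for the second half: the empty matrix is
positive definite. -/
theorem posDef_sub_smul_of_lt {ι : Type} [Fintype ι] [DecidableEq ι] {R : Matrix ι ι ℝ}
    (hR : R.IsHermitian) {c : ℝ} (hc : ∑ i, ∑ j, |R i j| < c) :
    (R - (-c) • (1 : Matrix ι ι ℝ)).PosDef ∧
      (Nonempty ι → ¬ (R - c • (1 : Matrix ι ι ℝ)).PosDef) := by
  have hsq : ∀ x : ι → ℝ, x ⬝ᵥ x = ∑ i, x i ^ 2 := fun x => by simp [dotProduct, sq]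
  have hform : ∀ (c : ℝ) (x : ι → ℝ), x ⬝ᵥ (R - c • (1 : Matrix ι ι ℝ)).mulVec x =
      x ⬝ᵥ R.mulVec x - c * ∑ i, x i ^ 2 := fun c x => by
    rw [Matrix.sub_mulVec, dotProduct_sub, Matrix.smul_mulVec, Matrix.one_mulVec, dotProduct_smul,
      hsq, smul_eq_mul]
  have hpos : ∀ x : ι → ℝ, x ≠ 0 → 0 < ∑ i, x i ^ 2 := fun x hx => by
    obtain ⟨i, hi⟩ := Function.ne_iff.mp hx
    exact Finset.sum_pos' (fun i _ => sq_nonneg _)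
      ⟨i, Finset.mem_univ i, by have := sq_pos_of_ne_zero hi; simpa using this⟩
  constructor
  · rw [Matrix.posDef_iff_dotProduct_mulVec]
    refine ⟨hR.sub (by rw [Matrix.IsHermitian, Matrix.conjTranspose_smul]; simp), fun x hx => ?_⟩
    rw [star_trivial, hform]
    have h1 := abs_le.mp (abs_form_le R x)
    nlinarith [hpos x hx]
  · rintro ⟨i⟩ h
    rw [Matrix.posDef_iff_dotProduct_mulVec] at h
    have hx : (Pi.single i 1 : ι → ℝ) ≠ 0 := fun h => by simpa using congrFun h i
    have h2 := h.2 hx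
    rw [star_trivial, hform] at h2
    have h1 := abs_le.mp (abs_form_le R (Pi.single i 1))
    nlinarith [hpos _ hx]

theorem exists_weightBasis {n k : ℕ} (h : k ≤ n) : Nonempty (WeightBasis n k) := by
  have h1 : (List.range k).Pairwise (· < ·) := List.pairwise_lt_range
  refine ⟨⟨toBits n (List.range k), ?_⟩⟩
  rw [hammingWeight_toBits h1 fun a ha => (List.mem_range.mp ha).trans_le h, List.length_range]

/-- Testing 2^t Δ B against zΔ compares z with 2^t λ. The search ends with z < 2^t λ ≤ z + 1, and
division by 2^t gives the error bound. -/
theorem lowestEnergy_spec {n k : ℕ} {H : Hamiltonian n} (hH : H.TermsHermitian) (hk : k ≤ n)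
    (t : ℕ) : ∃ lam : ℝ, IsSmallestEigenvalue (H.restrict k) lam ∧
      |lam - ((lowestEnergy (encHamiltonian k H ++ encUnary t) (basisLists n k) : ℤ) : ℝ) / 2 ^ t| ≤
        1 / 2 ^ t := by
  have := exists_weightBasis hk
  obtain ⟨lam, hlam, hpd, -⟩ :=
    exists_isSmallestEigenvalue (Hamiltonian.restrict_isHermitian hH k)
  refine ⟨lam, hlam, ?_⟩
  have htok : tokens (encUnary t) = [List.replicate t true] := by
    have := tokens_encUnary t []
    rwa [List.append_nil] at this
  rw [lowestEnergy, inputMatrix_eq, inputTerms_eq, htok, List.headD_cons, List.length_replicate]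
  set Δ := commonDenom (tokens (encHamiltonian k H ++ encUnary t))
  have hΔ0 : 0 < Δ := commonDenom_pos _
  have hdvd := dvd_inputDenom k H (encUnary t)
  have hl := length_realMatrix Δ (List.map LocalTerm.raw H) (basisLists n k)
  set D := (realIndices (basisLists n k)).length
  set M := shift ((2 ^ t : ℕ) : ℤ) 0 (realMatrix Δ (List.map LocalTerm.raw H) (basisLists n k))
  have hM : M.length = D := (length_shift _ _ _).trans hl
  have hMm : toMatrix D M = ((2 ^ t : ℕ) : ℤ) • toMatrix D (realMatrix Δ
      (List.map LocalTerm.raw H) (basisLists n k)) := by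
    rw [toMatrix_shift hl, zero_smul, sub_zero]
  have hΔr : (1 : ℝ) ≤ Δ := by exact_mod_cast hΔ0
  have h2t : (0 : ℝ) < 2 ^ t := by positivity
  have hw : ∀ w : ℤ, posTest (shift 1 w M) = true ↔ (w : ℝ) / (2 ^ t * Δ) < lam := by
    intro w
    rw [posTest_iff_posDef hH hΔ0 hdvd (u := ((2 ^ t : ℕ) : ℤ)) (w := w)
      ((length_shift _ _ _).trans hM) (by positivity)
      (by rw [toMatrix_shift hM, one_smul, hMm]), hpd]
    push_cast
    rfl
  have hz : ∀ z : ℤ, posTest (shift 1 (z * Δ) M) = true ↔ (z : ℝ) < 2 ^ t * lam := by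
    intro z
    rw [hw, div_lt_iff₀ (by positivity)]
    push_cast
    rw [← mul_assoc, mul_lt_mul_iff_of_pos_right (by linarith), mul_comm lam]
  have hsymm : (toMatrix D M).IsSymm := by
    rw [hMm]
    exact (realMatrix_isSymm hH hdvd).smul _
  have hreal : ∀ w : ℤ, posTest (shift 1 w M) = true ↔
      ((Int.castRingHom ℝ).mapMatrix (toMatrix D M) - (w : ℝ) • 1).PosDef := by
    intro w
    have h1 : toMatrix D (shift 1 w M) = toMatrix D M - w • 1 := by
      rw [toMatrix_shift hM, one_smul]
    rw [posTest_iff ((length_shift _ _ _).trans hM)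
      (by rw [h1]; exact hsymm.sub (Matrix.isSymm_one.smul w)), h1, map_sub]
    have h2 : (Int.castRingHom ℝ).mapMatrix (w • (1 : Matrix (Fin D) (Fin D) ℤ)) =
        (w : ℝ) • 1 := by
      ext i j
      simp only [RingHom.mapMatrix_apply, Matrix.map_apply, Matrix.smul_apply, smul_eq_mul,
        Int.coe_castRingHom, Matrix.one_apply]
      split_ifs <;> simp
    rw [h2]
  set m := (absSum M).natAbs.bits.length
  have hS : ∑ i, ∑ j, |(Int.castRingHom ℝ).mapMatrix (toMatrix D M) i j| < ((2 ^ m : ℤ) : ℝ) := by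
    have h1 : absSum M = ∑ i : Fin D, ∑ j : Fin D, |toMatrix D M i j| := by
      have h3 : ∀ f, M = tab (List.range D) f → absSum M =
          ∑ i : Fin D, ∑ j : Fin D, |toMatrix D M i j| := by
        rintro f hf
        rw [hf, absSum_tab]
        refine Finset.sum_congr rfl fun i _ => Finset.sum_congr rfl fun j _ => ?_
        rw [toMatrix, Matrix.of_apply, entry_tab i.2 j.2]
      exact h3 _ (congrArg (fun D => tab (List.range D) _) hl)
    have h2 : absSum M < 2 ^ m := by
      have h3 : (absSum M).natAbs < 2 ^ m := by
        rw [show m = (absSum M).natAbs.size from Nat.size_eq_bits_len _]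
        exact Nat.lt_size_self _
      calc absSum M ≤ ((absSum M).natAbs : ℤ) := Int.le_natAbs
        _ < ((2 ^ m : ℕ) : ℤ) := by exact_mod_cast h3
        _ = 2 ^ m := by push_cast; rfl
    rw [h1] at h2
    have h3 : ((∑ i : Fin D, ∑ j : Fin D, |toMatrix D M i j| : ℤ) : ℝ) < ((2 ^ m : ℤ) : ℝ) := by
      exact_mod_cast h2
    simpa using h3
  have hherm : ((Int.castRingHom ℝ).mapMatrix (toMatrix D M)).IsHermitian := by
    ext i j
    have := hsymm.apply i j
    simp only [RingHom.mapMatrix_apply, Matrix.conjTranspose_apply, Matrix.map_apply, star_trivial,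
      Int.coe_castRingHom, this]
  obtain ⟨hp, hn⟩ := posDef_sub_smul_of_lt hherm hS
  have hne : Nonempty (Fin D) := (indexEquiv n k).nonempty_congr.mpr inferInstance
  -- The bound on the entries confines 2^t Δ λ to the range between -2^m and 2^m; since Δ ≥ 1, the
  -- same range contains 2^t λ.
  have hlow : -(2 : ℝ) ^ m < 2 ^ t * lam := by
    have h1 := (hw (-2 ^ m)).mp ((hreal _).mpr (by push_cast at hp ⊢; exact hp))
    rw [div_lt_iff₀ (by positivity)] at h1
    push_cast at h1
    by_contra h2
    have h3 : (0 : ℝ) < 2 ^ m := by positivity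
    nlinarith [not_lt.mp h2]
  have hhigh : 2 ^ t * lam ≤ (2 : ℝ) ^ m := by
    have h1 := mt (hw (2 ^ m)).mpr (mt (hreal _).mp (by push_cast at hn ⊢; exact hn hne))
    rw [div_lt_iff₀ (by positivity)] at h1
    push_cast at h1
    by_contra h2
    have h3 : (0 : ℝ) < 2 ^ m := by positivity
    nlinarith [not_le.mp h2, not_lt.mp h1]
  obtain ⟨h1, h2⟩ := search_spec (Δ := (Δ : ℤ)) hz hlow hhigh
  rw [show lam = 2 ^ t * lam / 2 ^ t by field_simp, ← sub_div, abs_div, abs_of_pos h2t]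
  refine div_le_div_of_nonneg_right ?_ h2t.le
  rw [abs_le]
  constructor <;> linarith

/-! ### Energies -/

section

variable {n k : ℕ} {H : Hamiltonian n}

theorem sum_weightBasis {R : Type} [AddCommMonoid R] {f : (Fin n → Bool) → R}
    (hf : ∀ x, hammingWeight x ≠ k → f x = 0) : ∑ x, f x = ∑ x : WeightBasis n k, f x :=
  (Fintype.sum_of_injective Subtype.val Subtype.val_injective _ _ (fun x hx => hf x fun h =>
    hx ⟨⟨x, h⟩, rfl⟩) fun _ => rfl).symm

theorem energy_eq {ψ : (Fin n → Bool) → ℂ} (hψ : HasWeight k ψ) : H.energy ψ =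
    (star (fun x : WeightBasis n k => ψ x) ⬝ᵥ
      (H.restrict k).mulVec fun x : WeightBasis n k => ψ x).re := by
  rw [Hamiltonian.energy, dotProduct, dotProduct, sum_weightBasis (k := k)]
  · congr 1
    refine Finset.sum_congr rfl fun x _ => ?_
    congr 1
    rw [Matrix.mulVec, Matrix.mulVec, dotProduct, dotProduct, sum_weightBasis (k := k)]
    · rfl
    · intro y hy
      rw [hψ y hy, mul_zero]
  · intro x hx
    rw [Pi.star_apply, hψ x hx, star_zero, zero_mul]

theorem not_posDef_of_energy_le (hH : H.TermsHermitian) {a : ℝ} {ψ : (Fin n → Bool) → ℂ}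
    (hs : IsState ψ) (hψ : HasWeight k ψ) (h : H.energy ψ ≤ a) :
    ¬ (H.restrict k - (a : ℂ) • 1).PosDef := by
  rw [posDef_sub_smul_one_iff_re (Hamiltonian.restrict_isHermitian hH k)]
  intro hpos
  have h1 : ∑ x : WeightBasis n k, ‖ψ x‖ ^ 2 = 1 := by
    rw [← sum_weightBasis (f := fun x => ‖ψ x‖ ^ 2), hs]
    intro x hx
    rw [hψ x hx]
    simp
  have h2 := hpos (fun x => ψ x) (by
    intro h0
    have h3 : ∀ x : WeightBasis n k, ψ x = 0 := fun x => congrFun h0 x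
    simp [h3] at h1)
  rw [← energy_eq hψ, h1] at h2
  linarith

/-- A nonzero vector on the sector, divided by its norm and extended by zero, is a state of weight
k, so its form is at least b times the squared norm. If no basis state has weight k, the matrix is
empty and positive definite, in agreement with the vacuous hypothesis. -/
theorem posDef_of_lt_energy (hH : H.TermsHermitian) {a b : ℝ} (hab : a < b)
    (h : ∀ ψ, IsState ψ → HasWeight k ψ → b ≤ H.energy ψ) :
    (H.restrict k - (a : ℂ) • 1).PosDef := by
  rw [posDef_sub_smul_one_iff_re (Hamiltonian.restrict_isHermitian hH k)]
  intro v hv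
  have hc : 0 < ∑ i, ‖v i‖ ^ 2 := by
    obtain ⟨i, hi⟩ := Function.ne_iff.mp hv
    refine Finset.sum_pos' (fun i _ => sq_nonneg _) ⟨i, Finset.mem_univ i, ?_⟩
    exact pow_pos (norm_pos_iff.mpr hi) 2
  set c := ∑ i, ‖v i‖ ^ 2
  have hr : 0 < Real.sqrt c := Real.sqrt_pos.mpr hc
  have hr2 : Real.sqrt c ^ 2 = c := Real.sq_sqrt hc.le
  set r := Real.sqrt c
  let ψ : (Fin n → Bool) → ℂ := fun x =>
    if hx : hammingWeight x = k then ((r⁻¹ : ℝ) : ℂ) * v ⟨x, hx⟩ else 0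
  have hψ : HasWeight k ψ := fun x hx => dif_neg hx
  have hval : (fun x : WeightBasis n k => ψ x) = ((r⁻¹ : ℝ) : ℂ) • v := by
    funext x
    exact dif_pos x.2
  have hs : IsState ψ := by
    rw [IsState, sum_weightBasis (k := k)]
    · have : ∀ x : WeightBasis n k, ‖ψ x‖ ^ 2 = (r⁻¹) ^ 2 * ‖v x‖ ^ 2 := fun x => by
        rw [show ψ x = ((r⁻¹ : ℝ) : ℂ) * v x from congrFun hval x, norm_mul, mul_pow,
          Complex.norm_real, Real.norm_of_nonneg (inv_nonneg.mpr hr.le)]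
      simp only [this, ← Finset.mul_sum]
      change (r⁻¹) ^ 2 * c = 1
      rw [← hr2]
      field_simp
    · intro x hx
      rw [hψ x hx]
      simp
  have h1 := h ψ hs hψ
  rw [energy_eq hψ, hval, Matrix.mulVec_smul, star_smul, smul_dotProduct, dotProduct_smul,
    smul_eq_mul, smul_eq_mul, ← mul_assoc, RCLike.star_def, Complex.conj_ofReal,
    ← Complex.ofReal_mul, Complex.re_ofReal_mul] at h1
  have h2 : r⁻¹ * r⁻¹ * c = 1 := by
    rw [← hr2]; field_simp
  have h3 : 0 < r⁻¹ * r⁻¹ := by positivity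
  by_contra h4
  have h5 := not_lt.mp h4
  have h6 : r⁻¹ * r⁻¹ * (star v ⬝ᵥ (H.restrict k).mulVec v).re ≤ r⁻¹ * r⁻¹ * (a * c) :=
    mul_le_mul_of_nonneg_left (by linarith) h3.le
  rw [mul_left_comm, h2, mul_one] at h6
  linarith

end

end ParamQC

end

noncomputable section

namespace ParamQC

open Turing Computability

open Enc (enc)

open scoped ComplexOrder

/-! ### Machines for polynomial-time functions on strings -/

theorem OutputsWithin.mono {Γ Δ : Type} {M : TM2ComputableAux Γ Δ} {x : List Γ} {y : List Δ}
    {T T' : ℕ} (h : OutputsWithin M x y T) (hT : T ≤ T') : OutputsWithin M x y T' := by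
  obtain ⟨n, hn, h⟩ := (outputsWithin_iff _ _ _ _).mp h
  exact (outputsWithin_iff _ _ _ _).mpr ⟨n, hn.trans hT, h⟩

theorem PTm.toPT {α β : Type} [Enc α] [Enc β] {μ : α → ℕ} {f : α → β} (hf : PTm μ f)
    (hμ : PB μ esize) : PT f := by
  obtain ⟨p, q, h⟩ := hf
  exact .of_runs p (hμ.comp (q := q)) h

theorem pb_esize_length : PB (esize : List Symbol → ℕ) List.length :=
  PB.mono ((PB.const_mul .self 6).add_const 1) fun x => esize_string x

theorem PT.exists_machine {f : List Symbol → List Symbol} (hf : PT f) :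
    ∃ (M : TM2ComputableAux Symbol Symbol) (q : Polynomial ℕ),
      ∀ x, OutputsWithin M x (f x) (q.eval x.length) := by
  obtain ⟨M, q, h⟩ := PTm.exists_machine hf .self
  obtain ⟨r, hr⟩ := (pb_esize_length.comp (q := q))
  exact ⟨M, r, fun x => (h x).mono (hr x)⟩

/-- The machine that returns its input. -/
def idMachine (Γ : Type) [Fintype Γ] : TM2ComputableAux Γ Γ :=
  (idComputableInPolyTime (id : List Γ → List Γ)).toTM2ComputableAux

theorem outputsWithin_idMachine {Γ : Type} [Fintype Γ] (x : List Γ) :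
    OutputsWithin (idMachine Γ) x x 1 := by
  have h := (idComputableInPolyTime (id : List Γ → List Γ)).outputsFun x
  rw [show (idComputableInPolyTime (id : List Γ → List Γ)).time = 1 from rfl,
    Polynomial.eval_one] at h
  exact ⟨h⟩

/-- Compiled programs write over `Symbol`. Composition with the identity machine serves to rename
the output symbols to Booleans. -/
theorem PT.exists_machine_bool {f : List Symbol → List Bool} (hf : PT f) :
    ∃ (M : TM2ComputableAux Symbol Bool) (q : Polynomial ℕ),
      ∀ x, OutputsWithin M x (f x) (q.eval x.length) := by
  have h1 : PT fun x => (f x).map Option.some := PT.map (h := fun _ b => Option.some b) hf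
    (by fun_prop)
  obtain ⟨M, q, h⟩ := h1.exists_machine
  obtain ⟨r, hr⟩ := hf.pb_esize.trans pb_esize_length
  refine ⟨compMachine M (idMachine Bool) (fun s => s.getD false), q + 2 * r + 3, fun x => ?_⟩
  have h2 : ((f x).map Option.some).map (fun s : Symbol => s.getD false) = f x := by
    rw [List.map_map]
    exact List.map_id _
  have h4 : OutputsWithin (idMachine Bool) (((f x).map Option.some).map
      fun s : Symbol => s.getD false) (f x) 1 := by
    rw [h2]
    exact outputsWithin_idMachine _
  refine (OutputsWithin.comp M (idMachine Bool) (fun s => s.getD false) (h x) h4).mono ?_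
  have h3 := (length_lt_esize (f x)).trans_le (hr x)
  simp only [List.length_map, Polynomial.eval_add, Polynomial.eval_mul, Polynomial.eval_ofNat]
  omega

/-! ### The parameter -/

/-- The flag tells whether the leading block of ones is still being read; the list counts this block
in unary. -/
def countStep (s : Bool × List Bool) (b : Symbol) : Bool × List Bool :=
  bif s.1 && (b.isSome && b.getD false) then (true, true :: s.2) else (false, s.2)

theorem countStep_foldl (x : List Symbol) : ∀ l : List Bool,
    (x.foldl countStep (true, l)).2.length = (x.takeWhile (· == some true)).length + l.length := by
  have h0 : ∀ (x : List Symbol) (l : List Bool), (x.foldl countStep (false, l)).2 = l := by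
    intro x
    induction x with
    | nil => intro l; rfl
    | cons b x ih => intro l; exact ih l
  induction x with
  | nil => simp
  | cons b x ih =>
    intro l
    rcases b with _ | _ | _
    · rw [List.foldl_cons, show countStep (true, l) none = (false, l) from rfl, h0]
      simp
    · rw [List.foldl_cons, show countStep (true, l) (some false) = (false, l) from rfl, h0]
      simp
    · rw [List.foldl_cons, show countStep (true, l) (some true) = (true, true :: l) from rfl, ih]
      simp
      omega

theorem leadingParam_coe (x : List Symbol) : ((leadingParam x : ℕ+) : ℕ) =
    bif decide ((x.foldl countStep (true, [])).2.length = 0) then 1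
    else (x.foldl countStep (true, [])).2.length := by
  rw [countStep_foldl, List.length_nil, add_zero, leadingParam, Nat.toPNat', Nat.succPNat_coe]
  cases (x.takeWhile (· == some true)).length <;> simp

@[fun_prop]
theorem PT.countStepFoldl {α : Type} [Enc α] {f : α → List Symbol} (hf : PT f) :
    PT fun a => (f a).foldl countStep (true, []) := by
  refine PT.foldl_additive (h := fun _ s b => countStep s b) hf (by fun_prop) ?_
    (fun _ => 100) (by fun_prop) ?_
  · unfold countStep
    fun_prop
  · intro _ s b _
    have h1 := esize_bool true
    have h2 := esize_bool false
    have h3 := esize_bool s.1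
    rw [countStep, esize_prod s]
    cases (s.1 && (b.isSome && b.getD false))
    · rw [cond_false, esize_prod]
      dsimp only
      omega
    · rw [cond_true, esize_prod, esize_cons]
      dsimp only
      omega

@[fun_prop]
theorem PT.leadingParamFn {α : Type} [Enc α] {f : α → List Symbol} (hf : PT f) :
    PT fun a => ((leadingParam (f a) : ℕ+) : ℕ) := by
  have h1 : PT fun x : List Symbol => (x.foldl countStep (true, [])).2.length := by fun_prop
  have h2 := (PT.natEq h1 (.const 0)).cond (.const 1) h1
  exact (h2.of_eq fun x => (leadingParam_coe x).symm).comp hf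

theorem leadingParam_polyTime : Nonempty (TM2ComputableInPolyTime (id : List Symbol → List Symbol)
    (fun m : ℕ+ => encodeNat (m : ℕ)) leadingParam) := by
  have h : PT fun x : List Symbol => ((leadingParam x : ℕ+) : ℕ).bits := by fun_prop
  obtain ⟨M, q, h⟩ := h.exists_machine_bool
  refine ⟨⟨M, q, fun x => Classical.choice ?_⟩⟩
  rw [encodeNat_eq_bits]
  exact h x

theorem leadingParam_encUnary {k : ℕ} (hk : 0 < k) (x : List Symbol) :
    ((leadingParam (encUnary k ++ x) : ℕ+) : ℕ) = k := by
  have h : ((encUnary k ++ x).takeWhile (· == some true)).length = k := by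
    simp [encUnary]
  rw [leadingParam, h, Nat.toPNat', Nat.succPNat_coe, Nat.succ_pred_eq_of_pos hk]

/-! ### Weight-`k` Local Hamiltonian is in `XP` -/

def qubitToken (x : List Symbol) : List Bool := (tokens x).getD 1 []

@[fun_prop]
theorem PT.qubitTokenFn {α : Type} [Enc α] {f : α → List Symbol} (hf : PT f) :
    PT fun a => qubitToken (f a) := by
  unfold qubitToken
  fun_prop

theorem pb_qubitToken : PB (fun x : List Symbol => (qubitToken x).length) esize := by
  have h : PT fun x : List Symbol => qubitToken x := by fun_prop
  exact h.pb_esize.mono fun x => (length_lt_esize _).le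

theorem qubitToken_encHamiltonian {n : ℕ} (k : ℕ) (H : Hamiltonian n) (x : List Symbol) :
    qubitToken (encHamiltonian k H ++ x) = List.replicate n true := by
  rw [qubitToken, tokens_encHamiltonian]
  rfl

/-- Here k is a constant of the program, so (n + 1)^k is polynomial in the input. The comparison
with `leadingParam` rejects strings of another parameter, as the definition of a slice demands. -/
theorem PT.lowEnergy_slice (k : ℕ) : PT fun x : List Symbol =>
    [decide (((leadingParam x : ℕ+) : ℕ) = k) &&
      lowEnergy x (basis (List.replicate k true) (qubitToken x))] := by
  have hμ : PB (fun x : List Symbol => (qubitToken x).length + esize x + 1) esize :=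
    (pb_qubitToken.add .self).add_const 1
  have hμ' : PB (esize : List Symbol → ℕ) fun x : List Symbol =>
      (qubitToken x).length + esize x + 1 := PB.self.mono fun x => by omega
  have h1 : PTm (fun x : List Symbol => (qubitToken x).length + esize x + 1)
      fun x : List Symbol => basis (List.replicate k true) (qubitToken x) := by
    refine PTm.basisFn (.const _) (by fun_prop) hμ' ?_
    refine (PB.self.pow k).mono fun x => ?_
    rw [List.length_replicate]
    exact Nat.pow_le_pow_left (by omega) k
  have h2 : PT fun x : List Symbol => basis (List.replicate k true) (qubitToken x) := h1.toPT hμ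
  fun_prop

theorem weightLocalHamiltonian_mem_classXP (l : ℕ) (p : Polynomial ℕ) :
    weightLocalHamiltonian l p ∈ classXP Symbol := by
  refine ⟨leadingParam_polyTime, fun k => ?_⟩
  obtain ⟨M, q, h⟩ := (PT.lowEnergy_slice k).exists_machine_bool
  have key : ∀ I : LHInstance, I.Valid l p → leadingParam I.encode = k →
      I.k = k ∧ ([decide (((leadingParam I.encode : ℕ+) : ℕ) = k) && lowEnergy I.encode
        (basis (List.replicate k true) (qubitToken I.encode))] = [true] ↔
      ¬ (I.H.restrict I.k - ((I.a : ℝ) : ℂ) • 1).PosDef) := by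
    intro I hI hk
    have h1 : ((leadingParam I.encode : ℕ+) : ℕ) = I.k := by
      rw [LHInstance.encode, encHamiltonian, List.append_assoc, List.append_assoc,
        List.append_assoc]
      exact leadingParam_encUnary hI.k_pos _
    have hk' : I.k = k := by rw [← h1, hk]
    refine ⟨hk', ?_⟩
    rw [← lowEnergy_iff I.k hI.hermitian I.a I.b, h1, hk', decide_eq_true rfl, Bool.true_and]
    have h2 : qubitToken I.encode = List.replicate I.n true := by
      rw [LHInstance.encode, List.append_assoc, qubitToken_encHamiltonian]
    rw [h2]
    rw [LHInstance.encode, hk', List.cons.injEq]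
    simp
  refine ⟨M, q, fun x hx => ?_, fun x hx => ?_⟩
  · obtain ⟨⟨I, hI, ⟨ψ, hs, hw, he⟩, rfl⟩, hk⟩ := hx
    have h1 := (key I hI hk).2.mpr (not_posDef_of_energy_le hI.hermitian hs hw he)
    exact h1 ▸ h I.encode
  · have hfalse : [decide (((leadingParam x : ℕ+) : ℕ) = k) && lowEnergy x
        (basis (List.replicate k true) (qubitToken x))] = [false] := by
      rcases hx with ⟨⟨I, hI, hno, rfl⟩, hk⟩ | hk
      · have h1 := mt (key I hI hk).2.mp (not_not.mpr (posDef_of_lt_energy hI.hermitian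
          (lt_of_gap hI.gap) hno))
        simpa using h1
      · have : ((leadingParam x : ℕ+) : ℕ) ≠ k := fun h => hk (PNat.coe_injective h)
        simp [this]
    exact hfalse ▸ h x

/-! ### The dimension of the weight space -/

theorem finrank_weightSpace_le (n k : ℕ) : Module.finrank ℂ (weightSpace n k) ≤ n ^ k := by
  have h1 : {ψ : (Fin n → Bool) → ℂ | ∃ x : Fin n → Bool, hammingWeight x = k ∧
      ψ = Pi.single x 1} = Set.range fun x : WeightBasis n k => Pi.single (x : Fin n → Bool) 1 := by
    ext ψ
    constructor
    · rintro ⟨x, hx, rfl⟩; exact ⟨⟨x, hx⟩, rfl⟩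
    · rintro ⟨⟨x, hx⟩, rfl⟩; exact ⟨x, hx, rfl⟩
  rw [weightSpace, h1]
  refine (finrank_range_le_card _).trans ?_
  have h2 : Fintype.card (WeightBasis n k) = n.choose k := by
    rw [show n.choose k = ((Finset.univ : Finset (Fin n)).powersetCard k).card by simp,
      ← Fintype.card_coe]
    refine Fintype.card_congr ⟨fun x => ⟨Finset.univ.filter fun i => x.1 i = true,
      Finset.mem_powersetCard.mpr ⟨Finset.subset_univ _, x.2⟩⟩, fun s => ⟨fun i => decide (i ∈ s.1),
      ?_⟩, ?_, ?_⟩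
    · have := (Finset.mem_powersetCard.mp s.2).2
      simpa [hammingWeight] using this
    · intro x; ext i; simp
    · intro s; ext i; simp
  rw [h2]
  exact Nat.choose_le_pow n k

/-! ### Computing the smallest eigenvalue -/

theorem polynomial_eval_le_pow (q : Polynomial ℕ) :
    ∃ C d : ℕ, ∀ m, 1 ≤ m → q.eval m ≤ C * m ^ d := by
  refine ⟨q.eval 1, q.natDegree, fun m hm => ?_⟩
  rw [Polynomial.eval_eq_sum_range, Polynomial.eval_eq_sum_range, Finset.sum_mul]
  refine Finset.sum_le_sum fun i hi => ?_
  rw [one_pow, mul_one]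
  exact Nat.mul_le_mul_left _ (Nat.pow_le_pow_right hm (Nat.lt_succ_iff.mp (Finset.mem_range.mp hi)))

/-- The exponent k + 1 is never zero, so the measure dominates the size of every input string and
not only (n + 1)^k. -/
def eigenvalueMeasure (x : List Symbol) : ℕ :=
  ((qubitToken x).length + esize x + 1) ^ (((tokens x).headD []).length + 1)

theorem PTm.lowestEnergy_string : PTm eigenvalueMeasure fun x : List Symbol =>
    intString (lowestEnergy x (basis ((tokens x).headD []) (qubitToken x))) := by
  have hle : ∀ x : List Symbol, (qubitToken x).length + esize x + 1 ≤ eigenvalueMeasure x :=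
    fun x => Nat.le_self_pow (Nat.succ_ne_zero _) _
  have hμ : PB (esize : List Symbol → ℕ) eigenvalueMeasure :=
    PB.self.mono fun x => le_trans (by omega) (hle x)
  have h1 : PTm eigenvalueMeasure fun x : List Symbol =>
      basis ((tokens x).headD []) (qubitToken x) := by
    refine PTm.basisFn (by fun_prop) (by fun_prop) hμ (PB.self.mono fun x => ?_)
    rw [eigenvalueMeasure]
    exact (Nat.pow_le_pow_left (by omega) _).trans
      (Nat.pow_le_pow_right (by omega) (Nat.le_succ _))
  have h2 : PT fun p : List Symbol × List (List ℕ) => intString (lowestEnergy p.1 p.2) := by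
    fun_prop
  have h3 : PTm eigenvalueMeasure fun x : List Symbol =>
      (x, basis ((tokens x).headD []) (qubitToken x)) := (PTm.of_PT .id hμ).pair h1 hμ
  have h4 := PTm.comp (f := fun p : List Symbol × List (List ℕ) =>
    intString (lowestEnergy p.1 p.2)) h2 h3 hμ
  simpa only using h4

theorem exists_eigenvalue_machine : ∃ (M : TM2ComputableAux Symbol Symbol) (c : ℕ),
    ∀ (n k t : ℕ) (H : Hamiltonian n), 0 < k → k ≤ n → H.TermsHermitian →
      ∃ (lam : ℝ) (z : ℤ), IsSmallestEigenvalue (H.restrict k) lam ∧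
        |lam - (z : ℝ) / 2 ^ t| ≤ 1 / 2 ^ t ∧
        OutputsWithin M (encHamiltonian k H ++ encUnary t) (encInt z)
          (c * (encHamiltonian k H ++ encUnary t).length ^ (c * k)) := by
  have hμ : PB (esize : List Symbol → ℕ) eigenvalueMeasure := PB.self.mono fun x =>
    le_trans (by omega) (Nat.le_self_pow (Nat.succ_ne_zero _) ((qubitToken x).length + esize x + 1))
  obtain ⟨M, q, hM⟩ := PTm.exists_machine PTm.lowestEnergy_string hμ
  obtain ⟨C, d, hC⟩ := polynomial_eval_le_pow q
  -- The running time is at most C μ^d with μ the measure, and μ ≤ N^(10 k) on valid inputs. One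
  -- constant has to serve as factor and as exponent.
  refine ⟨M, C + 10 * d, fun n k t H hk hkn hH => ?_⟩
  obtain ⟨lam, hlam, h1⟩ := lowestEnergy_spec hH hkn t
  refine ⟨lam, _, hlam, h1, ?_⟩
  set x := encHamiltonian k H ++ encUnary t
  have hq : qubitToken x = List.replicate n true := qubitToken_encHamiltonian k H _
  have hk' : (tokens x).headD [] = List.replicate k true := by
    rw [tokens_encHamiltonian]; rfl
  have h2 := hM x
  rw [hq, hk', intString_eq] at h2
  refine h2.mono ?_
  have hlen : n + 2 ≤ x.length := by
    simp only [x, encHamiltonian, encUnary, List.length_append, List.length_replicate,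
      List.length_singleton]
    omega
  have hx := esize_string x
  have hm : eigenvalueMeasure x ≤ x.length ^ (10 * k) := by
    rw [eigenvalueMeasure, hq, hk', List.length_replicate, List.length_replicate]
    -- The base of the measure is at most 16 N, and 16 ≤ N^4 because N ≥ 2. The exponent 5(k + 1) is
    -- then at most 10 k because k ≥ 1.
    have h3 : n + esize x + 1 ≤ x.length ^ 5 := by
      have h4 : 2 ^ 4 ≤ x.length ^ 4 := Nat.pow_le_pow_left (by omega) 4
      calc n + esize x + 1 ≤ 2 ^ 4 * x.length := by omega
        _ ≤ x.length ^ 4 * x.length := Nat.mul_le_mul_right _ h4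
        _ = x.length ^ 5 := by ring
    calc _ ≤ (x.length ^ 5) ^ (k + 1) := Nat.pow_le_pow_left h3 _
      _ = x.length ^ (5 * (k + 1)) := by rw [← pow_mul]
      _ ≤ _ := Nat.pow_le_pow_right (by omega) (by omega)
  have hm1 : 1 ≤ eigenvalueMeasure x := Nat.one_le_pow _ _ (Nat.succ_pos _)
  calc q.eval (eigenvalueMeasure x) ≤ C * eigenvalueMeasure x ^ d := hC _ hm1
    _ ≤ C * (x.length ^ (10 * k)) ^ d := by gcongr
    _ = C * x.length ^ (10 * d * k) := by rw [← pow_mul]; ring_nf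
    _ ≤ (C + 10 * d) * x.length ^ ((C + 10 * d) * k) := by
        refine Nat.mul_le_mul (Nat.le_add_right _ _) (Nat.pow_le_pow_right (by omega) ?_)
        exact Nat.mul_le_mul_right _ (Nat.le_add_left _ _)

end ParamQC

end

noncomputable section

namespace ParamQC

open Turing Computability

open Enc (enc)

/-! ### The action of gates -/

theorem Gate.hadamard_mulVec {N : ℕ} (i : Fin N) (φ : (Fin N → Bool) → ℂ) (x : Fin N → Bool) :
    (Gate.hadamard i).op.mulVec φ x =
      (φ (Function.update x i false) +
        (if x i = true then -1 else 1) * φ (Function.update x i true)) / (Real.sqrt 2 : ℂ) := by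
  rw [Matrix.mulVec, dotProduct, Fintype.sum_eq_add (Function.update x i false)
    (Function.update x i true)]
  · have h : ∀ b, ∀ j, j ≠ i → x j = Function.update x i b j := fun b j hj => by
      rw [Function.update_of_ne hj]
    simp only [Gate.op, Matrix.of_apply, if_pos (h _), Function.update_self]
    simp only [Bool.false_eq_true, and_false, if_false, and_true]
    ring
  · intro h
    have := congrFun h i
    simp at this
  · rintro y ⟨h1, h2⟩
    rw [Gate.op, Matrix.of_apply, if_neg, zero_mul]
    intro h
    have h3 : y = Function.update x i (y i) := by
      funext j
      by_cases hj : j = i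
      · subst hj; simp
      · rw [Function.update_of_ne hj, h j hj]
    cases hb : y i
    · exact h1 (hb ▸ h3)
    · exact h2 (hb ▸ h3)

theorem Gate.phase_mulVec {N : ℕ} (i : Fin N) (φ : (Fin N → Bool) → ℂ) (x : Fin N → Bool) :
    (Gate.phase i).op.mulVec φ x =
      (if x i = true then Complex.exp (Complex.I * (Real.pi / 4)) else 1) * φ x := by
  rw [Gate.op, Matrix.mulVec_diagonal]

theorem Gate.cnot_mulVec {N : ℕ} (c t : Fin N) (h : c ≠ t) (φ : (Fin N → Bool) → ℂ)
    (x : Fin N → Bool) :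
    (Gate.cnot c t h).op.mulVec φ x = φ (Function.update x t (xor (x t) (x c))) := by
  rw [Matrix.mulVec, dotProduct, Fintype.sum_eq_single (Function.update x t (xor (x t) (x c)))]
  · simp [Gate.op, Function.update_of_ne h]
  · intro y hy
    rw [Gate.op, Matrix.of_apply, if_neg, zero_mul]
    rintro rfl
    apply hy
    simp [Function.update_of_ne h]

/-! ### Adding unused witness qubits -/

section

variable {m : ℕ} (n : ℕ)

/-- Ancillas are numbered before witness qubits, so adding witness qubits leaves all qubit numbers,
and hence the codes of the gates, unchanged. -/
def liftQubit (i : Fin (m + 0)) : Fin (m + n) := Fin.castAdd n i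

theorem liftQubit_injective : Function.Injective (liftQubit (m := m) n) :=
  fun i j h => by
    have h' := congrArg Fin.val h
    exact Fin.ext h'

def Gate.lift : Gate (m + 0) → Gate (m + n)
  | .hadamard i => .hadamard (liftQubit n i)
  | .phase i => .phase (liftQubit n i)
  | .cnot c t h => .cnot (liftQubit n c) (liftQubit n t) fun e => h (liftQubit_injective n e)

def Circuit.lift (C : Circuit 0 m) : Circuit n m where
  out := liftQubit n C.out
  gates := C.gates.map (Gate.lift n)

variable {n}

theorem update_liftQubit (x : Fin (m + n) → Bool) (i : Fin (m + 0)) (b : Bool) :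
    (fun j => Function.update x (liftQubit n i) b (liftQubit n j)) =
      Function.update (fun j => x (liftQubit n j)) i b ∧
    (fun j => Function.update x (liftQubit n i) b (Fin.natAdd m j)) =
      fun j => x (Fin.natAdd m j) := by
  constructor
  · funext j
    by_cases h : j = i
    · subst h; simp
    · rw [Function.update_of_ne h, Function.update_of_ne ((liftQubit_injective n).ne h)]
  · funext j
    rw [Function.update_of_ne]
    intro h
    have h1 := congrArg Fin.val h
    have h2 := i.2
    simp [liftQubit] at h1
    omega

/-- A lifted gate acts on the first factor of a product state and leaves the witness factor alone.
-/
theorem Gate.lift_mulVec (g : Gate (m + 0)) (φ : (Fin (m + 0) → Bool) → ℂ)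
    (ψ : (Fin n → Bool) → ℂ) :
    (g.lift n).op.mulVec (fun x => φ (fun j => x (liftQubit n j)) *
      ψ (fun j => x (Fin.natAdd m j))) =
      fun x => g.op.mulVec φ (fun j => x (liftQubit n j)) * ψ (fun j => x (Fin.natAdd m j)) := by
  funext x
  cases g with
  | hadamard i =>
    rw [Gate.lift, Gate.hadamard_mulVec, Gate.hadamard_mulVec]
    simp only [(update_liftQubit x i _).1, (update_liftQubit x i _).2]
    ring
  | phase i =>
    rw [Gate.lift, Gate.phase_mulVec, Gate.phase_mulVec, mul_assoc]
  | cnot c t h =>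
    rw [Gate.lift, Gate.cnot_mulVec, Gate.cnot_mulVec]
    simp only [(update_liftQubit x t _).1, (update_liftQubit x t _).2]

theorem Circuit.lift_run (C : Circuit 0 m) (ψ : (Fin n → Bool) → ℂ) :
    (C.lift n).run ψ = fun x => C.run (fun _ => 1) (fun j => x (liftQubit n j)) *
      ψ (fun j => x (Fin.natAdd m j)) := by
  have key : ∀ (l : List (Gate (m + 0))) (φ : (Fin (m + 0) → Bool) → ℂ),
      (l.map (Gate.lift n)).foldl (fun φ g => g.op.mulVec φ)
        (fun x => φ (fun j => x (liftQubit n j)) * ψ (fun j => x (Fin.natAdd m j))) =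
      fun x => l.foldl (fun φ g => g.op.mulVec φ) φ (fun j => x (liftQubit n j)) *
        ψ (fun j => x (Fin.natAdd m j)) := by
    intro l
    induction l with
    | nil => intro φ; rfl
    | cons g l ih =>
      intro φ
      rw [List.map_cons, List.foldl_cons, Gate.lift_mulVec, ih, List.foldl_cons]
  have h0 : initialState m ψ = fun x => initialState m (fun _ : Fin 0 → Bool => (1 : ℂ))
      (fun j => x (liftQubit n j)) * ψ (fun j => x (Fin.natAdd m j)) := by
    funext x
    have h1 : initialState m (fun _ : Fin 0 → Bool => (1 : ℂ)) (fun j => x (liftQubit n j)) =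
        if ∀ i : Fin m, x (Fin.castAdd n i) = false then 1 else 0 := rfl
    rw [initialState, h1]
    split_ifs
    · rw [one_mul]
    · rw [zero_mul]
  rw [Circuit.run, h0]
  exact key C.gates _

/-- The final state is a product and the output qubit belongs to the first factor, so the sum over
the witness register contributes the squared norm of ψ, which is 1. -/
theorem Circuit.lift_acceptProb (C : Circuit 0 m) {ψ : (Fin n → Bool) → ℂ} (hψ : IsState ψ) :
    (C.lift n).acceptProb ψ = C.acceptProb fun _ => 1 := by
  rw [Circuit.acceptProb, Circuit.lift_run,
    ← (Fin.appendEquiv (α := Bool) m n).sum_comp, Fintype.sum_prod_type, Circuit.acceptProb]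
  refine Finset.sum_congr rfl fun u _ => ?_
  have h1 : ∀ v : Fin n → Bool, (fun j => Fin.appendEquiv (α := Bool) m n (u, v)
      (liftQubit n j)) = u := fun v => by
    funext j
    exact Fin.append_left u v j
  have h2 : ∀ v : Fin n → Bool, (fun j => Fin.appendEquiv (α := Bool) m n (u, v)
      (Fin.natAdd m j)) = v := fun v => by
    funext j
    exact Fin.append_right u v j
  have h3 : ∀ v : Fin n → Bool, Fin.appendEquiv (α := Bool) m n (u, v) (C.lift n).out =
      u C.out := fun v => congrFun (h1 v) C.out
  simp only [h1, h2, h3, norm_mul, mul_pow]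
  by_cases h : u C.out = true
  · simp only [if_pos h]
    rw [← Finset.mul_sum, hψ, mul_one]
  · simp [h]

end

/-! ### Circuits as instances of Weight-`k` Quantum Circuit Satisfiability -/

/-- The number m + 4 of witness qubits serves the two conditions on instances: with p(n) ≥ n, the m
ancillas are at most p(n), and the gap 1/3 satisfies 1/3 · p(n) ≥ 4/3 > 1. -/
def liftInstance {m : ℕ} (C : Circuit 0 m) : QCSatInstance :=
  ⟨1, m + 4, m, C.lift (m + 4), 1 / 3, 2 / 3⟩

theorem liftInstance_valid {m : ℕ} (C : Circuit 0 m) {p : Polynomial ℕ}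
    (hp : ∀ n : ℕ, n ≤ p.eval n) : (liftInstance C).Valid p where
  k_pos := one_pos
  ancillas_le := (Nat.le_add_right m 4).trans (hp (m + 4))
  a_mem := by constructor <;> norm_num [liftInstance]
  b_mem := by constructor <;> norm_num [liftInstance]
  gap := by
    have h : ((m + 4 : ℕ) : ℚ) ≤ ((p.eval (m + 4) : ℕ) : ℚ) := by exact_mod_cast hp (m + 4)
    have h' : (0 : ℚ) ≤ m := Nat.cast_nonneg m
    simp only [liftInstance]
    push_cast at h ⊢
    linarith

theorem liftInstance_isYes {m : ℕ} (C : Circuit 0 m) (h : 2 / 3 ≤ C.acceptProb fun _ => 1) :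
    (liftInstance C).IsYes := by
  have hs : IsState (Pi.single (fun j => decide (j = 0)) 1 : (Fin (m + 4) → Bool) → ℂ) := by
    rw [IsState, Fintype.sum_eq_single fun j => decide (j = 0)]
    · simp
    · intro x hx
      simp [Pi.single_eq_of_ne hx]
  refine ⟨Pi.single (fun j : Fin (m + 4) => decide (j = 0)) 1, hs, ?_, ?_⟩
  · intro x hx
    refine Pi.single_eq_of_ne ?_ _
    rintro rfl
    apply hx
    change (Finset.univ.filter fun i : Fin (m + 4) => decide (i = 0) = true).card = 1
    simp [Finset.filter_eq']
  · change (((2 / 3 : ℚ)) : ℝ) ≤ (C.lift (m + 4)).acceptProb _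
    refine le_trans ?_ (C.lift_acceptProb hs).ge
    push_cast
    exact h

theorem liftInstance_isNo {m : ℕ} (C : Circuit 0 m) (h : (C.acceptProb fun _ => 1) ≤ 1 / 3) :
    (liftInstance C).IsNo := by
  intro ψ hs _
  change (C.lift (m + 4)).acceptProb ψ ≤ (((1 / 3 : ℚ)) : ℝ)
  refine (C.lift_acceptProb hs).le.trans ?_
  push_cast
  exact h

/-- The code of a circuit without witness begins with the single separator that stands for zero
witness qubits. Dropping it leaves a string that starts with m in unary, so the number m + 4 can be
written by copying this block; the rest of the code stays the same. -/
def liftString (x : List Symbol) : List Symbol :=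
  encUnary 1 ++ ((x.tail.foldl countStep (true, [])).2.map (fun _ => some true) ++ encUnary 4) ++
    x.tail ++ encRat (1 / 3) ++ encRat (2 / 3)

theorem PT.liftStringFn : PT liftString := by
  have h : PT fun x : List Symbol => (x.tail.foldl countStep (true, [])).2 := by
    fun_prop
  have h1 : PT fun x : List Symbol =>
      (x.tail.foldl countStep (true, [])).2.map fun _ => Option.some true :=
    PT.map (h := fun _ _ => Option.some true) h (by fun_prop)
  unfold liftString
  fun_prop

theorem Gate.encode_lift {m : ℕ} (n : ℕ) (g : Gate (m + 0)) : (g.lift n).encode = g.encode := by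
  cases g <;> rfl

theorem liftString_encode {m : ℕ} (C : Circuit 0 m) :
    liftString C.encode = (liftInstance C).encode := by
  have h1 : C.encode.tail = encUnary m ++ (encUnary C.out ++ encList Gate.encode C.gates) := by
    rw [Circuit.encode, List.append_assoc, List.append_assoc]
    rfl
  have h2 : (C.encode.tail.foldl countStep (true, [])).2.length = m := by
    rw [countStep_foldl, h1]
    simp [encUnary]
  have h3 : (C.encode.tail.foldl countStep (true, [])).2.map (fun _ => some true) ++ encUnary 4 =
      encUnary (m + 4) := by
    rw [List.map_const', h2, encUnary, encUnary, ← List.append_assoc, ← List.replicate_add]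
  have h4 : encList Gate.encode (C.lift (m + 4)).gates = encList Gate.encode C.gates := by
    rw [encList, encList, Circuit.lift, List.length_map, List.flatMap_map]
    simp only [Gate.encode_lift]
  rw [liftString, h3, h1, QCSatInstance.encode]
  change _ = encUnary 1 ++ (encUnary (m + 4) ++ encUnary m ++ encUnary C.out ++
    encList Gate.encode (C.lift (m + 4)).gates) ++ encRat (1 / 3) ++ encRat (2 / 3)
  rw [h4]
  simp only [List.append_assoc]

theorem leadingParam_liftInstance {m : ℕ} (C : Circuit 0 m) :
    leadingParam (liftInstance C).encode = 1 := by
  apply PNat.coe_injective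
  rw [QCSatInstance.encode, List.append_assoc, List.append_assoc]
  exact leadingParam_encUnary one_pos _

/-! ### `P = BQP` from an `XP` algorithm -/

/-- Three machines are chained: the generator of the circuit, the conversion to an instance with k =
1, and the decision procedure for the first slice. The polynomials `Q` and `R` bound the lengths of
the circuit code and of the instance, which exist because output length is linear in input length
and time. -/
theorem classBQP_subset_classP {p : Polynomial ℕ} (hp : ∀ n : ℕ, n ≤ p.eval n)
    (h : weightQuantumCircuitSat p ∈ classXP Symbol) : classBQP Bool ⊆ classP Bool := by
  rintro A ⟨M, q, hyes, hno⟩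
  obtain ⟨M₁, q₁, h₁, h₁'⟩ := h.2 1
  obtain ⟨M₂, q₂, h₂⟩ := PT.liftStringFn.exists_machine
  obtain ⟨c, hc⟩ := OutputsWithin.length_le M
  obtain ⟨c₂, hc₂⟩ := OutputsWithin.length_le M₂
  let Q : Polynomial ℕ := .X + .C c * q
  let R : Polynomial ℕ := Q + .C c₂ * q₂.comp Q
  have key : ∀ x, ∀ m (C : Circuit 0 m), OutputsWithin M x C.encode (q.eval x.length) → ∀ b,
      OutputsWithin M₁ (liftInstance C).encode [b] (q₁.eval (liftInstance C).encode.length) →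
      OutputsWithin (compMachine M (compMachine M₂ M₁ id) id) x [b]
        ((q + (q₂.comp Q + q₁.comp R + 2 * R + 2) + 2 * Q + 2).eval x.length) := by
    intro x m C hx b hb
    have hQ : C.encode.length ≤ Q.eval x.length := by
      simpa [Q] using hc _ _ _ hx
    have h3 := h₂ C.encode
    rw [liftString_encode] at h3
    have hR : (liftInstance C).encode.length ≤ R.eval x.length := by
      have h4 := hc₂ _ _ _ h3
      have h5 : c₂ * q₂.eval C.encode.length ≤ c₂ * q₂.eval (Q.eval x.length) :=
        Nat.mul_le_mul_left _ (polynomial_eval_mono q₂ hQ)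
      simp only [R, Polynomial.eval_add, Polynomial.eval_mul, Polynomial.eval_C,
        Polynomial.eval_comp]
      omega
    refine (OutputsWithin.comp M (compMachine M₂ M₁ id) id hx
      (OutputsWithin.comp M₂ M₁ id (by rw [List.map_id]; exact h3)
        (by rw [List.map_id]; exact hb))).mono ?_
    have h6 := polynomial_eval_mono q₂ hQ
    have h7 := polynomial_eval_mono q₁ hR
    simp only [Polynomial.eval_add, Polynomial.eval_mul, Polynomial.eval_ofNat,
      Polynomial.eval_comp] at *
    omega
  refine ⟨compMachine M (compMachine M₂ M₁ id) id,
    q + (q₂.comp Q + q₁.comp R + 2 * R + 2) + 2 * Q + 2, fun x hx => ?_, fun x hx => ?_⟩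
  · obtain ⟨m, C, hC, hp'⟩ := hyes x hx
    exact key x m C hC true (h₁ _ ⟨⟨liftInstance C, liftInstance_valid C hp,
      liftInstance_isYes C hp', rfl⟩, leadingParam_liftInstance C⟩)
  · obtain ⟨m, C, hC, hp'⟩ := hno x hx
    exact key x m C hC false (h₁' _ (.inl ⟨⟨liftInstance C, liftInstance_valid C hp,
      liftInstance_isNo C hp', rfl⟩, leadingParam_liftInstance C⟩))

/-! ### The inclusion of P in BQP -/

/-- The circuit that flips one ancilla. -/
def flipCircuit : Circuit 0 1 :=
  ⟨0, [.hadamard 0, .phase 0, .phase 0, .phase 0, .phase 0, .hadamard 0]⟩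

def emptyCircuit : Circuit 0 1 := ⟨0, []⟩

theorem emptyCircuit_acceptProb : (emptyCircuit.acceptProb fun _ => 1) = 0 := by
  refine Finset.sum_eq_zero fun x _ => ?_
  split_ifs with h
  · have h1 : ¬ ∀ i : Fin 1, x (Fin.castAdd 0 i) = false := fun h' => by
      have := h' 0
      exact Bool.noConfusion (this.symm.trans h)
    have h2 : emptyCircuit.run (fun _ => 1) x = 0 := if_neg h1
    rw [h2]
    simp
  · rfl

/-- T⁴ = Z because its phase is exp(iπ) = -1, and HZH = X. -/
theorem flipCircuit_run (x : Fin (1 + 0) → Bool) (hx : x 0 = true) :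
    flipCircuit.run (fun _ => 1) x = 1 := by
  have h2 : (Real.sqrt 2 : ℂ) * (Real.sqrt 2 : ℂ) = 2 := by
    rw [← Complex.ofReal_mul, Real.mul_self_sqrt (by norm_num)]
    norm_num
  have h0 : (Real.sqrt 2 : ℂ) ≠ 0 := by
    intro h; rw [h] at h2; norm_num at h2
  have he : Complex.exp (Complex.I * (Real.pi / 4)) * (Complex.exp (Complex.I * (Real.pi / 4)) *
      (Complex.exp (Complex.I * (Real.pi / 4)) * Complex.exp (Complex.I * (Real.pi / 4)))) =
      -1 := by
    rw [← Complex.exp_add, ← Complex.exp_add, ← Complex.exp_add, ← Complex.exp_pi_mul_I]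
    congr 1
    ring
  have hi : ∀ y : Fin (1 + 0) → Bool, initialState 1 (fun _ : Fin 0 → Bool => (1 : ℂ)) y =
      if y 0 = false then 1 else 0 := by
    intro y
    refine if_congr ⟨fun h => h 0, fun h i => ?_⟩ rfl rfl
    rw [Subsingleton.elim i 0]
    exact h
  rw [Circuit.run, flipCircuit]
  simp only [List.foldl_cons, List.foldl_nil, Gate.hadamard_mulVec, Gate.phase_mulVec,
    Function.update_self, hi, Function.update_idem, hx]
  simp only [if_true, Bool.false_eq_true, if_false, one_mul, Bool.true_eq_false, mul_zero,
    add_zero]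
  generalize Complex.exp (Complex.I * (Real.pi / 4)) = e at he ⊢
  generalize (Real.sqrt 2 : ℂ) = s at h0 h2 ⊢
  field_simp
  linear_combination (-1 : ℂ) * he - h2

theorem flipCircuit_acceptProb : 2 / 3 ≤ flipCircuit.acceptProb fun _ => 1 := by
  have h1 : (1 : ℝ) = if (fun _ => true : Fin (1 + 0) → Bool) flipCircuit.out = true then
      ‖flipCircuit.run (fun _ => 1) fun _ => true‖ ^ 2 else 0 := by
    rw [if_pos rfl, flipCircuit_run _ rfl]
    simp
  have h2 := Finset.single_le_sum (f := fun x : Fin (1 + 0) → Bool => if x flipCircuit.out = true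
    then ‖flipCircuit.run (fun _ => 1) x‖ ^ 2 else 0) (fun x _ => by positivity)
    (Finset.mem_univ fun _ => true)
  rw [Circuit.acceptProb]
  rw [← h1] at h2
  linarith

/-- The deterministic machine computes the answer, and only then is a circuit written: the one that
flips its ancilla for the answer `true`, the empty one for `false`. Since the answer has length one,
the second machine adds only a constant to the running time. -/
theorem classP_subset_classBQP : classP Bool ⊆ classBQP Bool := by
  rintro A ⟨M, q, hyes, hno⟩
  have h : PT fun x : List Symbol => bif (x.headD none).getD false then flipCircuit.encode else
    emptyCircuit.encode := by fun_prop
  obtain ⟨M', q', h'⟩ := h.exists_machine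
  have key : ∀ x b, OutputsWithin M x [b] (q.eval x.length) →
      OutputsWithin (compMachine M M' Option.some) x
        (bif b then flipCircuit.encode else emptyCircuit.encode)
        ((q + .C (q'.eval 1) + 4 : Polynomial ℕ).eval x.length) := by
    intro x b hx
    refine (OutputsWithin.comp M M' Option.some hx (h' [some b])).mono ?_
    simp
  refine ⟨compMachine M M' Option.some, q + .C (q'.eval 1) + 4, fun x hx => ?_, fun x hx => ?_⟩
  · exact ⟨1, flipCircuit, key x true (hyes x hx), flipCircuit_acceptProb⟩
  · refine ⟨1, emptyCircuit, key x false (hno x hx), ?_⟩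
    rw [emptyCircuit_acceptProb]
    norm_num

end ParamQC

end

open ParamQC in
theorem mainTheorem2 :
    -- Weight-`k` `l`-Local Hamiltonian is in `XP`
    (∀ (l : ℕ) (p : Polynomial ℕ), weightLocalHamiltonian l p ∈ classXP Symbol) ∧
    -- the span of the weight-`k` basis states has dimension `n^{O(k)}`
    (∀ n k : ℕ, Module.finrank ℂ (weightSpace n k) ≤ n ^ k) ∧
    -- the smallest eigenvalue of the restricted Hamiltonian is computed, to within `2^{-t}`, by one
    -- deterministic machine in time `N^{O(k)}`, where `N` is the length of the input
    (∃ (M : Turing.TM2ComputableAux Symbol Symbol) (c : ℕ),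
      ∀ (n k t : ℕ) (H : Hamiltonian n), 0 < k → k ≤ n → H.TermsHermitian →
        ∃ (lam : ℝ) (z : ℤ), IsSmallestEigenvalue (H.restrict k) lam ∧
          |lam - (z : ℝ) / 2 ^ t| ≤ 1 / 2 ^ t ∧
          OutputsWithin M (encHamiltonian k H ++ encUnary t) (encInt z)
            (c * (encHamiltonian k H ++ encUnary t).length ^ (c * k))) ∧
    -- Weight-`k` Quantum Circuit Satisfiability is not in `XP` unless `P = BQP`
    (∀ p : Polynomial ℕ, (∀ n : ℕ, n ≤ p.eval n) →
      weightQuantumCircuitSat p ∈ classXP Symbol → classP Bool = classBQP Bool) := by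
  exact ⟨ParamQC.weightLocalHamiltonian_mem_classXP, ParamQC.finrank_weightSpace_le,
    ParamQC.exists_eigenvalue_machine, fun _ hp h => Set.Subset.antisymm
      ParamQC.classP_subset_classBQP (ParamQC.classBQP_subset_classP hp h)⟩
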